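/- **Setting.** Consider a finite two-player zero-sum extensive-form game with chance and perfect recall. $\mathcal S=\mathcal S_1\cup\mathcal S_2$ is the set of infosets, $p(s)$ the player acting at $s$, $\mathcal A_s$ the action set of $s$, and $|s|$ the number of nodes of $s$. Player 1's payoff $\mathcal U_1$ takes values in $[-1,1]$ and vanishes off terminal nodes; $\mathcal U_2=-\mathcal U_1$. $\mu_c(h)>0$ is the chance contribution to reaching the node $h$, $\sigma_i(h)$ is the last infoset-action pair of player $i$ before $h$ (or $\emptyset$), and $\sigma(s)=\sigma_{p(s)}(h)$ for $h\in s$. A strategy profile $\pi$ has the sequence form $\mu^\pi(s,a)=\mu^\pi(\sigma(s))\,\pi(a|s)$, $\mu^\pi(\emptyset)=1$; we write $\mu_i$ for the part of player $i$ and $\mu_1^\top\mathbf A\mu_2=\sum_h\mu_c(h)\mu_1(\sigma_1(h))\mu_2(\sigma_2(h))\,\mathcal U_1(h)$. Let $\tau>0$, $\alpha_s>0$, $\eta_s>0$, $\gamma_s\in(0,1]$, and let $\nu_s$ be distributions on $\mathcal A_s$ of full support. Either (Euclidean) $\psi_s(u)=\frac{\alpha_s}{2}\sum_a u_a^2$ for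 all $s$, or (entropy) $\psi_s(u)=\alpha_s(\log|\mathcal A_s|+\sum_a u_a\log u_a)$ for all $s$. A profile is *feasible* if $\pi(\cdot|s)\in\Delta_s:=\{u\in\Delta^{|\mathcal A_s|}:u_a\ge\gamma_s\nu_{s,a}\ \forall a\}$ for all $s$. Let $\gamma>0$ satisfy $\mu^\pi(s,a)\ge\gamma$ for all feasible $\pi$ and all $(s,a)$. Write $D_\psi(x,y)=\psi(x)-\psi(y)-\langle\nabla\psi(y),x-y\rangle$, $$\psi^{\Pi_i}(\mu)=\sum_{s\in\mathcal S_i}\mu(\sigma(s))\,\psi_s\big(\mu(s,\cdot)/\mu(\sigma(s))\big),\qquad \psi^\Pi=\psi^{\Pi_1}+\psi^{\Pi_2}.$$ Let $\pi^*$ be a Nash equilibrium, over feasible profiles, of $\max_{\mu_1}\min_{\mu_2}\ \mu_1^\top\mathbf A\mu_2-\tau\psi^{\Pi_1}(\mu_1)+\tau\psi^{\Pi_2}(\mu_2)$, and $\mu^*$ its sequence form. **Feedback.** For $s\in\mathcal S_i$, with $h'$ ranging over the nodes below action $a$ at some node of $s$, let $$\mathrm{CF}^\pi(s,a)=\sum_{h'}\mu_c(h')\frac{\mu_i^\pi(\sigma_i(h'))}{\mu_i^\pi(s,a)}\mu_{3-i}^\pi(\sigma_{3-i}(h'))\,\mathcal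 U_i(h'),\qquad V^\pi(s,a)=\sum_{s'\in\mathcal S_i:\,(s,a)\sqsubseteq s'}\frac{\mu^\pi(\sigma(s'))}{\mu^\pi(s,a)}\,\psi_{s'}(\pi(\cdot|s')).$$ Fix one of three feedback types and the corresponding multiplier: counterfactual value, $m^\pi_s=1$; trajectory Q-value, $m^\pi_s=1/\mu^\pi(\sigma(s))$; Q-value, $m^\pi_s=\sum_{h\in s}\mu_c(h)\,\mu_{3-i}^\pi(\sigma_{3-i}(h))$. The feedback is the corresponding value of the regularized game, $q^\pi(s,a)=\big(\mathrm{CF}^\pi(s,a)-\tau V^\pi(s,a)\big)/m^\pi_s$. **Lazy update with stochastic feedback.** Let $T\ge1$. Start from $\overline\pi^{(1)}=\pi^{(0)}$, a fixed feasible profile, and an initial prediction $\tilde q^{(0)}$. With $m^{(t)}_s=m^{\pi^{(t)}}_s$, for $t=1,\dots,T$ and every infoset $s$, $$\pi^{(t)}(\cdot|s)=\arg\min_{u\in\Delta_s}\ \langle u,-\tilde q^{(t-1)}(s,\cdot)\rangle+\frac{\tau}{m_s^{(t-1)}}\psi_s(u)+\frac1{\eta_s}D_{\psi_s}(u,\overline\pi^{(t)}(\cdot|s)),$$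 $$\overline\pi^{(t+1)}(\cdot|s)=\arg\min_{u\in\Delta_s}\ \langle u,-\tilde q^{(t)}(s,\cdot)\rangle+\frac{\tau}{m_s^{(t)}}\psi_s(u)+\frac1{\eta_s}D_{\psi_s}(u,\overline\pi^{(t)}(\cdot|s)).$$ Here $(\tilde q^{(t)})_{0\le t\le T}$ is adapted to a filtration $(\mathcal F_t)$, $\mathbb E[\tilde q^{(t)}(s,a)\mid\mathcal F_{t-1}]=q^{\pi^{(t)}}(s,a)$ for $1\le t\le T$, and $\|\mathbf q\|_\infty$ is a constant such that $|\tilde q^{(t)}(s,a)|\le\|\mathbf q\|_\infty$ almost surely for all $0\le t\le T$, $s$, $a$ (hence also $|q^{\pi^{(t)}}(s,a)|\le\|\mathbf q\|_\infty$ a.s. for $t\ge1$). **Constants.** For counterfactual values, trajectory Q-values and Q-values, respectively, $M_1$ is $1$, $1$, $\gamma\min_s\sum_{h\in s}\mu_c(h)$, and $M_2$ is $1$, $1/\gamma$, $1$. Let $\eta_s^{\rm anc}$ be the largest $\eta_{s'}$ over all pairs $(s',a')$ of either player on the paths to nodes of $s$ ($0$ if there are none). Put $C^{\rm diff}_s=\frac2{\alpha_s}\big(\|\mathbf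 q\|_\infty+\frac{\tau\alpha_s}{M_1}\log\frac1\gamma\big)$ (entropy) or $C^{\rm diff}_s=\frac{|\mathcal A_s|}{\alpha_s}\|\mathbf q\|_\infty+\frac{\sqrt{|\mathcal A_s|}\,\tau}{M_1}$ (Euclidean), $C^{\rm diff}_{\max}=\max_sC^{\rm diff}_s$, and $K=\max_s\big(\frac{2\|\mathbf q\|_\infty}{\alpha_s}+\frac\tau{M_1}\log\frac1\gamma\big)$. Then $(C_s^-,C_s^/)$ is - $(0,0)$ for counterfactual values; - $\big(\frac6{\gamma^2}C^{\rm diff}_{\max},\ \frac6{\gamma^2M_1}C^{\rm diff}_{\max}\big)$ (Euclidean) or $(12K/\gamma,\ 12K)$ (entropy) for trajectory Q-values; - $\big(6|s|\,C^{\rm diff}_{\max},\ \frac{6|s|}{M_1}C^{\rm diff}_{\max}\big)$ (Euclidean) or $(12M_2K,\ 12K)$ (entropy) for Q-values. **Theorem.** Suppose that for every infoset $s$: - $\eta_s^{\rm anc}/\eta_s\le\tau/(2C_s^-)$ (no restriction if $C_s^-=0$); - (A) $\max_{h\in s}\sum_{(s',a')\sqsubseteq\sigma_i(h)}\eta_{s'}\le\eta_s$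 for $i=1,2$; - (B) $6\,\eta^{\rm anc}_sK\le1$; - (C) $\eta_s\big(2\|\mathbf q\|_\infty+\frac{\tau\alpha_s}{M_1}\log\frac1\gamma\big)\le1$. Then for every $\delta\in(0,1)$, with probability at least $1-\delta$, $$\begin{aligned}\sum_{t=2}^TD_{\psi^\Pi}\big(\mu^*,\mu^{\overline\pi^{(t)}}\big)\le{}&2\sum_sC_s^/\,\eta_s^{\rm anc}\mu^*(\sigma(s))\sum_{t=1}^T\big|\psi_s(\pi^{(t)}(\cdot|s))-\psi_s(\overline\pi^{(t+1)}(\cdot|s))\big|+\frac4\tau\sum_sC^{\rm diff}_s\mu^*(\sigma(s))\|\mathbf q\|_\infty\eta_sM_2T\\&+\frac2\tau\sum_s\frac{m^{(1)}_s}{\eta_s}\mu^*(\sigma(s))D_{\psi_s}\big(\pi^*(\cdot|s),\overline\pi^{(1)}(\cdot|s)\big)+\frac8\tau M_2\|\mathbf q\|_\infty|\mathcal S|\sqrt{2T\log\tfrac1\delta}.\end{aligned}$$ For counterfactual values and Q-values $M_2=1$, so the last term is $\frac8\tau\|\mathbf q\|_\infty|\mathcal S|\sqrt{2T\log\frac1\delta}$.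 -/

import Mathlib

open MeasureTheory

noncomputable section

/-! ### Two-player zero-sum extensive-form games

`S` is the type of information sets of the two players, `A s` the action set of `s`, and `C` a type
of labels for chance outcomes. A node of the game tree is identified with its history, the list of
chance outcomes and infoset-action pairs on the path from the root. -/

/-- An edge of the game tree: a chance outcome or an action taken at an infoset. -/
abbrev GameStep (S : Type*) (A : S → Type*) (C : Type*) := C ⊕ (Σ s, A s)

/-- What happens at a node. -/
inductive NodeKind (S : Type*) where
  | terminal : NodeKind S
  | chance : NodeKind S
  | decision (s : S) : NodeKind S

/-- The infoset-action pairs of player `i` along a history, from the root on. -/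
def playerSeqOf {S : Type*} {A : S → Type*} {C : Type*} (owner : S → Fin 2) (i : Fin 2)
    (h : List (GameStep S A C)) : List (Σ s, A s) :=
  h.filterMap fun e => match e with
    | Sum.inl _ => none
    | Sum.inr x => if owner x.1 = i then some x else none

/-- A finite two-player zero-sum extensive-form game with perfect recall. Player `0` is the first
player (the maximizer of `utility`), player `1` the second one. -/
structure EFG (S : Type*) (A : S → Type*) (C : Type*) [Fintype C] where
  /-- the player who acts at an infoset -/
  owner : S → Fin 2
  /-- the nodes of the tree -/
  hist : Finset (List (GameStep S A C))
  kind : List (GameStep S A C) → NodeKind S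
  /-- distribution of the outcome at a chance node -/
  chanceProb : List (GameStep S A C) → C → ℝ
  /-- payoff of the first player; the second player receives its negative -/
  utility : List (GameStep S A C) → ℝ
  nil_mem : [] ∈ hist
  /-- The children of a node: none at a terminal node, one for each outcome of positive probability
  at a chance node, one for each action at a decision node. -/
  snoc_mem : ∀ h e, h ++ [e] ∈ hist ↔ h ∈ hist ∧
    match kind h with
    | NodeKind.terminal => False
    | NodeKind.chance => ∃ c, e = Sum.inl c ∧ 0 < chanceProb h c
    | NodeKind.decision s => ∃ a : A s, e = Sum.inr ⟨s, a⟩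
  chanceProb_nonneg : ∀ h ∈ hist, kind h = NodeKind.chance → ∀ c, 0 ≤ chanceProb h c
  chanceProb_sum : ∀ h ∈ hist, kind h = NodeKind.chance → ∑ c, chanceProb h c = 1
  utility_bound : ∀ h ∈ hist, |utility h| ≤ 1
  utility_terminal : ∀ h ∈ hist, kind h ≠ NodeKind.terminal → utility h = 0
  infoset_nonempty : ∀ s, ∃ h ∈ hist, kind h = NodeKind.decision s
  /-- Perfect recall: nodes of an infoset share the own infosets and actions of its owner. -/
  perfect_recall : ∀ s, ∀ h ∈ hist, ∀ h' ∈ hist, kind h = NodeKind.decision s →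
    kind h' = NodeKind.decision s →
      playerSeqOf owner (owner s) h = playerSeqOf owner (owner s) h'

/-- Behavioral strategies of both players: `π s a` is the probability of `a` at `s`. -/
abbrev Profile (S : Type*) (A : S → Type*) := ∀ s : S, A s → ℝ

/-- Vectors indexed by infoset-action pairs; a joint sequence-form strategy is such a vector. -/
abbrev SeqVec (S : Type*) (A : S → Type*) := (Σ s : S, A s) → ℝ

/-- The value of a sequence-form vector at a possibly empty sequence, with `μ(∅) = 1`. -/
def SeqVec.at {S : Type*} {A : S → Type*} (μ : SeqVec S A) : Option (Σ s : S, A s) → ℝ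
  | none => 1
  | some x => μ x

namespace EFG

variable {S : Type*} {A : S → Type*} {C : Type*} [Fintype C] (G : EFG S A C)

open scoped Classical in
/-- The nodes of an infoset. -/
def nodes (s : S) : Finset (List (GameStep S A C)) :=
  G.hist.filter fun h => G.kind h = NodeKind.decision s

/-- The infoset-action pairs of player `i` on the path to `h`, i.e. all `(s', a') ⊑ σ_i(h)`. -/
def playerSeq (i : Fin 2) (h : List (GameStep S A C)) : List (Σ s, A s) :=
  playerSeqOf G.owner i h

/-- `σ_i(h)`: the last infoset-action pair of player `i` on the path to `h`. -/
def lastSeq (i : Fin 2) (h : List (GameStep S A C)) : Option (Σ s, A s) :=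
  (G.playerSeq i h).getLast?

/-- A node of the infoset `s`. -/
def repr (s : S) : List (GameStep S A C) := (G.infoset_nonempty s).choose

/-- `σ(s)`, the parent sequence of `s`; by perfect recall the choice of the node is irrelevant. -/
def parentSeq (s : S) : Option (Σ s, A s) := G.lastSeq (G.owner s) (G.repr s)

/-- `(h, a) ⊑ h'` for some node `h` of `s`. -/
def PassesThrough (s : S) (a : A s) (h' : List (GameStep S A C)) : Prop :=
  ∃ h ∈ G.nodes s, (h ++ [Sum.inr ⟨s, a⟩]) <+: h'

/-- `(s, a) ⊑ s'` for infosets of the same player. -/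
def Precedes (s : S) (a : A s) (s' : S) : Prop :=
  G.owner s' = G.owner s ∧ ∃ h' ∈ G.nodes s', G.PassesThrough s a h'

/-- `μ_c(h)`: the contribution of chance to the probability of reaching `h`. -/
def chanceReach (h : List (GameStep S A C)) : ℝ :=
  ∏ k ∈ Finset.range h.length,
    match h[k]? with
    | some (Sum.inl c) => G.chanceProb (h.take k) c
    | _ => 1

/-- The sequence form `μ^π` of both players: `μ^π(s, a)` is the product of the probabilities of all
actions of the owner of `s` up to and including `a` at `s`. -/
def seqForm (π : Profile S A) : SeqVec S A := fun x =>
  ((G.playerSeq (G.owner x.1) (G.repr x.1)).map fun y => π y.1 y.2).prod * π x.1 x.2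

/-- `∑_{h ∈ s} μ_c(h)`. -/
def infosetChance (s : S) : ℝ := ∑ h ∈ G.nodes s, G.chanceReach h

/-- `μ_{-p(s)}(s) = ∑_{h ∈ s} μ_c(h) μ_{3-p(s)}(σ_{3-p(s)}(h))`. -/
def oppReach (π : Profile S A) (s : S) : ℝ :=
  ∑ h ∈ G.nodes s,
    G.chanceReach h * (G.seqForm π).at (G.lastSeq (G.owner s).rev h)

/-- The payoff of player `i`. -/
def payoff (i : Fin 2) (h : List (GameStep S A C)) : ℝ :=
  if i = 0 then G.utility h else -G.utility h

/-- The expected payoff `μ₁ᵀ 𝐀 μ₂` of the first player under a joint sequence-form strategy. -/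
def expectedUtility (μ : SeqVec S A) : ℝ :=
  ∑ h ∈ G.hist, G.chanceReach h * μ.at (G.lastSeq 0 h) * μ.at (G.lastSeq 1 h) * G.utility h

/-! ### Unregularized values at an infoset, for the player acting there -/

open scoped Classical in
/-- Counterfactual value. -/
def counterfactualValue (π : Profile S A) (s : S) (a : A s) : ℝ :=
  ∑ h' ∈ G.hist.filter (fun h' => G.PassesThrough s a h'),
    G.chanceReach h' *
      ((G.seqForm π).at (G.lastSeq (G.owner s) h') / G.seqForm π ⟨s, a⟩) *
      (G.seqForm π).at (G.lastSeq (G.owner s).rev h') * G.payoff (G.owner s) h'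

open scoped Classical in
/-- Trajectory Q-value. -/
def trajectoryQ (π : Profile S A) (s : S) (a : A s) : ℝ :=
  1 / π s a * ∑ h' ∈ G.hist.filter (fun h' => G.PassesThrough s a h'),
    G.chanceReach h' * (G.seqForm π).at (G.lastSeq 0 h') *
      (G.seqForm π).at (G.lastSeq 1 h') * G.payoff (G.owner s) h'

/-- Q-value: the trajectory Q-value conditioned on reaching the infoset. -/
def qValue (π : Profile S A) (s : S) (a : A s) : ℝ :=
  G.trajectoryQ π s a / ∑ h ∈ G.nodes s,
    G.chanceReach h * (G.seqForm π).at (G.lastSeq 0 h) * (G.seqForm π).at (G.lastSeq 1 h)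

end EFG

/-! ### Regularizers and Bregman divergences -/

/-- `D_ψ(x, y) = ψ(x) - ψ(y) - ⟨∇ψ(y), x - y⟩`. -/
def bregman {ι : Type*} [Fintype ι] (ψ : (ι → ℝ) → ℝ) (x y : ι → ℝ) : ℝ :=
  ψ x - ψ y - fderiv ℝ ψ y (x - y)

inductive RegKind where
  | euclidean : RegKind
  | entropy : RegKind

/-- The regularizer of one infoset with action set `ι` and weight `α`. -/
def RegKind.reg (r : RegKind) {ι : Type*} [Fintype ι] (α : ℝ) (u : ι → ℝ) : ℝ :=
  match r with
  | .euclidean => α / 2 * ∑ a, u a ^ 2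
  | .entropy => α * (Real.log (Fintype.card ι) + ∑ a, u a * Real.log (u a))

/-- The perturbed simplex `{u ∈ Δ : u_a ≥ γ_s ν_{s,a}}`. -/
def perturbedSimplex {ι : Type*} [Fintype ι] (γs : ℝ) (ν : ι → ℝ) : Set (ι → ℝ) :=
  {u | u ∈ stdSimplex ℝ ι ∧ ∀ a, γs * ν a ≤ u a}

def IsArgmin {E : Type*} (f : E → ℝ) (K : Set E) (x : E) : Prop :=
  x ∈ K ∧ ∀ y ∈ K, f x ≤ f y

/-- The type of value vector that is fed to the update. -/
inductive FeedbackKind where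
  | counterfactual : FeedbackKind
  | trajectoryQ : FeedbackKind
  | qValue : FeedbackKind

/-- Parameters of the regularized, perturbed game and of the algorithm. -/
structure LazyParams (S : Type*) (A : S → Type*) where
  reg : RegKind
  feedback : FeedbackKind
  /-- strength of the regularization -/
  τ : ℝ
  /-- weights of the regularizers -/
  α : S → ℝ
  /-- exploration probabilities -/
  γs : S → ℝ
  /-- exploration strategies -/
  ν : ∀ s, A s → ℝ
  /-- uniform lower bound of the sequence-form strategies -/
  γ : ℝ
  /-- learning rates -/
  η : S → ℝ
  /-- upper bound of the feedback, `‖q‖_∞` -/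
  qBound : ℝ

namespace LazyParams

variable {S : Type*} {A : S → Type*} {C : Type*} [Fintype S] [∀ s, Fintype (A s)] [Fintype C]
  (p : LazyParams S A) (G : EFG S A C)

/-- `ψ_s^Δ`. -/
def psi (s : S) (u : A s → ℝ) : ℝ := p.reg.reg (p.α s) u

/-- Strategies that explore as prescribed in every infoset. -/
def Feasible (π : Profile S A) : Prop := ∀ s, π s ∈ perturbedSimplex (p.γs s) (p.ν s)

/-- The summand of `s` in the dilated regularizer, as a function of the sequence form. -/
def dilatedTerm (μ : SeqVec S A) (s : S) : ℝ :=
  μ.at (G.parentSeq s) * p.psi s (fun a => μ ⟨s, a⟩ / μ.at (G.parentSeq s))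

/-- The dilated regularizer `ψ^{Π_i}` of player `i`. -/
def dilatedReg (i : Fin 2) (μ : SeqVec S A) : ℝ :=
  ∑ s ∈ Finset.univ.filter (fun s => G.owner s = i), p.dilatedTerm G μ s

/-- `ψ^Π = ψ^{Π_1} + ψ^{Π_2}`. -/
def jointReg (μ : SeqVec S A) : ℝ := p.dilatedReg G 0 μ + p.dilatedReg G 1 μ

/-- `μ₁ᵀ 𝐀 μ₂ - τ ψ^{Π_1}(μ₁) + τ ψ^{Π_2}(μ₂)`. -/
def objective (μ : SeqVec S A) : ℝ :=
  G.expectedUtility μ - p.τ * p.dilatedReg G 0 μ + p.τ * p.dilatedReg G 1 μ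

/-- Player `i` switches from `π` to `π'`. -/
def deviate (i : Fin 2) (π π' : Profile S A) : Profile S A :=
  fun s => if G.owner s = i then π' s else π s

/-- Nash equilibria of the regularized and perturbed game. -/
def IsNash (π : Profile S A) : Prop :=
  p.Feasible π ∧ ∀ π', p.Feasible π' →
    p.objective G (G.seqForm (deviate G 0 π π')) ≤ p.objective G (G.seqForm π) ∧
    p.objective G (G.seqForm π) ≤ p.objective G (G.seqForm (deviate G 1 π π'))

/-! ### Feedback of the regularized game -/

/-- `m_s`, the ratio of the counterfactual value and the feedback. -/
def mult (π : Profile S A) (s : S) : ℝ :=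
  match p.feedback with
  | .counterfactual => 1
  | .trajectoryQ => 1 / (G.seqForm π).at (G.parentSeq s)
  | .qValue => G.oppReach π s

open scoped Classical in
/-- `V(s, a)`: the regularization that the player at `s` still meets below `(s, a)`. -/
def futureReg (π : Profile S A) (s : S) (a : A s) : ℝ :=
  ∑ s' ∈ Finset.univ.filter (fun s' => G.Precedes s a s'),
    (G.seqForm π).at (G.parentSeq s') / G.seqForm π ⟨s, a⟩ * p.psi s' (π s')

/-- The value vector of the unregularized game. -/
def rawFeedback (π : Profile S A) (s : S) (a : A s) : ℝ :=
  match p.feedback with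
  | .counterfactual => G.counterfactualValue π s a
  | .trajectoryQ => G.trajectoryQ π s a
  | .qValue => G.qValue π s a

/-- The value vector `q(s, ·)` of the regularized game: the counterfactual value there is
`m_s q(s, ·) = CF(s, ·) - τ V(s, ·)`. -/
def q (π : Profile S A) (s : S) (a : A s) : ℝ :=
  p.rawFeedback G π s a - p.τ / p.mult G π s * p.futureReg G π s a

/-- One lazy update of the infoset `s`: `u'` minimizes
`⟨u, -q⟩ + (τ / m) ψ_s(u) + (1 / η_s) D_{ψ_s}(u, u₀)` over the perturbed simplex. -/
def IsLazyStep (s : S) (qs : A s → ℝ) (m : ℝ) (u₀ u' : A s → ℝ) : Prop :=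
  IsArgmin
    (fun u => ∑ a, u a * (-qs a) + p.τ / m * p.psi s u + 1 / p.η s * bregman (p.psi s) u u₀)
    (perturbedSimplex (p.γs s) (p.ν s)) u'

/-! ### Constants -/

def M₁ : ℝ :=
  match p.feedback with
  | .counterfactual => 1
  | .trajectoryQ => 1
  | .qValue => p.γ * ⨅ s, G.infosetChance s

def M₂ : ℝ :=
  match p.feedback with
  | .counterfactual => 1
  | .trajectoryQ => 1 / p.γ
  | .qValue => 1

/-- `η_s^anc`, the largest learning rate among the ancestors of `s`; it is `0` if there are none. -/
def ηAnc (s : S) : ℝ :=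
  sSup {x | ∃ i : Fin 2, ∃ h ∈ G.nodes s, ∃ e ∈ G.playerSeq i h, x = p.η e.1}

/-- `C_s^diff`. -/
def cDiff (s : S) : ℝ :=
  match p.reg with
  | .entropy => 2 / p.α s * (p.qBound + p.τ * p.α s / p.M₁ G * Real.log (1 / p.γ))
  | .euclidean =>
    Fintype.card (A s) / p.α s * p.qBound + Real.sqrt (Fintype.card (A s)) * p.τ / p.M₁ G

/-- `max_s (2‖q‖_∞ / α_s + (τ / M₁) log (1 / γ))`. -/
def maxRate : ℝ := ⨆ s, (2 * p.qBound / p.α s + p.τ / p.M₁ G * Real.log (1 / p.γ))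

/-- `C_s^-`, the constant of additive stability of `m_s`. -/
def cMinus (s : S) : ℝ :=
  match p.feedback, p.reg with
  | .counterfactual, _ => 0
  | .trajectoryQ, .euclidean => 6 / p.γ ^ 2 * ⨆ s', p.cDiff G s'
  | .trajectoryQ, .entropy => 12 * p.maxRate G / p.γ
  | .qValue, .euclidean => 6 * (G.nodes s).card * ⨆ s', p.cDiff G s'
  | .qValue, .entropy => 12 * p.M₂ * p.maxRate G

/-- `C_s^/`, the constant of multiplicative stability of `m_s`. -/
def cDiv (s : S) : ℝ :=
  match p.feedback, p.reg with
  | .counterfactual, _ => 0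
  | .trajectoryQ, .euclidean => 6 / (p.γ ^ 2 * p.M₁ G) * ⨆ s', p.cDiff G s'
  | .trajectoryQ, .entropy => 12 * p.maxRate G
  | .qValue, .euclidean => 6 * (G.nodes s).card / p.M₁ G * ⨆ s', p.cDiff G s'
  | .qValue, .entropy => 12 * p.maxRate G

/-- Ranges of the parameters. -/
structure Admissible : Prop where
  τ_pos : 0 < p.τ
  α_pos : ∀ s, 0 < p.α s
  γs_pos : ∀ s, 0 < p.γs s
  γs_le : ∀ s, p.γs s ≤ 1
  ν_mem : ∀ s, p.ν s ∈ stdSimplex ℝ (A s)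
  ν_pos : ∀ s a, 0 < p.ν s a
  γ_pos : 0 < p.γ
  γ_le : ∀ π, p.Feasible π → ∀ x, p.γ ≤ G.seqForm π x
  η_pos : ∀ s, 0 < p.η s

/-- The conditions on the learning rates. -/
structure LearningRates : Prop where
  /-- `η_s^anc / η_s ≤ τ / (2 C_s^-)`, without a restriction if `C_s^- = 0` -/
  ratio : ∀ s, 2 * p.cMinus G s * p.ηAnc G s ≤ p.τ * p.η s
  condA : ∀ s i, ∀ h ∈ G.nodes s, ((G.playerSeq i h).map fun e => p.η e.1).sum ≤ p.η s
  condB : ∀ s, 6 * p.ηAnc G s * p.maxRate G ≤ 1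
  condC : ∀ s, p.η s *
    (2 * p.qBound + p.τ * p.α s / p.M₁ G * Real.log (1 / p.γ)) ≤ 1

/-- A run of the lazy update with stochastic feedback up to time `T`. `π t` and `πbar t` are the two
strategies at time `t`, `qhat t` is the estimate of the feedback of `π t`. It starts at
`πbar 1 = π 0`, a fixed exploring strategy, with an initial prediction `qhat 0`. At each time
`t ∈ {1, …, T}` every infoset is updated; given the past, `qhat t` has the mean `q(π t)`, and all
estimates are bounded by `‖q‖_∞`. -/
structure IsStochasticRun {Ω : Type*} {mΩ : MeasurableSpace Ω} (P : Measure Ω)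
    (ℱ : Filtration ℕ mΩ) (T : ℕ) (π πbar : ℕ → Ω → Profile S A)
    (qhat : ℕ → Ω → Profile S A) : Prop where
  init : ∃ π₁ : Profile S A, p.Feasible π₁ ∧ ∀ ω, πbar 1 ω = π₁ ∧ π 0 ω = π₁
  step : ∀ t, 1 ≤ t → t ≤ T → ∀ ω s,
    p.IsLazyStep s (qhat (t - 1) ω s) (p.mult G (π (t - 1) ω) s) (πbar t ω s) (π t ω s)
  stepBar : ∀ t, 1 ≤ t → t ≤ T → ∀ ω s,
    p.IsLazyStep s (qhat t ω s) (p.mult G (π t ω) s) (πbar t ω s) (πbar (t + 1) ω s)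
  adapted : ∀ t ≤ T, ∀ s a, StronglyMeasurable[ℱ t] fun ω => qhat t ω s a
  bounded : ∀ t ≤ T, ∀ s a, ∀ᵐ ω ∂P, |qhat t ω s a| ≤ p.qBound
  unbiased : ∀ t, 1 ≤ t → t ≤ T → ∀ s a,
    P[fun ω => qhat t ω s a | ℱ (t - 1)] =ᵐ[P] fun ω => p.q G (π t ω) s a

end LazyParams

end

/-!
# Convergence of the lazy update with stochastic feedback

The proof is an analysis of optimistic mirror descent at each infoset, put together by the
performance difference identity of extensive-form games.

*From the game to the infosets.* Along the path to a node, the reach probability of a player is a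
product of action probabilities. Telescoping this product
(`EFG.playerReach_sub_eq_list_sum`) and exchanging sums gives the change of the regularized
objective under a deviation of one player as a sum over infosets of local linear terms in
`m_s q(s, ·)`, weighted by the reach probabilities of the deviation
(`LazyParams.objective_deviate_sub`); perfect recall is what makes these weights functions of the
infoset. Adding the identities of both players for deviations to the equilibrium yields
`LazyParams.IsNash.sum_nonneg`: the total weighted local regret against the equilibrium is
nonnegative. The divergence of the dilated regularizer splits over the infosets with the same
weights (`LazyParams.bregman_jointReg`).

*One infoset.* The three-point inequalities of the two minimizations at time `t`, multiplied by the
current `m_s`, bound the local regret by a difference of divergences from the equilibrium, a term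
`τ |1 - m_t / m_{t-1}| |ψ_s(π_t) - ψ_s(π̄_{t+1})|`, and a prediction term that strong convexity
reduces to order `η_s` (`LazyParams.BoundedRun.regret_step_le`). The divergences telescope although
`m_s` varies, because the additive change of `m_s` is at most `τ η_s / 2`, so that half of the
contraction due to the regularizer remains (`LazyParams.BoundedRun.sum_divergence_le`).

*Stability of the multipliers.* A lazy step moves every probability by a factor `exp(± η_s K)`
(entropy) or by `η_s C^diff` (Euclidean). Consecutive strategies are three such steps apart, and the
learning rates on a path add up to at most `2 η_s^anc`, which gives both stability statements
`LazyParams.abs_mult_sub_le` and `LazyParams.mult_sub_le`. The bounds `M₁ ≤ m_s ≤ M₂` rest, for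
Q-values, on `EFG.oppReach_le_one`: the nodes of an infoset form an antichain, so they are reached
with total probability at most one by a player who aims at them.

*Noise.* The strategies at time `t` are measurable with respect to `ℱ (t - 1)`, since the minimizer
depends on the data in a Lipschitz way, so the errors of the estimates form a bounded martingale
difference sequence, and the Azuma-Hoeffding inequality (`one_sub_le_measure_sum_le`) applies.
-/

/-! ### Local regularizers -/

namespace RegKind

variable {ι : Type*} [Fintype ι]

/-- The gradient of the regularizer of one infoset, at a vector with positive entries. -/
noncomputable def grad (r : RegKind) (α : ℝ) (u : ι → ℝ) (a : ι) : ℝ :=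
  match r with
  | .euclidean => α * u a
  | .entropy => α * (Real.log (u a) + 1)

/-- A constant `κ` with `κ ‖x - y‖₁² ≤ D_ψ(x, y)` on the simplex. For the entropy, Pinsker's
inequality would give `α / 2`, but `α / 4` suffices and is elementary. -/
noncomputable def modulus (r : RegKind) (ι : Type*) [Fintype ι] (α : ℝ) : ℝ :=
  match r with
  | .euclidean => α / (2 * Fintype.card ι)
  | .entropy => α / 4

theorem hasFDerivAt_reg (r : RegKind) (α : ℝ) {y : ι → ℝ} (hy : ∀ a, 0 < y a) :
    HasFDerivAt (r.reg α)
      (∑ a, r.grad α y a • (ContinuousLinearMap.proj a : (ι → ℝ) →L[ℝ] ℝ)) y := by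
  have hp : ∀ a : ι, HasFDerivAt (fun u : ι → ℝ => u a)
      (ContinuousLinearMap.proj a : (ι → ℝ) →L[ℝ] ℝ) y := fun a => hasFDerivAt_apply a y
  cases r with
  | euclidean =>
    have h1 : HasFDerivAt (fun u : ι → ℝ => α / 2 * ∑ a, u a ^ 2)
        ((α / 2) • ∑ a, ((2 : ℕ) • y a ^ (2 - 1)) •
          (ContinuousLinearMap.proj a : (ι → ℝ) →L[ℝ] ℝ)) y :=
      (HasFDerivAt.fun_sum fun a _ => (hp a).pow 2).const_mul (α / 2)
    refine h1.congr_fderiv ?_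
    ext v
    simp only [smul_apply, sum_apply, smul_eq_mul,
      ContinuousLinearMap.proj_apply, grad, Finset.mul_sum]
    refine Finset.sum_congr rfl fun a _ => ?_
    simp
    ring
  | entropy =>
    have h1 : HasFDerivAt
        (fun u : ι → ℝ => α * (Real.log (Fintype.card ι) + ∑ a, u a * Real.log (u a)))
        (α • ∑ a, (Real.log (y a) + 1) •
          (ContinuousLinearMap.proj a : (ι → ℝ) →L[ℝ] ℝ)) y := by
      refine HasFDerivAt.const_mul (HasFDerivAt.const_add _ (HasFDerivAt.fun_sum fun a _ => ?_)) α
      exact (Real.hasDerivAt_mul_log (hy a).ne').comp_hasFDerivAt y (hp a)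
    refine h1.congr_fderiv ?_
    ext v
    simp [grad, Finset.mul_sum, mul_assoc]

theorem fderiv_reg_apply (r : RegKind) (α : ℝ) {y : ι → ℝ} (hy : ∀ a, 0 < y a) (v : ι → ℝ) :
    fderiv ℝ (r.reg α) y v = ∑ a, r.grad α y a * v a := by
  rw [(r.hasFDerivAt_reg α hy).fderiv]
  simp

theorem bregman_reg (r : RegKind) (α : ℝ) {y : ι → ℝ} (hy : ∀ a, 0 < y a) (x : ι → ℝ) :
    bregman (r.reg α) x y =
      r.reg α x - r.reg α y - ∑ a, r.grad α y a * (x a - y a) := by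
  rw [bregman, r.fderiv_reg_apply α hy]
  rfl

theorem bregman_three_point (r : RegKind) (α : ℝ) {x y : ι → ℝ} (hx : ∀ a, 0 < x a)
    (hy : ∀ a, 0 < y a) (u : ι → ℝ) :
    bregman (r.reg α) u y - bregman (r.reg α) u x - bregman (r.reg α) x y =
      ∑ a, (u a - x a) * (r.grad α x a - r.grad α y a) := by
  rw [r.bregman_reg α hy, r.bregman_reg α hx, r.bregman_reg α hy]
  have : ∑ a, (u a - x a) * (r.grad α x a - r.grad α y a) =
      ∑ a, r.grad α x a * (u a - x a) - ∑ a, r.grad α y a * (u a - y a) +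
        ∑ a, r.grad α y a * (x a - y a) := by
    rw [← Finset.sum_sub_distrib, ← Finset.sum_add_distrib]
    exact Finset.sum_congr rfl fun a _ => by ring
  rw [this]
  ring

theorem modulus_pos (r : RegKind) [Nonempty ι] {α : ℝ} (hα : 0 < α) : 0 < r.modulus ι α := by
  have : (0 : ℝ) < Fintype.card ι := by exact_mod_cast Fintype.card_pos
  cases r <;> simp only [modulus] <;> positivity

/-- The integrand of the relative entropy dominates that of the squared Hellinger distance. This is
`1 - 1 / w ≤ log w` at `w = √x / √y`. -/
theorem sq_sqrt_sub_le_mul_log {x y : ℝ} (hx : 0 ≤ x) (hy : 0 < y) :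
    (√x - √y) ^ 2 ≤ x * Real.log x - x * Real.log y - x + y := by
  have hsx := Real.sq_sqrt hx
  have hsy := Real.sq_sqrt hy.le
  rcases hx.eq_or_lt with rfl | hx
  · simp [hsy]
  · have h1 : 0 < √x := Real.sqrt_pos.2 hx
    have h2 : 0 < √y := Real.sqrt_pos.2 hy
    have h3 := Real.one_sub_inv_le_log_of_pos (div_pos h1 h2)
    rw [Real.log_div h1.ne' h2.ne', Real.log_sqrt hx.le, Real.log_sqrt hy.le, inv_div] at h3
    have h4 : 2 * x * (1 - √y / √x) = 2 * x - 2 * √x * √y := by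
      field_simp
      nlinarith
    have h5 := mul_le_mul_of_nonneg_left h3 (by positivity : 0 ≤ 2 * x)
    rw [h4] at h5
    nlinarith

/-- Strong convexity of the regularizers. For the entropy, the divergence dominates the squared
Hellinger distance, and Cauchy-Schwarz compares the latter with the `ℓ¹`-distance. -/
theorem modulus_mul_sq_le_bregman (r : RegKind) {α : ℝ} (hα : 0 < α) {x y : ι → ℝ}
    (hx : x ∈ stdSimplex ℝ ι) (hys : y ∈ stdSimplex ℝ ι) (hy : ∀ a, 0 < y a) :
    r.modulus ι α * (∑ a, |x a - y a|) ^ 2 ≤ bregman (r.reg α) x y := by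
  rw [r.bregman_reg α hy]
  cases r with
  | euclidean =>
    have h1 : reg .euclidean α x - reg .euclidean α y -
        ∑ a, grad .euclidean α y a * (x a - y a) = α / 2 * ∑ a, |x a - y a| ^ 2 := by
      simp only [reg, grad, Finset.mul_sum, ← Finset.sum_sub_distrib, sq_abs]
      exact Finset.sum_congr rfl fun a _ => by ring
    rw [h1, modulus]
    have h2 := sq_sum_le_card_mul_sum_sq (s := Finset.univ) (f := fun a => |x a - y a|)
    rcases Nat.eq_zero_or_pos (Fintype.card ι) with h0 | h0
    · simp only [h0, Nat.cast_zero, mul_zero, div_zero, zero_mul]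
      positivity
    · have h0' : (0 : ℝ) < Fintype.card ι := by exact_mod_cast h0
      rw [Finset.card_univ] at h2
      rw [div_mul_eq_mul_div, div_le_iff₀ (by positivity)]
      nlinarith
  | entropy =>
    have h1 : reg .entropy α x - reg .entropy α y - ∑ a, grad .entropy α y a * (x a - y a) =
        α * ∑ a, (x a * Real.log (x a) - x a * Real.log (y a) - x a + y a) := by
      simp only [reg, grad, mul_add, Finset.mul_sum]
      rw [add_sub_add_left_eq_sub, ← Finset.sum_sub_distrib, ← Finset.sum_sub_distrib]
      exact Finset.sum_congr rfl fun a _ => by ring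
    have h2 : ∑ a, (√(x a) - √(y a)) ^ 2 ≤
        ∑ a, (x a * Real.log (x a) - x a * Real.log (y a) - x a + y a) :=
      Finset.sum_le_sum fun a _ => sq_sqrt_sub_le_mul_log (hx.1 a) (hy a)
    have h3 : (∑ a, |x a - y a|) ^ 2 ≤
        (∑ a, (√(x a) - √(y a)) ^ 2) * ∑ a, (√(x a) + √(y a)) ^ 2 := by
      have h := Finset.sum_mul_sq_le_sq_mul_sq Finset.univ
        (fun a => |√(x a) - √(y a)|) (fun a => √(x a) + √(y a))
      simp only [sq_abs] at h
      refine le_trans (le_of_eq ?_) h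
      congr 1
      refine Finset.sum_congr rfl fun a _ => ?_
      rw [← abs_of_nonneg (by positivity : 0 ≤ √(x a) + √(y a)), ← abs_mul]
      congr 1
      have := Real.sq_sqrt (hx.1 a)
      have := Real.sq_sqrt (hy a).le
      nlinarith
    have h4 : ∑ a, (√(x a) + √(y a)) ^ 2 ≤ 4 := by
      have : ∑ a, (√(x a) + √(y a)) ^ 2 ≤ ∑ a, (2 * x a + 2 * y a) := by
        refine Finset.sum_le_sum fun a _ => ?_
        have := Real.sq_sqrt (hx.1 a)
        have := Real.sq_sqrt (hy a).le
        nlinarith [sq_nonneg (√(x a) - √(y a))]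
      rw [Finset.sum_add_distrib, ← Finset.mul_sum, ← Finset.mul_sum, hx.2, hys.2] at this
      linarith
    have h5 : 0 ≤ ∑ a, (√(x a) - √(y a)) ^ 2 := Finset.sum_nonneg fun a _ => sq_nonneg _
    rw [h1, modulus]
    nlinarith [mul_le_mul_of_nonneg_left h4 h5]

theorem bregman_reg_nonneg (r : RegKind) {α : ℝ} (hα : 0 < α) {x y : ι → ℝ}
    (hx : x ∈ stdSimplex ℝ ι) (hys : y ∈ stdSimplex ℝ ι) (hy : ∀ a, 0 < y a) :
    0 ≤ bregman (r.reg α) x y := by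
  refine le_trans (mul_nonneg ?_ (sq_nonneg _)) (r.modulus_mul_sq_le_bregman hα hx hys hy)
  cases r <;> simp only [modulus] <;> positivity

end RegKind

/-! ### Perturbed simplices -/

section PerturbedSimplex

variable {ι : Type*} [Fintype ι] {γs : ℝ} {ν : ι → ℝ}

theorem convex_perturbedSimplex : Convex ℝ (perturbedSimplex γs ν) := by
  intro x hx y hy a b ha hb hab
  refine ⟨convex_stdSimplex ℝ ι hx.1 hy.1 ha hb hab, fun i => ?_⟩
  have h1 := mul_le_mul_of_nonneg_left (hx.2 i) ha
  have h2 := mul_le_mul_of_nonneg_left (hy.2 i) hb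
  have h3 : γs * ν i = a * (γs * ν i) + b * (γs * ν i) := by rw [← add_mul, hab, one_mul]
  simp only [Pi.add_apply, Pi.smul_apply, smul_eq_mul]
  linarith

theorem apply_le_one_of_mem_stdSimplex {u : ι → ℝ} (hu : u ∈ stdSimplex ℝ ι) (a : ι) :
    u a ≤ 1 :=
  hu.2 ▸ Finset.single_le_sum (f := u) (fun b _ => hu.1 b) (Finset.mem_univ a)

/-- If `x` solves the variational inequality with gradient `g`, then `g` is smallest at the
coordinates above their lower bound, since mass may be moved from those to any other one. -/
theorem coordinate_le_of_variational {x g : ι → ℝ} (hl : ∀ a, 0 < γs * ν a)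
    (hx : x ∈ perturbedSimplex γs ν)
    (hvar : ∀ u ∈ perturbedSimplex γs ν, 0 ≤ ∑ a, (u a - x a) * g a) {b : ι}
    (hb : γs * ν b < x b) (a : ι) : g b ≤ g a := by
  classical
  rcases eq_or_ne a b with rfl | hab
  · exact le_rfl
  set ε := x b - γs * ν b with hε
  have hε0 : 0 < ε := sub_pos.2 hb
  set u : ι → ℝ := fun c => x c + ε * ((if c = a then 1 else 0) - if c = b then 1 else 0) with hu
  have hlow : ∀ c, γs * ν c ≤ u c := by
    intro c
    have := hx.2 c
    by_cases hc : c = b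
    · subst hc
      simp only [hu, if_neg hab.symm, if_true]
      linarith
    · simp only [hu, if_neg hc]
      split_ifs <;> linarith
  have hpos : ∀ c, 0 ≤ u c := fun c => (hl c).le.trans (hlow c)
  have h := hvar u ⟨⟨hpos, ?_⟩, hlow⟩
  · have h2 : ∑ c, (u c - x c) * g c = ε * (g a - g b) := by
      have : ∀ c, (u c - x c) * g c =
          ε * ((if c = a then g c else 0) - if c = b then g c else 0) := by
        intro c
        simp only [hu]
        split_ifs <;> ring
      simp_rw [this, ← Finset.mul_sum, Finset.sum_sub_distrib]
      simp
    rw [h2] at h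
    nlinarith
  · simp only [hu, Finset.sum_add_distrib, ← Finset.mul_sum, Finset.sum_sub_distrib]
    simp [hx.1.2]

end PerturbedSimplex

/-! ### A single step of the lazy update -/

namespace LazyParams

section LazyStep

variable {S : Type*} {A : S → Type*} [∀ s, Fintype (A s)] {p : LazyParams S A} {s : S}
  {qs : A s → ℝ} {m : ℝ} {u₀ x : A s → ℝ}

/-- The variational inequality of the minimizer. -/
theorem IsLazyStep.variational (h : p.IsLazyStep s qs m u₀ x) (hu₀ : ∀ a, 0 < u₀ a)
    (hx : ∀ a, 0 < x a) {u : A s → ℝ} (hu : u ∈ perturbedSimplex (p.γs s) (p.ν s)) :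
    0 ≤ ∑ a, (u a - x a) * (-qs a + p.τ / m * p.reg.grad (p.α s) x a +
      1 / p.η s * (p.reg.grad (p.α s) x a - p.reg.grad (p.α s) u₀ a)) := by
  have hd := p.reg.hasFDerivAt_reg (p.α s) hx
  have hp : ∀ a : A s, HasFDerivAt (fun u : A s → ℝ => u a)
      (ContinuousLinearMap.proj a : (A s → ℝ) →L[ℝ] ℝ) x := fun a => hasFDerivAt_apply a x
  have hb : HasFDerivAt (fun u => bregman (p.psi s) u u₀)
      ((∑ a, p.reg.grad (p.α s) x a • (ContinuousLinearMap.proj a : (A s → ℝ) →L[ℝ] ℝ)) -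
        fderiv ℝ (p.psi s) u₀) x := by
    have h1 : HasFDerivAt (fun u : A s → ℝ => fderiv ℝ (p.psi s) u₀ (u - u₀))
        (fderiv ℝ (p.psi s) u₀) x := by
      have := (fderiv ℝ (p.psi s) u₀).hasFDerivAt.comp x ((hasFDerivAt_id x).sub_const u₀)
      rwa [ContinuousLinearMap.comp_id] at this
    exact (hd.sub_const _).sub h1
  have hl := HasFDerivAt.fun_sum (u := Finset.univ) fun a _ => (hp a).mul_const (-qs a)
  have hF := (hl.add (hd.const_mul (p.τ / m))).add (hb.const_mul (1 / p.η s))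
  have hmin : IsLocalMinOn (fun u => ∑ a, u a * (-qs a) + p.τ / m * p.psi s u +
      1 / p.η s * bregman (p.psi s) u u₀) (perturbedSimplex (p.γs s) (p.ν s)) x :=
    (isMinOn_iff.2 h.2).localize
  have := hmin.hasFDerivWithinAt_nonneg hF.hasFDerivWithinAt
    (sub_mem_posTangentConeAt_of_segment_subset
      (convex_perturbedSimplex.segment_subset h.1 hu))
  have hf : ∀ v, fderiv ℝ (p.psi s) u₀ v = ∑ a, p.reg.grad (p.α s) u₀ a * v a :=
    p.reg.fderiv_reg_apply (p.α s) hu₀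
  simp only [add_apply, sub_apply, smul_apply, sum_apply, ContinuousLinearMap.proj_apply, hf,
    smul_eq_mul, Pi.sub_apply] at this
  refine this.trans (le_of_eq ?_)
  rw [← Finset.sum_sub_distrib, Finset.mul_sum, Finset.mul_sum, ← Finset.sum_add_distrib,
    ← Finset.sum_add_distrib]
  exact Finset.sum_congr rfl fun a _ => by ring

/-- The three-point inequality of mirror descent. -/
theorem IsLazyStep.three_point (h : p.IsLazyStep s qs m u₀ x) (hu₀ : ∀ a, 0 < u₀ a)
    (hx : ∀ a, 0 < x a) {u : A s → ℝ} (hu : u ∈ perturbedSimplex (p.γs s) (p.ν s)) :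
    ∑ a, (u a - x a) * qs a - p.τ / m * (p.psi s u - p.psi s x) ≤
      1 / p.η s * (bregman (p.psi s) u u₀ - bregman (p.psi s) u x - bregman (p.psi s) x u₀) -
        p.τ / m * bregman (p.psi s) u x := by
  have h1 := h.variational hu₀ hx hu
  have h2 := p.reg.bregman_three_point (p.α s) hx hu₀ u
  have h3 := p.reg.bregman_reg (p.α s) hx u
  have h4 : ∑ a, (u a - x a) * (-qs a + p.τ / m * p.reg.grad (p.α s) x a +
      1 / p.η s * (p.reg.grad (p.α s) x a - p.reg.grad (p.α s) u₀ a)) =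
      - ∑ a, (u a - x a) * qs a + p.τ / m * ∑ a, p.reg.grad (p.α s) x a * (u a - x a) +
      1 / p.η s * ∑ a, (u a - x a) * (p.reg.grad (p.α s) x a - p.reg.grad (p.α s) u₀ a) := by
    rw [← Finset.sum_neg_distrib, Finset.mul_sum, Finset.mul_sum, ← Finset.sum_add_distrib,
      ← Finset.sum_add_distrib]
    exact Finset.sum_congr rfl fun a _ => by ring
  rw [h4, ← h2] at h1
  change ∑ a, (u a - x a) * qs a - p.τ / m * (p.reg.reg (p.α s) u - p.reg.reg (p.α s) x) ≤
      1 / p.η s * (bregman (p.reg.reg (p.α s)) u u₀ - bregman (p.reg.reg (p.α s)) u x -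
        bregman (p.reg.reg (p.α s)) x u₀) - p.τ / m * bregman (p.reg.reg (p.α s)) u x
  have h5 : p.reg.reg (p.α s) u - p.reg.reg (p.α s) x =
      ∑ a, p.reg.grad (p.α s) x a * (u a - x a) + bregman (p.reg.reg (p.α s)) u x := by
    rw [h3]; ring
  rw [h5]
  linarith [mul_add (p.τ / m) (∑ a, p.reg.grad (p.α s) x a * (u a - x a))
    (bregman (p.reg.reg (p.α s)) u x)]

/-- With the entropy, one step changes every probability by a factor close to one. The minimizer is
compared with the point that moves mass between `a` and an action whose probability moved the
other way. -/
theorem IsLazyStep.abs_log_sub_log_le (h : p.IsLazyStep s qs m u₀ x) (hr : p.reg = .entropy)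
    (hl : ∀ a, 0 < p.γs s * p.ν s a) (hu₀ : u₀ ∈ perturbedSimplex (p.γs s) (p.ν s))
    (hτ : 0 < p.τ) (hα : 0 < p.α s) (hη : 0 < p.η s) (hm : 0 < m) {Q γ : ℝ} (hγ : 0 < γ)
    (hq : ∀ a, |qs a| ≤ Q) (hγx : ∀ a, γ ≤ x a) (a : A s) :
    |Real.log (x a) - Real.log (u₀ a)| ≤
      p.η s * (2 * Q / p.α s + p.τ / m * Real.log (1 / γ)) := by
  have hx := h.1
  have hxp : ∀ a, 0 < x a := fun a => (hl a).trans_le (hx.2 a)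
  have hu₀p : ∀ a, 0 < u₀ a := fun a => (hl a).trans_le (hu₀.2 a)
  have hvar := fun u hu => h.variational hu₀p hxp (u := u) hu
  have hex := fun {b : A s} hb a => coordinate_le_of_variational hl hx hvar (b := b) hb a
  simp only [hr, RegKind.grad] at hex
  have hlogx : ∀ a, -Real.log (1 / γ) ≤ Real.log (x a) := fun a => by
    rw [one_div, Real.log_inv, neg_neg]
    exact Real.log_le_log hγ (hγx a)
  have hlogx0 : ∀ a, Real.log (x a) ≤ 0 := fun a =>
    Real.log_nonpos (hxp a).le (apply_le_one_of_mem_stdSimplex hx.1 a)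
  have hsum : ∑ a, x a = ∑ a, u₀ a := hx.1.2.trans hu₀.1.2.symm
  set Lg := Real.log (1 / γ)
  have hLg : 0 ≤ Lg := by linarith [hlogx a, hlogx0 a]
  have hQ : 0 ≤ Q := (abs_nonneg _).trans (hq a)
  have hτm : 0 < p.τ / m := div_pos hτ hm
  -- The comparison of two coordinates of the gradient, solved for the change of the logarithms.
  have key : ∀ b c : A s, p.γs s * p.ν s b < x b →
      Real.log (x b) - Real.log (u₀ b) ≤ p.η s * (2 * Q / p.α s + p.τ / m * Lg) +
        (Real.log (x c) - Real.log (u₀ c)) := by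
    intro b c hb
    have h1 := hex hb c
    have h2 : 1 / p.η s * (p.α s * ((Real.log (x b) - Real.log (u₀ b)) -
        (Real.log (x c) - Real.log (u₀ c)))) ≤ 2 * Q + p.τ / m * p.α s * Lg := by
      have h3 : p.τ / m * p.α s * (Real.log (x c) - Real.log (x b)) ≤ p.τ / m * p.α s * Lg :=
        mul_le_mul_of_nonneg_left (by linarith [hlogx b, hlogx0 c]) (by positivity)
      have := abs_le.1 (hq b)
      have := abs_le.1 (hq c)
      nlinarith
    have h4 : p.η s * (2 * Q / p.α s + p.τ / m * Lg) =
        p.η s / p.α s * (2 * Q + p.τ / m * p.α s * Lg) := by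
      field_simp
    have h5 := mul_le_mul_of_nonneg_left h2 (div_pos hη hα).le
    rw [← h4] at h5
    have h6 : p.η s / p.α s * (1 / p.η s * (p.α s * ((Real.log (x b) - Real.log (u₀ b)) -
        (Real.log (x c) - Real.log (u₀ c))))) = (Real.log (x b) - Real.log (u₀ b)) -
        (Real.log (x c) - Real.log (u₀ c)) := by
      field_simp
    linarith
  have hR : 0 ≤ p.η s * (2 * Q / p.α s + p.τ / m * Lg) := by positivity
  rw [abs_le]
  constructor
  · rcases le_or_gt (u₀ a) (x a) with hle | hlt
    · linarith [Real.log_le_log (hu₀p a) hle]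
    · obtain ⟨b, hb⟩ : ∃ b, u₀ b < x b := by
        by_contra! hcon
        exact (Finset.sum_lt_sum (fun c _ => hcon c) ⟨a, Finset.mem_univ a, hlt⟩).ne hsum
      have := key b a ((hu₀.2 b).trans_lt hb)
      linarith [Real.log_le_log (hu₀p b) hb.le]
  · rcases le_or_gt (x a) (u₀ a) with hle | hlt
    · linarith [Real.log_le_log (hxp a) hle]
    · obtain ⟨b, hb⟩ : ∃ b, x b < u₀ b := by
        by_contra! hcon
        exact (Finset.sum_lt_sum (fun c _ => hcon c) ⟨a, Finset.mem_univ a, hlt⟩).ne' hsum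
      have h1 := Real.log_le_log (hxp b) hb.le
      linarith [key a b ((hu₀.2 a).trans_lt hlt)]

/-- With the Euclidean regularizer, one step changes the strategy by a distance proportional to the
learning rate: the variational inequality is applied to the starting point of the step. -/
theorem IsLazyStep.abs_sub_le_of_euclidean (h : p.IsLazyStep s qs m u₀ x)
    (hr : p.reg = .euclidean) (hl : ∀ a, 0 < p.γs s * p.ν s a)
    (hu₀ : u₀ ∈ perturbedSimplex (p.γs s) (p.ν s))
    (hτ : 0 < p.τ) (hα : 0 < p.α s) (hη : 0 < p.η s) (hm : 0 < m) {Q : ℝ}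
    (hq : ∀ a, |qs a| ≤ Q) (a : A s) :
    |x a - u₀ a| ≤
      p.η s * (Fintype.card (A s) / p.α s * Q + √(Fintype.card (A s)) * p.τ / m) := by
  have hx := h.1
  have hxp : ∀ a, 0 < x a := fun a => (hl a).trans_le (hx.2 a)
  have hu₀p : ∀ a, 0 < u₀ a := fun a => (hl a).trans_le (hu₀.2 a)
  have hvar := h.variational hu₀p hxp hu₀
  simp only [hr, RegKind.grad] at hvar
  have hQ : 0 ≤ Q := (abs_nonneg _).trans (hq a)
  have hτm : 0 < p.τ / m := div_pos hτ hm
  set n : ℝ := (Fintype.card (A s) : ℝ) with hn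
  have hn1 : 1 ≤ n := by
    have : Nonempty (A s) := ⟨a⟩
    rw [hn]
    exact_mod_cast Fintype.card_pos (α := A s)
  set W := ∑ a, (x a - u₀ a) ^ 2 with hW
  set w := √W with hw
  have hW0 : 0 ≤ W := Finset.sum_nonneg fun a _ => sq_nonneg _
  have hw2 : w ^ 2 = W := Real.sq_sqrt hW0
  have hw0 : 0 ≤ w := Real.sqrt_nonneg _
  have h1 : ∑ a, (x a - u₀ a) * qs a ≤ w * (√n * Q) := by
    refine (Real.sum_mul_le_sqrt_mul_sqrt _ _ _).trans ?_
    refine mul_le_mul_of_nonneg_left ?_ hw0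
    have : ∑ a, qs a ^ 2 ≤ n * Q ^ 2 := by
      have := Finset.sum_le_card_nsmul Finset.univ (fun a => qs a ^ 2) (Q ^ 2)
        fun a _ => sq_le_sq' (abs_le.1 (hq a)).1 (abs_le.1 (hq a)).2
      simpa [hn] using this
    calc √(∑ a, qs a ^ 2) ≤ √(n * Q ^ 2) := Real.sqrt_le_sqrt this
      _ = √n * Q := by rw [Real.sqrt_mul (by linarith), Real.sqrt_sq hQ]
  have h2 : ∑ a, (u₀ a - x a) * x a ≤ w * 1 := by
    refine (Real.sum_mul_le_sqrt_mul_sqrt _ _ _).trans ?_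
    have e1 : ∑ a, (u₀ a - x a) ^ 2 = W := Finset.sum_congr rfl fun a _ => by ring
    rw [e1]
    refine mul_le_mul_of_nonneg_left ?_ hw0
    refine Real.sqrt_le_iff.2 ⟨zero_le_one, ?_⟩
    rw [one_pow]
    calc ∑ a, x a ^ 2 ≤ ∑ a, x a := Finset.sum_le_sum fun a _ => by
          have := apply_le_one_of_mem_stdSimplex hx.1 a
          nlinarith [hxp a]
      _ = 1 := hx.1.2
  have h3 : ∑ a, (u₀ a - x a) * (-qs a + p.τ / m * (p.α s * x a) +
      1 / p.η s * (p.α s * x a - p.α s * u₀ a)) =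
      ∑ a, (x a - u₀ a) * qs a + p.τ / m * p.α s * ∑ a, (u₀ a - x a) * x a -
        p.α s / p.η s * W := by
    rw [hW, Finset.mul_sum, Finset.mul_sum, ← Finset.sum_add_distrib, ← Finset.sum_sub_distrib]
    exact Finset.sum_congr rfl fun a _ => by ring
  rw [h3, ← hw2] at hvar
  have h4 : p.α s / p.η s * w ^ 2 ≤ w * (√n * Q + p.τ / m * p.α s) := by
    have := mul_le_mul_of_nonneg_left h2 (by positivity : 0 ≤ p.τ / m * p.α s)
    nlinarith
  have h5 : w ≤ p.η s * (√n / p.α s * Q + p.τ / m) := by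
    rcases hw0.eq_or_lt with h0 | h0
    · rw [← h0]; positivity
    · have h6 : p.α s / p.η s * w ≤ √n * Q + p.τ / m * p.α s := by
        refine le_of_mul_le_mul_left ?_ h0
        linarith [h4]
      have h7 := mul_le_mul_of_nonneg_left h6 (div_pos hη hα).le
      have e1 : p.η s / p.α s * (p.α s / p.η s * w) = w := by field_simp
      have e2 : p.η s / p.α s * (√n * Q + p.τ / m * p.α s) =
          p.η s * (√n / p.α s * Q + p.τ / m) := by field_simp
      linarith
  have h6 : |x a - u₀ a| ≤ w := by
    rw [← Real.sqrt_sq_eq_abs]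
    exact Real.sqrt_le_sqrt (Finset.single_le_sum (f := fun a => (x a - u₀ a) ^ 2)
      (fun a _ => sq_nonneg _) (Finset.mem_univ a))
  refine h6.trans (h5.trans (mul_le_mul_of_nonneg_left ?_ hη.le))
  have hsn : 1 ≤ √n := Real.one_le_sqrt.2 hn1
  have hsn2 : √n ≤ n := by nlinarith [Real.sq_sqrt (by linarith : 0 ≤ n)]
  have e3 : √n * p.τ / m = √n * (p.τ / m) := by ring
  rw [e3]
  have := mul_le_mul_of_nonneg_right hsn hτm.le
  have : √n / p.α s * Q ≤ n / p.α s * Q := by gcongr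
  linarith

end LazyStep

end LazyParams

/-! ### Paths of the game tree and perfect recall -/

namespace EFG

variable {S : Type*} {A : S → Type*} {C : Type*} [Fintype C] (G : EFG S A C)

theorem playerSeq_nil (i : Fin 2) : G.playerSeq i [] = [] := rfl

theorem playerSeq_append (i : Fin 2) (h h' : List (GameStep S A C)) :
    G.playerSeq i (h ++ h') = G.playerSeq i h ++ G.playerSeq i h' := by
  simp [playerSeq, playerSeqOf, List.filterMap_append]

theorem playerSeq_inl (i : Fin 2) (c : C) : G.playerSeq i [Sum.inl c] = [] := rfl

theorem playerSeq_inr_of_owner {i : Fin 2} {x : Σ s, A s} (hx : G.owner x.1 = i) :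
    G.playerSeq i [Sum.inr x] = [x] := by
  simp [playerSeq, playerSeqOf, hx]

theorem playerSeq_inr_of_owner_ne {i : Fin 2} {x : Σ s, A s} (hx : G.owner x.1 ≠ i) :
    G.playerSeq i [Sum.inr x] = [] := by
  simp [playerSeq, playerSeqOf, hx]

theorem owner_eq_of_mem_playerSeq {i : Fin 2} {h : List (GameStep S A C)} {x : Σ s, A s}
    (hx : x ∈ G.playerSeq i h) : G.owner x.1 = i := by
  simp only [playerSeq, playerSeqOf, List.mem_filterMap] at hx
  obtain ⟨e, _, he⟩ := hx
  split at he
  · simp at he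
  · split_ifs at he with h1
    simp only [Option.some.injEq] at he
    rwa [← he]

theorem inr_mem_of_mem_playerSeq {i : Fin 2} {h : List (GameStep S A C)} {x : Σ s, A s}
    (hx : x ∈ G.playerSeq i h) : Sum.inr x ∈ h := by
  simp only [playerSeq, playerSeqOf, List.mem_filterMap] at hx
  obtain ⟨e, he1, he⟩ := hx
  split at he
  · simp at he
  · split_ifs at he with h1
    simp only [Option.some.injEq] at he
    rwa [← he]

theorem mem_hist_of_prefix {h h' : List (GameStep S A C)} (hp : h <+: h') (hh : h' ∈ G.hist) :
    h ∈ G.hist := by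
  obtain ⟨r, rfl⟩ := hp
  induction r using List.reverseRecOn with
  | nil => simpa using hh
  | append_singleton r e ih =>
    rw [← List.append_assoc] at hh
    exact ih ((G.snoc_mem _ _).1 hh).1

theorem mem_nodes {s : S} {h : List (GameStep S A C)} :
    h ∈ G.nodes s ↔ h ∈ G.hist ∧ G.kind h = NodeKind.decision s := by
  simp [nodes]

theorem mem_nodes_of_snoc_mem {h : List (GameStep S A C)} {x : Σ s, A s}
    (hh : h ++ [Sum.inr x] ∈ G.hist) : h ∈ G.nodes x.1 := by
  obtain ⟨h1, h2⟩ := (G.snoc_mem _ _).1 hh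
  refine G.mem_nodes.2 ⟨h1, ?_⟩
  split at h2
  · exact h2.elim
  · simp at h2
  · rename_i s hs
    obtain ⟨a, ha⟩ := h2
    rw [Sum.inr.injEq] at ha
    rw [hs, ha]

theorem repr_mem_nodes (s : S) : G.repr s ∈ G.nodes s :=
  G.mem_nodes.2 (G.infoset_nonempty s).choose_spec

theorem repr_mem_hist (s : S) : G.repr s ∈ G.hist := (G.mem_nodes.1 (G.repr_mem_nodes s)).1

theorem playerSeq_eq_of_mem_nodes {s : S} {h h' : List (GameStep S A C)} (hh : h ∈ G.nodes s)
    (hh' : h' ∈ G.nodes s) : G.playerSeq (G.owner s) h = G.playerSeq (G.owner s) h' :=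
  G.perfect_recall s h (G.mem_nodes.1 hh).1 h' (G.mem_nodes.1 hh').1 (G.mem_nodes.1 hh).2
    (G.mem_nodes.1 hh').2

theorem passesThrough_of_mem_playerSeq {i : Fin 2} {h : List (GameStep S A C)}
    (hh : h ∈ G.hist) {x : Σ s, A s} (hx : x ∈ G.playerSeq i h) : G.PassesThrough x.1 x.2 h := by
  obtain ⟨l, r, hlr⟩ := List.append_of_mem (G.inr_mem_of_mem_playerSeq hx)
  have hp : l ++ [Sum.inr x] <+: h := ⟨r, by simp [hlr]⟩
  exact ⟨l, G.mem_nodes_of_snoc_mem (G.mem_hist_of_prefix hp hh), hp⟩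

theorem PassesThrough.mem_playerSeq {s : S} {a : A s} {h : List (GameStep S A C)}
    (hp : G.PassesThrough s a h) : (⟨s, a⟩ : Σ s, A s) ∈ G.playerSeq (G.owner s) h := by
  obtain ⟨l, _, r, rfl⟩ := hp
  rw [playerSeq_append, playerSeq_append, G.playerSeq_inr_of_owner (x := ⟨s, a⟩) rfl]
  simp

theorem mem_playerSeq_iff {s : S} {a : A s} {i : Fin 2} (hi : G.owner s = i)
    {h : List (GameStep S A C)} (hh : h ∈ G.hist) :
    (⟨s, a⟩ : Σ s, A s) ∈ G.playerSeq i h ↔ G.PassesThrough s a h := by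
  subst hi
  exact ⟨fun hx => G.passesThrough_of_mem_playerSeq hh hx, fun hp => hp.mem_playerSeq⟩

theorem precedes_iff {s s' : S} {a : A s} (hs : G.owner s' = G.owner s) :
    G.Precedes s a s' ↔ G.PassesThrough s a (G.repr s') := by
  refine ⟨fun ⟨_, h', hh', hp⟩ => ?_, fun h => ⟨hs, _, G.repr_mem_nodes s', h⟩⟩
  have := hp.mem_playerSeq
  rw [← hs, G.playerSeq_eq_of_mem_nodes hh' (G.repr_mem_nodes s')] at this
  exact (G.mem_playerSeq_iff hs.symm (G.repr_mem_hist s')).1 this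

/-- By perfect recall, no path visits an infoset twice. -/
theorem not_mem_playerSeq_of_mem_nodes {s : S} {h : List (GameStep S A C)} (hh : h ∈ G.nodes s)
    (a : A s) (i : Fin 2) : (⟨s, a⟩ : Σ s, A s) ∉ G.playerSeq i h := by
  intro hx
  have hi : G.owner s = i := G.owner_eq_of_mem_playerSeq hx
  obtain ⟨l, hl, r, hr⟩ := G.passesThrough_of_mem_playerSeq (G.mem_nodes.1 hh).1 hx
  have h1 := G.playerSeq_eq_of_mem_nodes hl hh
  rw [← hr, playerSeq_append, playerSeq_append,
    G.playerSeq_inr_of_owner (x := ⟨s, a⟩) rfl] at h1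
  have := congrArg List.length h1
  simp at this

theorem nodup_map_fst_playerSeq (i : Fin 2) {h : List (GameStep S A C)} (hh : h ∈ G.hist) :
    ((G.playerSeq i h).map Sigma.fst).Nodup := by
  induction h using List.reverseRecOn with
  | nil => simp [playerSeq_nil]
  | append_singleton h e ih =>
    have ih := ih ((G.snoc_mem _ _).1 hh).1
    rw [playerSeq_append]
    cases e with
    | inl c => simpa [playerSeq_inl] using ih
    | inr x =>
      by_cases hx : G.owner x.1 = i
      · rw [G.playerSeq_inr_of_owner hx, List.map_append, List.nodup_append]
        refine ⟨ih, by simp, ?_⟩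
        intro t ht t' ht' htt
        simp only [List.map_cons, List.map_nil, List.mem_singleton] at ht'
        obtain ⟨⟨s, a⟩, hy, rfl⟩ := List.mem_map.1 ht
        have hs : s = x.1 := htt.trans ht'
        subst hs
        exact G.not_mem_playerSeq_of_mem_nodes (G.mem_nodes_of_snoc_mem hh) a i hy
      · simpa [G.playerSeq_inr_of_owner_ne hx] using ih

theorem eq_of_prefix_of_mem_nodes {s : S} {h h' : List (GameStep S A C)} (hh : h ∈ G.nodes s)
    (hh' : h' ∈ G.nodes s) (hp : h <+: h') : h = h' := by
  obtain ⟨r, rfl⟩ := hp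
  cases r with
  | nil => simp
  | cons e r =>
    exfalso
    have h1 : h ++ [e] ∈ G.hist :=
      G.mem_hist_of_prefix ⟨r, by simp⟩ (G.mem_nodes.1 hh').1
    have h2 := ((G.snoc_mem _ _).1 h1).2
    rw [(G.mem_nodes.1 hh).2] at h2
    obtain ⟨a, rfl⟩ := h2
    refine G.not_mem_playerSeq_of_mem_nodes hh' a (G.owner s) ?_
    exact PassesThrough.mem_playerSeq G ⟨h, hh, r, by simp⟩

/-! ### Reach probabilities and the sequence form -/

/-- The contribution of player `i` to the probability of reaching the node `h`. -/
noncomputable def playerReach (π : Profile S A) (i : Fin 2) (h : List (GameStep S A C)) : ℝ :=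
  ((G.playerSeq i h).map fun y => π y.1 y.2).prod

theorem playerReach_nil (π : Profile S A) (i : Fin 2) : G.playerReach π i [] = 1 := rfl

theorem playerReach_snoc_inl (π : Profile S A) (i : Fin 2) (h : List (GameStep S A C)) (c : C) :
    G.playerReach π i (h ++ [Sum.inl c]) = G.playerReach π i h := by
  simp [playerReach, playerSeq_append, playerSeq_inl]

theorem playerReach_snoc_inr (π : Profile S A) (i : Fin 2) (h : List (GameStep S A C))
    (x : Σ s, A s) : G.playerReach π i (h ++ [Sum.inr x]) =
      G.playerReach π i h * if G.owner x.1 = i then π x.1 x.2 else 1 := by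
  split_ifs with hx
  · simp [playerReach, playerSeq_append, G.playerSeq_inr_of_owner hx]
  · simp [playerReach, playerSeq_append, G.playerSeq_inr_of_owner_ne hx]

theorem playerReach_congr {π π' : Profile S A} {i : Fin 2} (h : List (GameStep S A C))
    (hπ : ∀ s, G.owner s = i → π s = π' s) : G.playerReach π i h = G.playerReach π' i h := by
  unfold playerReach
  congr 1
  refine List.map_congr_left fun y hy => ?_
  rw [hπ y.1 (G.owner_eq_of_mem_playerSeq hy)]

theorem playerReach_pos {π : Profile S A} (hπ : ∀ s a, 0 < π s a) (i : Fin 2)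
    (h : List (GameStep S A C)) : 0 < G.playerReach π i h := by
  refine List.prod_pos fun x hx => ?_
  obtain ⟨y, _, rfl⟩ := List.mem_map.1 hx
  exact hπ _ _

theorem playerReach_le_one {π : Profile S A} (hπ : ∀ s a, 0 < π s a) (hπ1 : ∀ s a, π s a ≤ 1)
    (i : Fin 2) (h : List (GameStep S A C)) : G.playerReach π i h ≤ 1 := by
  unfold playerReach
  induction G.playerSeq i h with
  | nil => simp
  | cons y l ih =>
    simp only [List.map_cons, List.prod_cons]
    exact mul_le_one₀ (hπ1 _ _) (List.prod_nonneg fun x hx => by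
      obtain ⟨y, _, rfl⟩ := List.mem_map.1 hx
      exact (hπ _ _).le) ih

theorem at_lastSeq (π : Profile S A) (i : Fin 2) {h : List (GameStep S A C)} (hh : h ∈ G.hist) :
    (G.seqForm π).at (G.lastSeq i h) = G.playerReach π i h := by
  induction h using List.reverseRecOn with
  | nil => simp [lastSeq, playerSeq_nil, SeqVec.at, playerReach]
  | append_singleton h e ih =>
    have ih := ih ((G.snoc_mem _ _).1 hh).1
    cases e with
    | inl c =>
      rw [playerReach_snoc_inl, ← ih, lastSeq, playerSeq_append, playerSeq_inl, List.append_nil,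
        lastSeq]
    | inr x =>
      rw [playerReach_snoc_inr, lastSeq, playerSeq_append]
      split_ifs with hx
      · rw [G.playerSeq_inr_of_owner hx]
        have hn := G.mem_nodes_of_snoc_mem hh
        simp only [List.getLast?_append, List.getLast?_singleton, Option.some_or, SeqVec.at,
          seqForm]
        rw [G.playerSeq_eq_of_mem_nodes (G.repr_mem_nodes x.1) hn, hx]
        rfl
      · rw [G.playerSeq_inr_of_owner_ne hx, List.append_nil, mul_one, ← ih, lastSeq]

theorem at_parentSeq (π : Profile S A) (s : S) :
    (G.seqForm π).at (G.parentSeq s) = G.playerReach π (G.owner s) (G.repr s) :=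
  G.at_lastSeq π _ (G.repr_mem_hist s)

theorem playerReach_eq_at_parentSeq (π : Profile S A) {s : S} {h : List (GameStep S A C)}
    (hh : h ∈ G.nodes s) : G.playerReach π (G.owner s) h = (G.seqForm π).at (G.parentSeq s) := by
  rw [at_parentSeq, playerReach, playerReach,
    G.playerSeq_eq_of_mem_nodes hh (G.repr_mem_nodes s)]

theorem seqForm_mk (π : Profile S A) (s : S) (a : A s) :
    G.seqForm π ⟨s, a⟩ = (G.seqForm π).at (G.parentSeq s) * π s a := by
  rw [at_parentSeq]
  rfl

theorem seqForm_pos {π : Profile S A} (hπ : ∀ s a, 0 < π s a) (x : Σ s, A s) :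
    0 < G.seqForm π x := by
  rcases x with ⟨s, a⟩
  rw [seqForm_mk, at_parentSeq]
  exact mul_pos (G.playerReach_pos hπ _ _) (hπ s a)

/-- Telescoping of the reach probability along the path to `h`: the actions of player `i` are
switched from `π` to `π'` one after the other. -/
theorem playerReach_sub_eq_list_sum (π' : Profile S A) {π : Profile S A} (hπ : ∀ s a, 0 < π s a)
    (i : Fin 2) {h : List (GameStep S A C)} (hh : h ∈ G.hist) :
    G.playerReach π' i h - G.playerReach π i h =
      ((G.playerSeq i h).map fun x => (G.seqForm π').at (G.parentSeq x.1) *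
        (π' x.1 x.2 - π x.1 x.2) * (G.playerReach π i h / G.seqForm π x)).sum := by
  induction h using List.reverseRecOn with
  | nil => simp [playerReach_nil, playerSeq_nil]
  | append_singleton h e ih =>
    have ih := ih ((G.snoc_mem _ _).1 hh).1
    cases e with
    | inl c =>
      simp only [playerReach_snoc_inl, playerSeq_append, playerSeq_inl, List.append_nil]
      exact ih
    | inr x =>
      simp only [playerReach_snoc_inr]
      by_cases hx : G.owner x.1 = i
      · rw [playerSeq_append, G.playerSeq_inr_of_owner hx]
        simp only [if_pos hx, List.map_append, List.sum_append, List.map_cons, List.map_nil,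
          List.sum_cons, List.sum_nil, add_zero]
        have hn := G.mem_nodes_of_snoc_mem hh
        have h1 : G.playerReach π i h * π x.1 x.2 / G.seqForm π x = 1 := by
          rw [div_eq_one_iff_eq (G.seqForm_pos hπ x).ne']
          rcases x with ⟨s, a⟩
          rw [seqForm_mk, ← G.playerReach_eq_at_parentSeq π hn, hx]
        have h2 : (G.seqForm π').at (G.parentSeq x.1) = G.playerReach π' i h := by
          rw [← G.playerReach_eq_at_parentSeq π' hn, hx]
        have h3 : ((G.playerSeq i h).map fun y => (G.seqForm π').at (G.parentSeq y.1) *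
            (π' y.1 y.2 - π y.1 y.2) *
              (G.playerReach π i h * π x.1 x.2 / G.seqForm π y)).sum =
            ((G.playerSeq i h).map fun y => (G.seqForm π').at (G.parentSeq y.1) *
            (π' y.1 y.2 - π y.1 y.2) * (G.playerReach π i h / G.seqForm π y)).sum *
              π x.1 x.2 := by
          rw [← List.sum_map_mul_right]
          congr 1
          exact List.map_congr_left fun y _ => by ring
        rw [h1, h2, h3, ← ih]
        ring
      · rw [playerSeq_append, G.playerSeq_inr_of_owner_ne hx]
        simp only [if_neg hx, mul_one, List.append_nil]
        exact ih

variable [Fintype S] [∀ s, Fintype (A s)]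

open scoped Classical in
theorem playerReach_sub_eq_sum (π' : Profile S A) {π : Profile S A} (hπ : ∀ s a, 0 < π s a)
    (i : Fin 2) {h : List (GameStep S A C)} (hh : h ∈ G.hist) :
    G.playerReach π' i h - G.playerReach π i h =
      ∑ s ∈ Finset.univ.filter (fun s => G.owner s = i), (G.seqForm π').at (G.parentSeq s) *
        ∑ a, (π' s a - π s a) *
          if G.PassesThrough s a h then G.playerReach π i h / G.seqForm π ⟨s, a⟩ else 0 := by
  rw [G.playerReach_sub_eq_list_sum π' hπ i hh,
    ← List.sum_toFinset _ (List.Nodup.of_map _ (G.nodup_map_fst_playerSeq i hh))]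
  have h1 : (G.playerSeq i h).toFinset = Finset.univ.filter fun x : Σ s, A s =>
      G.owner x.1 = i ∧ G.PassesThrough x.1 x.2 h := by
    ext ⟨s, a⟩
    simp only [List.mem_toFinset, Finset.mem_filter, Finset.mem_univ, true_and]
    exact ⟨fun hx => ⟨G.owner_eq_of_mem_playerSeq hx, G.passesThrough_of_mem_playerSeq hh hx⟩,
      fun hx => (G.mem_playerSeq_iff hx.1 hh).2 hx.2⟩
  rw [h1, Finset.sum_filter, Fintype.sum_sigma, Finset.sum_filter]
  refine Finset.sum_congr rfl fun s _ => ?_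
  by_cases hs : G.owner s = i
  · simp only [hs, true_and, if_true, Finset.mul_sum]
    refine Finset.sum_congr rfl fun a _ => ?_
    split_ifs <;> ring
  · simp [hs]

end EFG

/-! ### The performance difference identity and Nash equilibria -/

namespace EFG

variable {S : Type*} {A : S → Type*} {C : Type*} [Fintype C] (G : EFG S A C)

theorem chanceReach_nil : G.chanceReach [] = 1 := by simp [chanceReach]

theorem chanceReach_snoc (h : List (GameStep S A C)) (e : GameStep S A C) :
    G.chanceReach (h ++ [e]) = G.chanceReach h *
      match e with
      | Sum.inl c => G.chanceProb h c
      | Sum.inr _ => 1 := by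
  unfold chanceReach
  rw [List.length_append, List.length_singleton, Finset.prod_range_succ]
  congr 1
  · refine Finset.prod_congr rfl fun k hk => ?_
    have hk := Finset.mem_range.1 hk
    rw [List.getElem?_append_left hk, List.take_append_of_le_length hk.le]
  · cases e <;> simp

theorem chanceReach_pos {h : List (GameStep S A C)} (hh : h ∈ G.hist) : 0 < G.chanceReach h := by
  induction h using List.reverseRecOn with
  | nil => simp [chanceReach_nil]
  | append_singleton h e ih =>
    obtain ⟨h1, h2⟩ := (G.snoc_mem _ _).1 hh
    rw [chanceReach_snoc]
    cases e with
    | inr x => simpa using ih h1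
    | inl c =>
      refine mul_pos (ih h1) ?_
      split at h2
      · exact h2.elim
      · obtain ⟨c', hc, hp⟩ := h2
        rw [Sum.inl.injEq] at hc
        rwa [← hc] at hp
      · simp at h2

theorem oppReach_eq (π : Profile S A) (s : S) :
    G.oppReach π s = ∑ h ∈ G.nodes s, G.chanceReach h * G.playerReach π (G.owner s).rev h :=
  Finset.sum_congr rfl fun h hh => by rw [G.at_lastSeq π _ (G.mem_nodes.1 hh).1]

theorem oppReach_pos {π : Profile S A} (hπ : ∀ s a, 0 < π s a) (s : S) : 0 < G.oppReach π s := by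
  rw [oppReach_eq]
  exact Finset.sum_pos (fun h hh => mul_pos (G.chanceReach_pos (G.mem_nodes.1 hh).1)
    (G.playerReach_pos hπ _ _)) ⟨_, G.repr_mem_nodes s⟩

theorem playerReach_zero_mul_one (π : Profile S A) (i : Fin 2) (h : List (GameStep S A C)) :
    G.playerReach π 0 h * G.playerReach π 1 h =
      G.playerReach π i h * G.playerReach π i.rev h := by
  fin_cases i
  · rfl
  · exact mul_comm _ _

theorem expectedUtility_seqForm (π : Profile S A) :
    G.expectedUtility (G.seqForm π) = ∑ h ∈ G.hist,
      G.chanceReach h * (G.playerReach π 0 h * G.playerReach π 1 h) * G.utility h :=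
  Finset.sum_congr rfl fun h hh => by
    rw [G.at_lastSeq π _ hh, G.at_lastSeq π _ hh]
    ring

open scoped Classical in
theorem counterfactualValue_eq (π : Profile S A) (s : S) (a : A s) :
    G.counterfactualValue π s a = ∑ h ∈ G.hist,
      G.chanceReach h * G.playerReach π (G.owner s).rev h * G.payoff (G.owner s) h *
        if G.PassesThrough s a h then G.playerReach π (G.owner s) h / G.seqForm π ⟨s, a⟩
        else 0 := by
  rw [counterfactualValue, Finset.sum_filter]
  refine Finset.sum_congr rfl fun h hh => ?_
  rw [G.at_lastSeq π _ hh, G.at_lastSeq π _ hh]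
  split_ifs <;> ring

theorem trajectoryQ_eq {π : Profile S A} (hπ : ∀ s a, 0 < π s a) (s : S) (a : A s) :
    G.trajectoryQ π s a = (G.seqForm π).at (G.parentSeq s) * G.counterfactualValue π s a := by
  have h1 := G.playerReach_pos hπ (G.owner s) (G.repr s)
  rw [← at_parentSeq] at h1
  have h2 := hπ s a
  classical
  rw [trajectoryQ, counterfactualValue, Finset.mul_sum, Finset.mul_sum]
  refine Finset.sum_congr rfl fun h hh => ?_
  have hh := (Finset.mem_filter.1 hh).1
  rw [seqForm_mk]
  simp only [G.at_lastSeq π _ hh]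
  have h3 := G.playerReach_zero_mul_one π (G.owner s) h
  rw [mul_assoc (G.chanceReach h), h3]
  field_simp

theorem qValue_eq {π : Profile S A} (hπ : ∀ s a, 0 < π s a) (s : S) (a : A s) :
    G.qValue π s a = G.counterfactualValue π s a / G.oppReach π s := by
  have h1 := G.playerReach_pos hπ (G.owner s) (G.repr s)
  rw [← at_parentSeq] at h1
  have h2 : ∑ h ∈ G.nodes s,
      G.chanceReach h * (G.seqForm π).at (G.lastSeq 0 h) * (G.seqForm π).at (G.lastSeq 1 h) =
      (G.seqForm π).at (G.parentSeq s) * G.oppReach π s := by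
    rw [oppReach_eq, Finset.mul_sum]
    refine Finset.sum_congr rfl fun h hh => ?_
    have hm := (G.mem_nodes.1 hh).1
    rw [← G.playerReach_eq_at_parentSeq π hh, G.at_lastSeq π _ hm, G.at_lastSeq π _ hm, mul_assoc,
      G.playerReach_zero_mul_one π (G.owner s) h]
    ring
  rw [qValue, h2, G.trajectoryQ_eq hπ, mul_div_mul_left _ _ h1.ne']

variable [Fintype S] [∀ s, Fintype (A s)]

open scoped Classical in
theorem sum_mul_playerReach_sub {β : Type*} (H : Finset β) (w : β → ℝ)
    (f : β → List (GameStep S A C)) (π' : Profile S A) {π : Profile S A}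
    (hπ : ∀ s a, 0 < π s a) (i : Fin 2) (hf : ∀ b ∈ H, f b ∈ G.hist) :
    ∑ b ∈ H, w b * (G.playerReach π' i (f b) - G.playerReach π i (f b)) =
      ∑ s ∈ Finset.univ.filter (fun s => G.owner s = i), (G.seqForm π').at (G.parentSeq s) *
        ∑ a, (π' s a - π s a) * ∑ b ∈ H, w b *
          if G.PassesThrough s a (f b) then G.playerReach π i (f b) / G.seqForm π ⟨s, a⟩
          else 0 := by
  calc _ = ∑ b ∈ H, ∑ s ∈ Finset.univ.filter (fun s => G.owner s = i),
        ∑ a, w b * ((G.seqForm π').at (G.parentSeq s) * ((π' s a - π s a) *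
          if G.PassesThrough s a (f b) then G.playerReach π i (f b) / G.seqForm π ⟨s, a⟩
          else 0)) := by
        refine Finset.sum_congr rfl fun b hb => ?_
        rw [G.playerReach_sub_eq_sum π' hπ i (hf b hb), Finset.mul_sum]
        refine Finset.sum_congr rfl fun s _ => ?_
        rw [Finset.mul_sum, Finset.mul_sum]
    _ = _ := by
        rw [Finset.sum_comm]
        refine Finset.sum_congr rfl fun s _ => ?_
        rw [Finset.sum_comm, Finset.mul_sum]
        refine Finset.sum_congr rfl fun a _ => ?_
        rw [Finset.mul_sum, Finset.mul_sum]
        refine Finset.sum_congr rfl fun b _ => ?_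
        ring

end EFG

namespace LazyParams

variable {S : Type*} {A : S → Type*} {C : Type*} [Fintype C] (p : LazyParams S A) (G : EFG S A C)

theorem mult_pos {π : Profile S A} (hπ : ∀ s a, 0 < π s a) (s : S) : 0 < p.mult G π s := by
  unfold mult
  split
  · exact one_pos
  · rw [G.at_parentSeq]
    exact one_div_pos.2 (G.playerReach_pos hπ _ _)
  · exact G.oppReach_pos hπ s

theorem playerReach_deviate_self (π π' : Profile S A) (i : Fin 2) (h : List (GameStep S A C)) :
    G.playerReach (deviate G i π π') i h = G.playerReach π' i h :=
  G.playerReach_congr h fun s hs => by simp [deviate, hs]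

theorem playerReach_deviate_of_ne (π π' : Profile S A) {i j : Fin 2} (hij : j ≠ i)
    (h : List (GameStep S A C)) :
    G.playerReach (deviate G i π π') j h = G.playerReach π j h :=
  G.playerReach_congr h fun s hs => by simp [deviate, hs, hij]

theorem deviate_pos {π π' : Profile S A} (hπ : ∀ s a, 0 < π s a) (hπ' : ∀ s a, 0 < π' s a)
    (i : Fin 2) (s : S) (a : A s) : 0 < deviate G i π π' s a := by
  unfold deviate
  split_ifs
  exacts [hπ' s a, hπ s a]

theorem sum_filter_owner [Fintype S] (f : S → ℝ) :
    ∑ s ∈ Finset.univ.filter (fun s => G.owner s = 0), f s +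
      ∑ s ∈ Finset.univ.filter (fun s => G.owner s = 1), f s = ∑ s, f s := by
  rw [← Finset.sum_filter_add_sum_filter_not Finset.univ (fun s => G.owner s = 0) f]
  congr 2
  ext s
  simp only [Finset.mem_filter, Finset.mem_univ, true_and]
  constructor
  · intro h; rw [h]; decide
  · intro h; exact (Fin.exists_fin_two.1 ⟨_, rfl⟩ : G.owner s = 0 ∨ G.owner s = 1).resolve_left h

variable [∀ s, Fintype (A s)]

theorem dilatedTerm_seqForm {π : Profile S A} (hπ : ∀ s a, 0 < π s a) (s : S) :
    p.dilatedTerm G (G.seqForm π) s =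
      (G.seqForm π).at (G.parentSeq s) * p.psi s (π s) := by
  have h1 := G.playerReach_pos hπ (G.owner s) (G.repr s)
  rw [← G.at_parentSeq] at h1
  rw [dilatedTerm]
  congr 2
  ext a
  rw [G.seqForm_mk, mul_div_cancel_left₀ _ h1.ne']

variable [Fintype S]

/-- All three types of feedback are the regularized counterfactual value divided by `m_s`. -/
theorem mult_mul_q {π : Profile S A} (hπ : ∀ s a, 0 < π s a) (s : S) (a : A s) :
    p.mult G π s * p.q G π s a = G.counterfactualValue π s a - p.τ * p.futureReg G π s a := by
  have hm := p.mult_pos G hπ s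
  have h1 : p.mult G π s * p.rawFeedback G π s a = G.counterfactualValue π s a := by
    have h2 := G.playerReach_pos hπ (G.owner s) (G.repr s)
    rw [← G.at_parentSeq] at h2
    unfold mult rawFeedback
    cases p.feedback
    · exact one_mul _
    · simp only [G.trajectoryQ_eq hπ]
      field_simp
    · simp only [G.qValue_eq hπ]
      have := G.oppReach_pos hπ s
      field_simp
  rw [q, mul_sub, h1]
  field_simp

theorem dilatedReg_seqForm {π : Profile S A} (hπ : ∀ s a, 0 < π s a) (i : Fin 2) :
    p.dilatedReg G i (G.seqForm π) = ∑ s ∈ Finset.univ.filter (fun s => G.owner s = i),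
      G.playerReach π i (G.repr s) * p.psi s (π s) :=
  Finset.sum_congr rfl fun s hs => by
    rw [p.dilatedTerm_seqForm G hπ, G.at_parentSeq, (Finset.mem_filter.1 hs).2]

theorem dilatedReg_deviate_of_ne {π π' : Profile S A} (hπ : ∀ s a, 0 < π s a)
    (hπ' : ∀ s a, 0 < π' s a) {i j : Fin 2} (hij : j ≠ i) :
    p.dilatedReg G j (G.seqForm (deviate G i π π')) = p.dilatedReg G j (G.seqForm π) := by
  rw [p.dilatedReg_seqForm G hπ, p.dilatedReg_seqForm G (deviate_pos G hπ hπ' i)]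
  refine Finset.sum_congr rfl fun s hs => ?_
  have hs := (Finset.mem_filter.1 hs).2
  rw [playerReach_deviate_of_ne G π π' hij]
  congr 2
  simp [deviate, hs, hij]

/-- The change of the dilated regularizer splits into local changes and the change of the
probabilities to meet regularizers further down. -/
theorem dilatedReg_deviate_sub {π π' : Profile S A} (hπ : ∀ s a, 0 < π s a)
    (hπ' : ∀ s a, 0 < π' s a) (i : Fin 2) :
    p.dilatedReg G i (G.seqForm (deviate G i π π')) - p.dilatedReg G i (G.seqForm π) =
      ∑ s ∈ Finset.univ.filter (fun s => G.owner s = i), (G.seqForm π').at (G.parentSeq s) *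
        (∑ a, (π' s a - π s a) * p.futureReg G π s a + (p.psi s (π' s) - p.psi s (π s))) := by
  classical
  have h1 := G.sum_mul_playerReach_sub (Finset.univ.filter (fun s => G.owner s = i))
    (fun s => p.psi s (π s)) G.repr π' hπ i (fun s _ => G.repr_mem_hist s)
  have h2 : ∀ s ∈ Finset.univ.filter (fun s => G.owner s = i), ∀ a,
      (∑ s' ∈ Finset.univ.filter (fun s => G.owner s = i), p.psi s' (π s') *
        if G.PassesThrough s a (G.repr s') then
          G.playerReach π i (G.repr s') / G.seqForm π ⟨s, a⟩ else 0) =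
      p.futureReg G π s a := by
    intro s hs a
    have hs := (Finset.mem_filter.1 hs).2
    rw [futureReg, Finset.sum_filter, Finset.sum_filter]
    refine Finset.sum_congr rfl fun s' _ => ?_
    by_cases hs' : G.owner s' = i
    · rw [if_pos hs', G.at_parentSeq, hs']
      have := G.precedes_iff (a := a) (hs'.trans hs.symm)
      simp only [this]
      split_ifs <;> ring
    · have : ¬ G.Precedes s a s' := fun h => hs' (h.1.trans hs)
      rw [if_neg hs', if_neg this]
  rw [p.dilatedReg_seqForm G hπ, p.dilatedReg_seqForm G (deviate_pos G hπ hπ' i)]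
  have h3 : ∀ s ∈ Finset.univ.filter (fun s => G.owner s = i),
      G.playerReach (deviate G i π π') i (G.repr s) * p.psi s (deviate G i π π' s) =
        p.psi s (π s) * (G.playerReach π' i (G.repr s) - G.playerReach π i (G.repr s)) +
        (G.seqForm π').at (G.parentSeq s) * (p.psi s (π' s) - p.psi s (π s)) +
        G.playerReach π i (G.repr s) * p.psi s (π s) := by
    intro s hs
    have hs := (Finset.mem_filter.1 hs).2
    rw [playerReach_deviate_self, G.at_parentSeq, hs]
    have : deviate G i π π' s = π' s := by simp [deviate, hs]
    rw [this]
    ring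
  rw [Finset.sum_congr rfl h3, Finset.sum_add_distrib, Finset.sum_add_distrib, h1,
    add_sub_cancel_right, ← Finset.sum_add_distrib]
  refine Finset.sum_congr rfl fun s hs => ?_
  rw [mul_add]
  simp only [h2 s hs]

theorem expectedUtility_deviate_sub {π π' : Profile S A} (hπ : ∀ s a, 0 < π s a) (i : Fin 2) :
    (if i = 0 then 1 else -1) * (G.expectedUtility (G.seqForm (deviate G i π π')) -
        G.expectedUtility (G.seqForm π)) =
      ∑ s ∈ Finset.univ.filter (fun s => G.owner s = i), (G.seqForm π').at (G.parentSeq s) *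
        ∑ a, (π' s a - π s a) * G.counterfactualValue π s a := by
  classical
  have h1 := G.sum_mul_playerReach_sub G.hist
    (fun h => G.chanceReach h * G.playerReach π i.rev h * G.payoff i h) id π' hπ i
    (fun h hh => hh)
  have hne : i.rev ≠ i := by fin_cases i <;> decide
  rw [G.expectedUtility_seqForm, G.expectedUtility_seqForm, ← Finset.sum_sub_distrib,
    Finset.mul_sum]
  calc _ = ∑ h ∈ G.hist, G.chanceReach h * G.playerReach π i.rev h * G.payoff i h *
        (G.playerReach π' i (id h) - G.playerReach π i (id h)) := by
        refine Finset.sum_congr rfl fun h _ => ?_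
        rw [G.playerReach_zero_mul_one _ i, G.playerReach_zero_mul_one _ i,
          playerReach_deviate_self, playerReach_deviate_of_ne G π π' hne, EFG.payoff, id]
        split_ifs <;> ring
    _ = _ := by
        rw [h1]
        refine Finset.sum_congr rfl fun s hs => ?_
        have hs := (Finset.mem_filter.1 hs).2
        subst hs
        simp only [G.counterfactualValue_eq, id]

theorem objective_deviate_sub {π π' : Profile S A} (hπ : ∀ s a, 0 < π s a)
    (hπ' : ∀ s a, 0 < π' s a) (i : Fin 2) :
    (if i = 0 then 1 else -1) * (p.objective G (G.seqForm (deviate G i π π')) -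
        p.objective G (G.seqForm π)) =
      ∑ s ∈ Finset.univ.filter (fun s => G.owner s = i), (G.seqForm π').at (G.parentSeq s) *
        (p.mult G π s * ∑ a, (π' s a - π s a) * p.q G π s a -
          p.τ * (p.psi s (π' s) - p.psi s (π s))) := by
  have h1 := expectedUtility_deviate_sub G (π' := π') hπ i
  have h2 := p.dilatedReg_deviate_sub G hπ hπ' i
  have h3 : ∀ s, (G.seqForm π').at (G.parentSeq s) *
        (p.mult G π s * ∑ a, (π' s a - π s a) * p.q G π s a -
          p.τ * (p.psi s (π' s) - p.psi s (π s))) =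
      (G.seqForm π').at (G.parentSeq s) *
        ∑ a, (π' s a - π s a) * G.counterfactualValue π s a -
      p.τ * ((G.seqForm π').at (G.parentSeq s) *
        (∑ a, (π' s a - π s a) * p.futureReg G π s a +
          (p.psi s (π' s) - p.psi s (π s)))) := by
    intro s
    have h4 : p.mult G π s * ∑ a, (π' s a - π s a) * p.q G π s a =
        ∑ a, (π' s a - π s a) * G.counterfactualValue π s a -
          p.τ * ∑ a, (π' s a - π s a) * p.futureReg G π s a := by
      rw [Finset.mul_sum, Finset.mul_sum, ← Finset.sum_sub_distrib]
      refine Finset.sum_congr rfl fun a _ => ?_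
      linear_combination (π' s a - π s a) * p.mult_mul_q G hπ s a
    rw [h4]
    ring
  rw [Finset.sum_congr rfl fun s _ => h3 s, Finset.sum_sub_distrib, ← Finset.mul_sum, ← h1, ← h2]
  unfold objective
  fin_cases i
  · have := p.dilatedReg_deviate_of_ne G hπ hπ' (i := 0) (j := 1) (by decide)
    simp only [Fin.zero_eta, if_true, this]
    ring
  · have := p.dilatedReg_deviate_of_ne G hπ hπ' (i := 1) (j := 0) (by decide)
    simp only [Fin.mk_one, one_ne_zero, if_false, this]
    ring

/-- Switching to the equilibrium does not hurt the two players in total. -/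
theorem IsNash.sum_nonneg {p : LazyParams S A} {πs : Profile S A} (hNash : p.IsNash G πs)
    (hπs : ∀ s a, 0 < πs s a) {π : Profile S A} (hfeas : p.Feasible π)
    (hπ : ∀ s a, 0 < π s a) :
    0 ≤ ∑ s, (G.seqForm πs).at (G.parentSeq s) *
      (p.mult G π s * ∑ a, (πs s a - π s a) * p.q G π s a -
        p.τ * (p.psi s (πs s) - p.psi s (π s))) := by
  have h0 := p.objective_deviate_sub G hπ hπs 0
  have h1 := p.objective_deviate_sub G hπ hπs 1
  have h2 : ∀ i j : Fin 2, i ≠ j → deviate G i πs π = deviate G j π πs := by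
    intro i j hij
    ext s a
    unfold deviate
    by_cases hi : G.owner s = i
    · rw [if_pos hi, if_neg (by rw [hi]; exact hij)]
    · have : G.owner s = j := by omega
      rw [if_neg hi, if_pos this]
  have h3 := hNash.2 π hfeas
  rw [h2 0 1 (by decide), h2 1 0 (by decide)] at h3
  rw [← sum_filter_owner G, ← h0, ← h1]
  simp only [if_true, one_ne_zero, if_false]
  linarith [h3.1, h3.2]

end LazyParams

/-! ### Bounds of reach probabilities -/

namespace EFG

variable {S : Type*} {A : S → Type*} {C : Type*} [Fintype C] (G : EFG S A C)

theorem chanceProb_le_one {h : List (GameStep S A C)} (hh : h ∈ G.hist)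
    (hk : G.kind h = NodeKind.chance) (c : C) : G.chanceProb h c ≤ 1 := by
  rw [← G.chanceProb_sum h hh hk]
  exact Finset.single_le_sum (f := G.chanceProb h) (fun c _ => G.chanceProb_nonneg h hh hk c)
    (Finset.mem_univ c)

theorem chanceReach_le_one {h : List (GameStep S A C)} (hh : h ∈ G.hist) :
    G.chanceReach h ≤ 1 := by
  induction h using List.reverseRecOn with
  | nil => simp [chanceReach_nil]
  | append_singleton h e ih =>
    obtain ⟨h1, h2⟩ := (G.snoc_mem _ _).1 hh
    rw [chanceReach_snoc]
    cases e with
    | inr x => simpa using ih h1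
    | inl c =>
      split at h2
      · exact h2.elim
      · rename_i hk
        exact mul_le_one₀ (ih h1) (G.chanceProb_nonneg h h1 hk c) (G.chanceProb_le_one h1 hk c)
      · simp at h2

/-- The probability of reaching `h` if both players follow `σ`. -/
noncomputable def totalReach (σ : Profile S A) (h : List (GameStep S A C)) : ℝ :=
  G.chanceReach h * (G.playerReach σ 0 h * G.playerReach σ 1 h)

theorem totalReach_snoc_inl (σ : Profile S A) (h : List (GameStep S A C)) (c : C) :
    G.totalReach σ (h ++ [Sum.inl c]) = G.totalReach σ h * G.chanceProb h c := by
  simp only [totalReach, chanceReach_snoc, playerReach_snoc_inl]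
  ring

theorem totalReach_snoc_inr (σ : Profile S A) (h : List (GameStep S A C)) (x : Σ s, A s) :
    G.totalReach σ (h ++ [Sum.inr x]) = G.totalReach σ h * σ x.1 x.2 := by
  simp only [totalReach, chanceReach_snoc, playerReach_snoc_inr]
  have : G.owner x.1 = 0 ∨ G.owner x.1 = 1 := by omega
  rcases this with h | h <;> simp only [h] <;> simp <;> ring

theorem totalReach_nonneg {σ : Profile S A} (hσ : ∀ s a, 0 ≤ σ s a)
    {h : List (GameStep S A C)} (hh : h ∈ G.hist) : 0 ≤ G.totalReach σ h := by
  have h1 : ∀ i, 0 ≤ G.playerReach σ i h := fun i => List.prod_nonneg fun x hx => by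
    obtain ⟨y, _, rfl⟩ := List.mem_map.1 hx
    exact hσ _ _
  exact mul_nonneg (G.chanceReach_pos hh).le (mul_nonneg (h1 0) (h1 1))

variable [Fintype S] [∀ s, Fintype (A s)]

open scoped Classical in
theorem sum_children_totalReach_le {σ : Profile S A} (hσ : ∀ s a, 0 ≤ σ s a)
    (hσ1 : ∀ s, ∑ a, σ s a ≤ 1) {h : List (GameStep S A C)} (hh : h ∈ G.hist) :
    ∑ e : GameStep S A C, (if h ++ [e] ∈ G.hist then G.totalReach σ (h ++ [e]) else 0) ≤
      G.totalReach σ h := by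
  have h0 := G.totalReach_nonneg hσ hh
  rw [Fintype.sum_sum_type]
  cases hk : G.kind h with
  | terminal => simpa [G.snoc_mem, hk] using h0
  | chance =>
    have h1 : ∀ x : Σ s, A s, h ++ [Sum.inr x] ∉ G.hist := fun x => by simp [G.snoc_mem, hk]
    simp only [h1, if_false, Finset.sum_const_zero, add_zero]
    calc _ ≤ ∑ c, G.totalReach σ h * G.chanceProb h c := by
          refine Finset.sum_le_sum fun c _ => ?_
          split_ifs
          · exact (G.totalReach_snoc_inl σ h c).le
          · exact mul_nonneg h0 (G.chanceProb_nonneg h hh hk c)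
      _ = G.totalReach σ h := by rw [← Finset.mul_sum, G.chanceProb_sum h hh hk, mul_one]
  | decision s =>
    have h1 : ∀ c : C, h ++ [Sum.inl c] ∉ G.hist := fun c => by simp [G.snoc_mem, hk]
    simp only [h1, if_false, Finset.sum_const_zero, zero_add]
    rw [Fintype.sum_sigma]
    calc _ ≤ ∑ s', if s' = s then G.totalReach σ h * ∑ a, σ s a else 0 := by
          refine Finset.sum_le_sum fun s' _ => ?_
          split_ifs with hs
          · subst hs
            rw [Finset.mul_sum]
            refine Finset.sum_le_sum fun a _ => ?_
            split_ifs
            · exact (G.totalReach_snoc_inr σ h ⟨s', a⟩).le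
            · exact mul_nonneg h0 (hσ _ _)
          · refine (Finset.sum_eq_zero fun a _ => if_neg fun hm => hs ?_).le
            have := (G.mem_nodes.1 (G.mem_nodes_of_snoc_mem hm)).2
            rw [hk] at this
            exact (NodeKind.decision.inj this).symm
      _ = G.totalReach σ h * ∑ a, σ s a := by simp
      _ ≤ G.totalReach σ h := mul_le_of_le_one_right h0 (hσ1 s)

open scoped Classical in
/-- The nodes of an antichain below `h` are not reached more often than `h`. The bound `n` of the
height of the subtree is there for the induction. -/
theorem sum_prefix_totalReach_le {σ : Profile S A} (hσ : ∀ s a, 0 ≤ σ s a)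
    (hσ1 : ∀ s, ∑ a, σ s a ≤ 1) {N : Finset (List (GameStep S A C))} (hN : N ⊆ G.hist)
    (hanti : ∀ h ∈ N, ∀ h' ∈ N, h <+: h' → h = h') (n : ℕ) :
    ∀ h ∈ G.hist, (∀ h' ∈ G.hist, h <+: h' → h'.length ≤ h.length + n) →
      ∑ h' ∈ N, (if h <+: h' then G.totalReach σ h' else 0) ≤ G.totalReach σ h := by
  have hmem : ∀ h ∈ N, ∑ h' ∈ N, (if h <+: h' then G.totalReach σ h' else 0) ≤
      G.totalReach σ h := by
    intro h hh
    rw [Finset.sum_eq_single_of_mem h hh, if_pos List.prefix_rfl]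
    exact fun h' hh' hne => if_neg fun hp => hne (hanti h hh h' hh' hp).symm
  induction n with
  | zero =>
    intro h hh hlen
    by_cases hn : h ∈ N
    · exact hmem h hn
    · rw [Finset.sum_eq_zero]
      · exact G.totalReach_nonneg hσ hh
      · refine fun h' hh' => if_neg fun hp => hn ?_
        rwa [hp.eq_of_length_le (hlen h' (hN hh') hp)]
  | succ n ih =>
    intro h hh hlen
    by_cases hn : h ∈ N
    · exact hmem h hn
    refine le_trans (b := ∑ e : GameStep S A C, ∑ h' ∈ N,
      if h ++ [e] <+: h' then G.totalReach σ h' else 0) (le_of_eq ?_)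
      (le_trans (Finset.sum_le_sum fun e _ => ?_) (G.sum_children_totalReach_le hσ hσ1 hh))
    · rw [Finset.sum_comm]
      refine Finset.sum_congr rfl fun h' hh' => ?_
      split_ifs with hp
      · obtain ⟨r, rfl⟩ := hp
        cases r with
        | nil => exact absurd (by simpa using hh') hn
        | cons e r =>
          rw [Finset.sum_eq_single e]
          · rw [if_pos ⟨r, by simp⟩]
          · intro e' _ hne
            refine if_neg fun hp => hne ?_
            rw [List.prefix_append_right_inj, List.cons_prefix_cons] at hp
            exact hp.1
          · simp
      · refine (Finset.sum_eq_zero fun e _ => if_neg fun hp' => hp ?_).symm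
        exact (List.prefix_append h [e]).trans hp'
    · split_ifs with he
      · refine ih (h ++ [e]) he fun h' hh' hp => ?_
        have := hlen h' hh' ((List.prefix_append h [e]).trans hp)
        simp only [List.length_append, List.length_singleton]
        omega
      · exact (Finset.sum_eq_zero fun h' hh' =>
          if_neg fun hp => he (G.mem_hist_of_prefix hp (hN hh'))).le

theorem sum_nodes_totalReach_le_one {σ : Profile S A} (hσ : ∀ s a, 0 ≤ σ s a)
    (hσ1 : ∀ s, ∑ a, σ s a ≤ 1) (s : S) : ∑ h ∈ G.nodes s, G.totalReach σ h ≤ 1 := by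
  classical
  have h1 := G.sum_prefix_totalReach_le hσ hσ1 (N := G.nodes s)
    (fun h hh => (G.mem_nodes.1 hh).1)
    (fun h hh h' hh' hp => G.eq_of_prefix_of_mem_nodes hh hh' hp)
    (G.hist.sup List.length) [] G.nil_mem
    (fun h hh _ => by simpa using Finset.le_sup (f := List.length) hh)
  simpa [totalReach, chanceReach_nil, playerReach_nil] using h1

/-- The player at `s` may play towards `s`; the nodes of `s` are then reached with the
probabilities that chance and the opponent contribute. -/
theorem oppReach_le_one {π : Profile S A} (hπ : ∀ s, π s ∈ stdSimplex ℝ (A s)) (s : S) :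
    G.oppReach π s ≤ 1 := by
  classical
  set i := G.owner s with hi
  set l := G.playerSeq i (G.repr s) with hl
  -- At infosets off the path `σ` puts no mass at all, so it is only sub-stochastic.
  set σ : Profile S A := fun s' a =>
    if G.owner s' = i then (if (⟨s', a⟩ : Σ s, A s) ∈ l then 1 else 0) else π s' a with hσdef
  have hσ : ∀ s' a, 0 ≤ σ s' a := by
    intro s' a
    simp only [hσdef]
    split_ifs
    exacts [zero_le_one, le_rfl, (hπ s').1 a]
  have hnd := G.nodup_map_fst_playerSeq i (G.repr_mem_hist s)
  have hσ1 : ∀ s', ∑ a, σ s' a ≤ 1 := by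
    intro s'
    by_cases hs' : G.owner s' = i
    · simp only [hσdef, if_pos hs']
      by_cases hex : ∃ a, (⟨s', a⟩ : Σ s, A s) ∈ l
      · obtain ⟨a, ha⟩ := hex
        rw [Finset.sum_eq_single a]
        · simp [ha]
        · intro b _ hb
          refine if_neg fun hbl => hb ?_
          have := List.inj_on_of_nodup_map hnd hbl ha rfl
          simpa using this
        · simp
      · push Not at hex
        simp [hex]
    · simp only [hσdef, if_neg hs']
      exact (hπ s').2.le
  refine le_trans (le_of_eq ?_) (G.sum_nodes_totalReach_le_one hσ hσ1 s)
  rw [oppReach_eq]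
  refine Finset.sum_congr rfl fun h hh => ?_
  -- Every action of player `i` on the way to a node of `s` has probability one under `σ`.
  have h1 : G.playerReach σ i h = 1 := by
    refine List.prod_eq_one fun x hx => ?_
    obtain ⟨y, hy, rfl⟩ := List.mem_map.1 hx
    have hyl : y ∈ l := by rwa [hl, ← G.playerSeq_eq_of_mem_nodes hh (G.repr_mem_nodes s)]
    simp [hσdef, G.owner_eq_of_mem_playerSeq hy, hyl]
  have h2 : G.playerReach σ i.rev h = G.playerReach π i.rev h := by
    refine G.playerReach_congr h fun s' hs' => ?_
    have hne : i.rev ≠ i := by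
      generalize i = j
      fin_cases j <;> decide
    ext a
    simp [hσdef, hs', hne]
  rw [totalReach, G.playerReach_zero_mul_one σ i, h1, h2, one_mul]

end EFG

/-! ### The Bregman divergence of the dilated regularizer -/

namespace LazyParams

variable {S : Type*} {A : S → Type*} {C : Type*} [Fintype S] [∀ s, Fintype (A s)] [Fintype C]
  (p : LazyParams S A) (G : EFG S A C)

theorem jointReg_eq_sum (μ : SeqVec S A) : p.jointReg G μ = ∑ s, p.dilatedTerm G μ s :=
  sum_filter_owner G _

/-- The summand of `s` is differentiable at a sequence form, and its derivative is evaluated at the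
difference to another sequence form. It is a perspective `(z, v) ↦ z ψ_s(v / z)`. -/
theorem dilatedTerm_hasFDerivAt {π : Profile S A} (hπ : ∀ s a, 0 < π s a) (s : S) :
    ∃ L : SeqVec S A →L[ℝ] ℝ,
      HasFDerivAt (fun μ => p.dilatedTerm G μ s) L (G.seqForm π) ∧
      ∀ π' : Profile S A, L (G.seqForm π' - G.seqForm π) =
        ((G.seqForm π').at (G.parentSeq s) - (G.seqForm π).at (G.parentSeq s)) *
            p.psi s (π s) +
          (G.seqForm π').at (G.parentSeq s) * fderiv ℝ (p.psi s) (π s) (π' s - π s) := by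
  obtain ⟨Z, hZ, hZ'⟩ : ∃ Z : SeqVec S A →L[ℝ] ℝ,
      HasFDerivAt (fun μ : SeqVec S A => μ.at (G.parentSeq s)) Z (G.seqForm π) ∧
      ∀ μ μ' : SeqVec S A,
        Z (μ' - μ) = μ'.at (G.parentSeq s) - μ.at (G.parentSeq s) := by
    cases G.parentSeq s with
    | none => exact ⟨0, hasFDerivAt_const _ _, by simp [SeqVec.at]⟩
    | some x => exact ⟨ContinuousLinearMap.proj x, hasFDerivAt_apply x _, by simp [SeqVec.at]⟩
  have hz : 0 < (G.seqForm π).at (G.parentSeq s) := by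
    rw [G.at_parentSeq]
    exact G.playerReach_pos hπ _ _
  set z := (G.seqForm π).at (G.parentSeq s)
  have hdiv : (fun a => G.seqForm π ⟨s, a⟩ / z) = π s := by
    ext a
    rw [G.seqForm_mk, mul_div_cancel_left₀ _ hz.ne']
  have hψ : HasFDerivAt (p.psi s) (fderiv ℝ (p.psi s) (π s)) (π s) :=
    (p.reg.hasFDerivAt_reg (p.α s) (hπ s)).differentiableAt.hasFDerivAt
  have hψ' : HasFDerivAt (p.psi s) (fderiv ℝ (p.psi s) (π s))
      (fun a => G.seqForm π ⟨s, a⟩ * z⁻¹) := by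
    simp only [← div_eq_mul_inv, hdiv]
    exact hψ
  have hcoord : ∀ a, HasFDerivAt (fun μ : SeqVec S A => μ ⟨s, a⟩)
      (ContinuousLinearMap.proj (R := ℝ) (φ := fun _ : Σ s, A s => ℝ) ⟨s, a⟩) (G.seqForm π) :=
    fun a => hasFDerivAt_apply _ _
  have hinv := (hasDerivAt_inv hz.ne').comp_hasFDerivAt (G.seqForm π) hZ
  have hu := hasFDerivAt_pi.2 fun a => (hcoord a).mul hinv
  refine ⟨_, hZ.mul (HasFDerivAt.comp (G.seqForm π) hψ' hu), fun π' => ?_⟩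
  have hv' : ∀ (c : ℝ) (v : A s → ℝ),
      c * fderiv ℝ (p.psi s) (π s) v = fderiv ℝ (p.psi s) (π s) (c • v) :=
    fun c v => by rw [map_smul, smul_eq_mul]
  simp only [add_apply, smul_apply, smul_eq_mul, ContinuousLinearMap.comp_apply,
    Function.comp_apply, hv', hZ']
  change _ + p.psi s (fun a => G.seqForm π ⟨s, a⟩ / z) * (_ - z) = _
  rw [hdiv, add_comm, mul_comm (p.psi s (π s))]
  congr 2
  ext a
  change z * (G.seqForm π ⟨s, a⟩ * (-(z ^ 2)⁻¹ * Z (G.seqForm π' - G.seqForm π)) +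
    z⁻¹ * (G.seqForm π' ⟨s, a⟩ - G.seqForm π ⟨s, a⟩)) =
    (G.seqForm π').at (G.parentSeq s) * (π' s a - π s a)
  rw [hZ', G.seqForm_mk, G.seqForm_mk]
  change z * (z * π s a * (-(z ^ 2)⁻¹ * ((G.seqForm π').at (G.parentSeq s) - z)) +
    z⁻¹ * ((G.seqForm π').at (G.parentSeq s) * π' s a - z * π s a)) = _
  field_simp
  ring

/-- The divergence of the dilated regularizer decomposes over the infosets. -/
theorem bregman_jointReg {π : Profile S A} (hπ : ∀ s a, 0 < π s a) {π' : Profile S A}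
    (hπ' : ∀ s a, 0 < π' s a) :
    bregman (p.jointReg G) (G.seqForm π') (G.seqForm π) =
      ∑ s, (G.seqForm π').at (G.parentSeq s) * bregman (p.psi s) (π' s) (π s) := by
  choose L hL hL' using p.dilatedTerm_hasFDerivAt G hπ
  have h1 : HasFDerivAt (p.jointReg G) (∑ s, L s) (G.seqForm π) := by
    have := HasFDerivAt.fun_sum (u := Finset.univ) fun s _ => hL s
    exact this.congr_of_eventuallyEq (Filter.Eventually.of_forall (p.jointReg_eq_sum G))
  rw [bregman, h1.fderiv, jointReg_eq_sum, jointReg_eq_sum, sum_apply,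
    ← Finset.sum_sub_distrib, ← Finset.sum_sub_distrib]
  refine Finset.sum_congr rfl fun s _ => ?_
  rw [hL', p.dilatedTerm_seqForm G hπ, p.dilatedTerm_seqForm G hπ', bregman]
  ring

end LazyParams

/-! ### Bounds of the multipliers -/

namespace LazyParams

variable {S : Type*} {A : S → Type*} {C : Type*} [∀ s, Fintype (A s)] [Fintype C]
  {p : LazyParams S A} {G : EFG S A C}

namespace Admissible

variable (hp : p.Admissible G)

include hp

theorem lower_pos (s : S) (a : A s) : 0 < p.γs s * p.ν s a :=
  mul_pos (hp.γs_pos s) (hp.ν_pos s a)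

theorem pos_of_mem {s : S} {u : A s → ℝ} (hu : u ∈ perturbedSimplex (p.γs s) (p.ν s))
    (a : A s) : 0 < u a :=
  (hp.lower_pos s a).trans_le (hu.2 a)

theorem pos_of_feasible {π : Profile S A} (hπ : p.Feasible π) (s : S) (a : A s) : 0 < π s a :=
  hp.pos_of_mem (hπ s) a

theorem nonempty_actions (s : S) : Nonempty (A s) := by
  by_contra h
  rw [not_nonempty_iff] at h
  simpa using (hp.ν_mem s).2

theorem feasible_ν : p.Feasible p.ν := fun s =>
  ⟨hp.ν_mem s, fun a => mul_le_of_le_one_left (hp.ν_pos s a).le (hp.γs_le s)⟩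

theorem playerReach_le_one {π : Profile S A} (hπ : p.Feasible π) (i : Fin 2)
    (h : List (GameStep S A C)) : G.playerReach π i h ≤ 1 :=
  G.playerReach_le_one (hp.pos_of_feasible hπ)
    (fun s a => apply_le_one_of_mem_stdSimplex (hπ s).1 a) i h

theorem γ_le_apply {π : Profile S A} (hπ : p.Feasible π) (s : S) (a : A s) : p.γ ≤ π s a := by
  refine (hp.γ_le π hπ ⟨s, a⟩).trans ?_
  rw [G.seqForm_mk, G.at_parentSeq]
  exact mul_le_of_le_one_left (hp.pos_of_feasible hπ s a).le (hp.playerReach_le_one hπ _ _)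

theorem γ_le_one (s : S) : p.γ ≤ 1 := by
  obtain ⟨a⟩ := hp.nonempty_actions s
  exact (hp.γ_le_apply hp.feasible_ν s a).trans
    (apply_le_one_of_mem_stdSimplex (hp.ν_mem s) a)

theorem γ_le_playerReach {π : Profile S A} (hπ : p.Feasible π) {s : S} (i : Fin 2)
    {h : List (GameStep S A C)} (hh : h ∈ G.nodes s) : p.γ ≤ G.playerReach π i h := by
  rw [← G.at_lastSeq π i (G.mem_nodes.1 hh).1]
  cases G.lastSeq i h with
  | none => exact hp.γ_le_one s
  | some x => exact hp.γ_le π hπ x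

theorem log_one_div_γ_nonneg (s : S) : 0 ≤ Real.log (1 / p.γ) :=
  Real.log_nonneg (one_le_one_div hp.γ_pos (hp.γ_le_one s))

variable [Fintype S]

theorem M₁_pos (s : S) : 0 < p.M₁ G := by
  unfold M₁
  split
  · exact one_pos
  · exact one_pos
  · have : Nonempty S := ⟨s⟩
    refine mul_pos hp.γ_pos ?_
    obtain ⟨s', hs'⟩ := exists_eq_ciInf_of_finite (f := fun s => G.infosetChance s)
    rw [← hs']
    exact Finset.sum_pos (fun h hh => G.chanceReach_pos (G.mem_nodes.1 hh).1)
      ⟨_, G.repr_mem_nodes s'⟩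

theorem M₁_le_mult {π : Profile S A} (hπ : p.Feasible π) (s : S) :
    p.M₁ G ≤ p.mult G π s := by
  unfold M₁ mult
  cases p.feedback
  · exact le_rfl
  · simp only [G.at_parentSeq]
    exact one_le_one_div (G.playerReach_pos (hp.pos_of_feasible hπ) _ _)
      (hp.playerReach_le_one hπ _ _)
  · have h1 : ⨅ s, G.infosetChance s ≤ G.infosetChance s :=
      ciInf_le (Set.finite_range _).bddBelow s
    refine (mul_le_mul_of_nonneg_left h1 hp.γ_pos.le).trans ?_
    rw [EFG.infosetChance, G.oppReach_eq, Finset.mul_sum]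
    refine Finset.sum_le_sum fun h hh => ?_
    rw [mul_comm]
    exact mul_le_mul_of_nonneg_left (hp.γ_le_playerReach hπ _ hh)
      (G.chanceReach_pos (G.mem_nodes.1 hh).1).le

theorem mult_le_M₂ {π : Profile S A} (hπ : p.Feasible π) (s : S) : p.mult G π s ≤ p.M₂ := by
  unfold M₂ mult
  cases p.feedback
  · exact le_rfl
  · simp only [G.at_parentSeq]
    exact one_div_le_one_div_of_le hp.γ_pos (hp.γ_le_playerReach hπ _ (G.repr_mem_nodes s))
  · exact G.oppReach_le_one (fun s => (hπ s).1) s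

theorem maxRate_nonneg (hQ : 0 ≤ p.qBound) : 0 ≤ p.maxRate G :=
  Real.iSup_nonneg fun s => by
    have := hp.M₁_pos s
    have := hp.log_one_div_γ_nonneg s
    have := hp.τ_pos
    have := hp.α_pos s
    positivity

theorem cDiff_nonneg (hQ : 0 ≤ p.qBound) (s : S) : 0 ≤ p.cDiff G s := by
  have := hp.M₁_pos s
  have := hp.log_one_div_γ_nonneg s
  have := hp.τ_pos
  have := hp.α_pos s
  unfold cDiff
  cases p.reg <;> positivity

theorem iSup_cDiff_nonneg (hQ : 0 ≤ p.qBound) : 0 ≤ ⨆ s, p.cDiff G s :=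
  Real.iSup_nonneg (hp.cDiff_nonneg hQ)

omit [Fintype S] in
theorem ηAnc_nonneg (s : S) : 0 ≤ p.ηAnc G s := by
  refine Real.sSup_nonneg ?_
  rintro x ⟨i, h, _, e, _, rfl⟩
  exact (hp.η_pos _).le

omit [∀ s, Fintype (A s)] hp in
theorem η_le_ηAnc {s : S} {h : List (GameStep S A C)} (hh : h ∈ G.nodes s) {i : Fin 2}
    {e : Σ s, A s} (he : e ∈ G.playerSeq i h) : p.η e.1 ≤ p.ηAnc G s := by
  refine le_csSup (Set.Finite.bddAbove ((Set.finite_range p.η).subset ?_)) ⟨i, h, hh, e, he, rfl⟩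
  rintro x ⟨_, _, _, e, _, rfl⟩
  exact ⟨e.1, rfl⟩

/-- The learning rate of the last ancestor bounds the sum of all earlier ones. -/
theorem sum_η_le (hη : p.LearningRates G) {s : S} {h : List (GameStep S A C)}
    (hh : h ∈ G.nodes s) (i : Fin 2) :
    ((G.playerSeq i h).map fun e => p.η e.1).sum ≤ 2 * p.ηAnc G s := by
  have key : ∀ {B : ℝ}, 0 ≤ B → ∀ {h : List (GameStep S A C)}, h ∈ G.hist →
      (∀ e ∈ G.playerSeq i h, p.η e.1 ≤ B) →
      ((G.playerSeq i h).map fun e => p.η e.1).sum ≤ 2 * B := by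
    intro B hB h hh hle
    induction h using List.reverseRecOn with
    | nil => simpa [G.playerSeq_nil] using hB
    | append_singleton h e ih =>
      have ih := ih ((G.snoc_mem _ _).1 hh).1
      rw [G.playerSeq_append] at hle ⊢
      cases e with
      | inl c => simpa [G.playerSeq_inl] using ih fun e he => hle e (by simp [he])
      | inr x =>
        by_cases hx : G.owner x.1 = i
        · rw [G.playerSeq_inr_of_owner hx] at hle ⊢
          have h1 := hη.condA x.1 i h (G.mem_nodes_of_snoc_mem hh)
          have h2 := hle x (by simp)
          simp only [List.map_append, List.sum_append, List.map_cons, List.map_nil,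
            List.sum_cons, List.sum_nil, add_zero]
          linarith
        · rw [G.playerSeq_inr_of_owner_ne hx, List.append_nil] at hle ⊢
          exact ih hle
  exact key (hp.ηAnc_nonneg s) (G.mem_nodes.1 hh).1 fun e he => η_le_ηAnc hh he

end Admissible

variable [Fintype S]

/-! ### Stability of the multipliers -/

/-- Closeness of two profiles, in the sense in which consecutive strategies of the lazy update are
close: multiplicatively for the entropy, additively for the Euclidean regularizer. The factor `k`
counts the lazy steps between them. -/
def Close (p : LazyParams S A) (G : EFG S A C) (k : ℝ) (π π' : Profile S A) : Prop :=
  match p.reg with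
  | .entropy => ∀ s a, |Real.log (π' s a) - Real.log (π s a)| ≤ k * p.maxRate G * p.η s
  | .euclidean => ∀ s a, |π' s a - π s a| ≤ k * (⨆ s', p.cDiff G s') * p.η s

omit [Fintype S] [∀ s, Fintype (A s)] in
theorem abs_log_playerReach_sub_le {π π' : Profile S A} (hπ : ∀ s a, 0 < π s a)
    (hπ' : ∀ s a, 0 < π' s a) {k : ℝ}
    (hk : ∀ s a, |Real.log (π' s a) - Real.log (π s a)| ≤ k * p.η s) (i : Fin 2)
    (h : List (GameStep S A C)) :
    |Real.log (G.playerReach π' i h) - Real.log (G.playerReach π i h)| ≤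
      k * ((G.playerSeq i h).map fun e => p.η e.1).sum := by
  unfold EFG.playerReach
  have hpos : ∀ {π : Profile S A}, (∀ s a, 0 < π s a) → ∀ l : List (Σ s, A s),
      0 < (l.map fun y => π y.1 y.2).prod := fun hπ l => List.prod_pos fun x hx => by
    obtain ⟨y, _, rfl⟩ := List.mem_map.1 hx
    exact hπ _ _
  induction G.playerSeq i h with
  | nil => simp
  | cons y l ih =>
    simp only [List.map_cons, List.prod_cons, List.sum_cons]
    rw [Real.log_mul (hπ' _ _).ne' (hpos hπ' l).ne', Real.log_mul (hπ _ _).ne' (hpos hπ l).ne',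
      add_sub_add_comm]
    refine (abs_add_le _ _).trans ?_
    linarith [hk y.1 y.2]

omit [Fintype S] [∀ s, Fintype (A s)] in
theorem abs_playerReach_sub_le {π π' : Profile S A} (hπ : ∀ s a, 0 < π s a)
    (hπ1 : ∀ s a, π s a ≤ 1) (hπ' : ∀ s a, 0 < π' s a) (hπ1' : ∀ s a, π' s a ≤ 1) {k : ℝ}
    (hk : ∀ s a, |π' s a - π s a| ≤ k * p.η s) (i : Fin 2) (h : List (GameStep S A C)) :
    |G.playerReach π' i h - G.playerReach π i h| ≤
      k * ((G.playerSeq i h).map fun e => p.η e.1).sum := by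
  unfold EFG.playerReach
  have hpos : ∀ {π : Profile S A}, (∀ s a, 0 < π s a) → (∀ s a, π s a ≤ 1) →
      ∀ l : List (Σ s, A s), 0 < (l.map fun y => π y.1 y.2).prod ∧
        (l.map fun y => π y.1 y.2).prod ≤ 1 := by
    intro π hπ hπ1 l
    induction l with
    | nil => simp
    | cons y l ih =>
      simp only [List.map_cons, List.prod_cons]
      exact ⟨mul_pos (hπ _ _) ih.1, mul_le_one₀ (hπ1 _ _) ih.1.le ih.2⟩
  induction G.playerSeq i h with
  | nil => simp
  | cons y l ih =>
    simp only [List.map_cons, List.prod_cons, List.sum_cons]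
    obtain ⟨h1, h2⟩ := hpos hπ hπ1 l
    have e : ∀ a b P R : ℝ, a * P - b * R = a * (P - R) + (a - b) * R := fun a b P R => by ring
    rw [e]
    refine (abs_add_le _ _).trans ?_
    rw [abs_mul, abs_mul, abs_of_pos h1, abs_of_pos (hπ' _ _), mul_add]
    have h3 := mul_le_of_le_one_left (abs_nonneg ((l.map fun y => π' y.1 y.2).prod -
      (l.map fun y => π y.1 y.2).prod)) (hπ1' y.1 y.2)
    have h4 := mul_le_of_le_one_right (abs_nonneg (π' y.1 y.2 - π y.1 y.2)) h2
    linarith [hk y.1 y.2]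

omit [Fintype S] in
theorem Close.symm {k : ℝ} {π π' : Profile S A} (h : p.Close G k π π') : p.Close G k π' π := by
  unfold Close at h ⊢
  revert h
  cases p.reg <;> exact fun h s a => by rw [abs_sub_comm]; exact h s a

omit [Fintype S] in
theorem Close.trans {k k' : ℝ} {π π' π'' : Profile S A} (h : p.Close G k π π')
    (h' : p.Close G k' π' π'') : p.Close G (k + k') π π'' := by
  unfold Close at h h' ⊢
  revert h h'
  cases p.reg <;> exact fun h h' s a => by
    have h1 := h s a
    have h2 := h' s a
    rw [abs_le] at h1 h2 ⊢
    constructor <;> linarith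

theorem Close.mono (hp : p.Admissible G) (hQ : 0 ≤ p.qBound) {k k' : ℝ} (hk : k ≤ k')
    {π π' : Profile S A} (h : p.Close G k π π') : p.Close G k' π π' := by
  have h1 := hp.maxRate_nonneg hQ
  have h2 := hp.iSup_cDiff_nonneg hQ
  unfold Close at h ⊢
  revert h
  cases p.reg <;> intro h s a <;> refine (h s a).trans ?_ <;> have := (hp.η_pos s).le <;> gcongr

/-- One lazy update of all infosets leads to a close profile. -/
theorem close_of_isLazyStep (hp : p.Admissible G) {π₁ π' : Profile S A}
    (hπ₁ : p.Feasible π₁) {qs : Profile S A} {m : S → ℝ} (hm : ∀ s, p.M₁ G ≤ m s)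
    (hq : ∀ s a, |qs s a| ≤ p.qBound)
    (h : ∀ s, p.IsLazyStep s (qs s) (m s) (π₁ s) (π' s)) : p.Close G 1 π₁ π' := by
  have hπ' : p.Feasible π' := fun s => (h s).1
  unfold Close
  generalize hreg : p.reg = r
  cases r with
  | entropy =>
    intro s a
    have hM := hp.M₁_pos s
    refine ((h s).abs_log_sub_log_le hreg (hp.lower_pos s) (hπ₁ s) hp.τ_pos (hp.α_pos s)
      (hp.η_pos s) (hM.trans_le (hm s)) hp.γ_pos (hq s) (hp.γ_le_apply hπ' s) a).trans ?_
    rw [one_mul, mul_comm]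
    refine mul_le_mul_of_nonneg_right ?_ (hp.η_pos s).le
    refine le_trans ?_ (le_ciSup (f := fun s => 2 * p.qBound / p.α s +
      p.τ / p.M₁ G * Real.log (1 / p.γ)) (Set.finite_range _).bddAbove s)
    have h1 : p.τ / m s ≤ p.τ / p.M₁ G := div_le_div_of_nonneg_left hp.τ_pos.le hM (hm s)
    have := mul_le_mul_of_nonneg_right h1 (hp.log_one_div_γ_nonneg s)
    linarith
  | euclidean =>
    intro s a
    have hM := hp.M₁_pos s
    refine ((h s).abs_sub_le_of_euclidean hreg (hp.lower_pos s) (hπ₁ s) hp.τ_pos (hp.α_pos s)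
      (hp.η_pos s) (hM.trans_le (hm s)) (hq s) a).trans ?_
    rw [one_mul, mul_comm]
    refine mul_le_mul_of_nonneg_right ?_ (hp.η_pos s).le
    refine le_trans ?_ (le_ciSup (f := fun s => p.cDiff G s) (Set.finite_range _).bddAbove s)
    simp only [cDiff, hreg]
    have h1 : √(Fintype.card (A s)) * p.τ / m s ≤ √(Fintype.card (A s)) * p.τ / p.M₁ G :=
      div_le_div_of_nonneg_left (mul_nonneg (Real.sqrt_nonneg _) hp.τ_pos.le) hM (hm s)
    linarith

section Stability

variable (hp : p.Admissible G) (hη : p.LearningRates G) (hQ : 0 ≤ p.qBound)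
  {π π' : Profile S A} (hπ : p.Feasible π) (hπ' : p.Feasible π') (hc : p.Close G 3 π π')

include hp hη hQ hπ hπ' hc

theorem abs_playerReach_sub_le_of_entropy (hr : p.reg = .entropy) {s : S}
    {h : List (GameStep S A C)} (hh : h ∈ G.nodes s) (i : Fin 2) :
    |G.playerReach π' i h - G.playerReach π i h| ≤
      12 * p.maxRate G * p.ηAnc G s * G.playerReach π i h := by
  simp only [Close, hr] at hc
  have h1 := abs_log_playerReach_sub_le (G := G) (hp.pos_of_feasible hπ) (hp.pos_of_feasible hπ') hc i h
  have hK := hp.maxRate_nonneg hQ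
  have h2 : |Real.log (G.playerReach π' i h) - Real.log (G.playerReach π i h)| ≤
      6 * p.ηAnc G s * p.maxRate G := by
    refine h1.trans ?_
    have := mul_le_mul_of_nonneg_left (hp.sum_η_le hη hh i)
      (by positivity : 0 ≤ 3 * p.maxRate G)
    linarith
  have hR := G.playerReach_pos (hp.pos_of_feasible hπ) i h
  have hR' := G.playerReach_pos (hp.pos_of_feasible hπ') i h
  have h3 := Real.abs_exp_sub_one_le (h2.trans (hη.condB s))
  rw [Real.exp_sub, Real.exp_log hR', Real.exp_log hR] at h3
  have h4 : G.playerReach π' i h - G.playerReach π i h =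
      (G.playerReach π' i h / G.playerReach π i h - 1) * G.playerReach π i h := by
    field_simp
  rw [h4, abs_mul, abs_of_pos hR]
  refine mul_le_mul_of_nonneg_right ?_ hR.le
  linarith

theorem abs_playerReach_sub_le_of_euclidean (hr : p.reg = .euclidean) {s : S}
    {h : List (GameStep S A C)} (hh : h ∈ G.nodes s) (i : Fin 2) :
    |G.playerReach π' i h - G.playerReach π i h| ≤
      6 * (⨆ s', p.cDiff G s') * p.ηAnc G s := by
  simp only [Close, hr] at hc
  have h1 := abs_playerReach_sub_le (G := G) (hp.pos_of_feasible hπ)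
    (fun s a => apply_le_one_of_mem_stdSimplex (hπ s).1 a) (hp.pos_of_feasible hπ')
    (fun s a => apply_le_one_of_mem_stdSimplex (hπ' s).1 a) hc i h
  have hK := hp.iSup_cDiff_nonneg hQ
  refine h1.trans ?_
  have := mul_le_mul_of_nonneg_left (hp.sum_η_le hη hh i)
    (by positivity : 0 ≤ 3 * ⨆ s', p.cDiff G s')
  linarith

/-- Multiplicative stability of `m_s`. -/
theorem abs_mult_sub_le (s : S) :
    |p.mult G π' s - p.mult G π s| ≤ p.cDiv G s * p.ηAnc G s * p.mult G π s := by
  have hη0 := hp.ηAnc_nonneg s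
  have hs := G.repr_mem_nodes s
  have hR := G.playerReach_pos (hp.pos_of_feasible hπ) (G.owner s) (G.repr s)
  have hR' := G.playerReach_pos (hp.pos_of_feasible hπ') (G.owner s) (G.repr s)
  have hγ' := hp.γ_le_playerReach hπ' (G.owner s) hs
  have hM := hp.M₁_pos s
  have hMm := hp.M₁_le_mult hπ s
  have hD := hp.iSup_cDiff_nonneg hQ
  have e : ∀ x y : ℝ, 0 < x → 0 < y → |1 / y - 1 / x| = |x - y| / y * (1 / x) := by
    intro x y hx hy
    rw [div_sub_div _ _ hy.ne' hx.ne', one_mul, mul_one, abs_div, abs_of_pos (mul_pos hy hx)]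
    field_simp
  cases hf : p.feedback <;> cases hr : p.reg <;>
    simp only [mult, cDiv, hf, hr, G.at_parentSeq, M₁] at hM hMm ⊢
  · simp
  · simp
  · rw [e _ _ hR hR']
    refine mul_le_mul_of_nonneg_right ?_ (by positivity)
    have h1 := abs_playerReach_sub_le_of_euclidean hp hη hQ hπ' hπ hc.symm hr hs (G.owner s)
    have h2 := hp.γ_pos
    have h3 := hp.γ_le_one s
    calc _ ≤ 6 * (⨆ s', p.cDiff G s') * p.ηAnc G s / p.γ := by gcongr
      _ ≤ 6 * (⨆ s', p.cDiff G s') * p.ηAnc G s / p.γ ^ 2 := by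
          gcongr
          nlinarith
      _ = _ := by ring
  · rw [e _ _ hR hR']
    refine mul_le_mul_of_nonneg_right ?_ (by positivity)
    have h1 := abs_playerReach_sub_le_of_entropy hp hη hQ hπ' hπ hc.symm hr hs (G.owner s)
    rwa [div_le_iff₀ hR']
  · rw [G.oppReach_eq π, G.oppReach_eq π', ← Finset.sum_sub_distrib]
    rw [G.oppReach_eq π] at hMm
    refine (Finset.abs_sum_le_sum_abs _ _).trans ?_
    have h1 : ∀ h ∈ G.nodes s, |G.chanceReach h * G.playerReach π' (G.owner s).rev h -
        G.chanceReach h * G.playerReach π (G.owner s).rev h| ≤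
        6 * (⨆ s', p.cDiff G s') * p.ηAnc G s := by
      intro h hh
      have hm := (G.mem_nodes.1 hh).1
      rw [← mul_sub, abs_mul, abs_of_pos (G.chanceReach_pos hm)]
      exact (mul_le_of_le_one_left (abs_nonneg _) (G.chanceReach_le_one hm)).trans
        (abs_playerReach_sub_le_of_euclidean hp hη hQ hπ hπ' hc hr hh _)
    refine (Finset.sum_le_card_nsmul _ _ _ h1).trans ?_
    rw [nsmul_eq_mul]
    calc _ = (6 * ((G.nodes s).card : ℝ) * (⨆ s', p.cDiff G s') * p.ηAnc G s) * 1 := by ring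
      _ ≤ (6 * ((G.nodes s).card : ℝ) * (⨆ s', p.cDiff G s') * p.ηAnc G s) * _ :=
          mul_le_mul_of_nonneg_left ((one_le_div hM).2 hMm) (by positivity)
      _ = _ := by ring
  · rw [G.oppReach_eq π, G.oppReach_eq π', ← Finset.sum_sub_distrib]
    refine (Finset.abs_sum_le_sum_abs _ _).trans ?_
    rw [Finset.mul_sum]
    refine Finset.sum_le_sum fun h hh => ?_
    have hm := G.chanceReach_pos (G.mem_nodes.1 hh).1
    rw [← mul_sub, abs_mul, abs_of_pos hm]
    have := abs_playerReach_sub_le_of_entropy hp hη hQ hπ hπ' hc hr hh (G.owner s).rev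
    calc _ ≤ G.chanceReach h * _ := mul_le_mul_of_nonneg_left this hm.le
      _ = _ := by ring

/-- Additive stability of `m_s`. -/
theorem mult_sub_le (s : S) :
    p.mult G π' s - p.mult G π s ≤ p.cMinus G s * p.ηAnc G s := by
  have hη0 := hp.ηAnc_nonneg s
  have hs := G.repr_mem_nodes s
  have h0 := abs_mult_sub_le hp hη hQ hπ hπ' hc s
  have h1 := (le_abs_self _).trans h0
  have hm0 := p.mult_pos G (hp.pos_of_feasible hπ) s
  have hM₂ := hp.mult_le_M₂ hπ s
  have hK := hp.maxRate_nonneg hQ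
  have hD := hp.iSup_cDiff_nonneg hQ
  have hγ0 := hp.γ_pos
  cases hf : p.feedback <;> cases hr : p.reg <;> simp only [cMinus, cDiv, hf, hr] at h1 ⊢
  · simpa using h1
  · simpa using h1
  · simp only [mult, hf, G.at_parentSeq]
    have hR := hp.γ_le_playerReach hπ (G.owner s) hs
    have hR' := hp.γ_le_playerReach hπ' (G.owner s) hs
    have hR0 := hγ0.trans_le hR
    have hR0' := hγ0.trans_le hR'
    have h2 := abs_playerReach_sub_le_of_euclidean hp hη hQ hπ' hπ hc.symm hr hs (G.owner s)
    rw [div_sub_div _ _ hR0'.ne' hR0.ne', one_mul, mul_one]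
    calc _ ≤ 6 * (⨆ s', p.cDiff G s') * p.ηAnc G s /
          (G.playerReach π' (G.owner s) (G.repr s) * G.playerReach π (G.owner s) (G.repr s)) := by
          gcongr
          exact (le_abs_self _).trans h2
      _ ≤ 6 * (⨆ s', p.cDiff G s') * p.ηAnc G s / p.γ ^ 2 := by
          rw [sq]
          gcongr
      _ = _ := by ring
  · refine h1.trans ?_
    simp only [M₂, hf] at hM₂
    calc _ ≤ 12 * p.maxRate G * p.ηAnc G s * (1 / p.γ) := by gcongr
      _ = _ := by ring
  · simp only [mult, hf, G.oppReach_eq, ← Finset.sum_sub_distrib]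
    have h1 : ∀ h ∈ G.nodes s, G.chanceReach h * G.playerReach π' (G.owner s).rev h -
        G.chanceReach h * G.playerReach π (G.owner s).rev h ≤
        6 * (⨆ s', p.cDiff G s') * p.ηAnc G s := by
      intro h hh
      have hm := (G.mem_nodes.1 hh).1
      rw [← mul_sub]
      refine (le_abs_self _).trans ?_
      rw [abs_mul, abs_of_pos (G.chanceReach_pos hm)]
      exact (mul_le_of_le_one_left (abs_nonneg _) (G.chanceReach_le_one hm)).trans
        (abs_playerReach_sub_le_of_euclidean hp hη hQ hπ hπ' hc hr hh _)
    refine (Finset.sum_le_card_nsmul _ _ _ h1).trans ?_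
    rw [nsmul_eq_mul]
    exact le_of_eq (by ring)
  · refine h1.trans ?_
    calc _ ≤ 12 * p.maxRate G * p.ηAnc G s * p.M₂ := by gcongr
      _ = _ := by ring

end Stability

end LazyParams

/-! ### Regret of a run with bounded feedback -/

namespace LazyParams

variable {S : Type*} {A : S → Type*} {C : Type*} [∀ s, Fintype (A s)] [Fintype C]

/-- A single trajectory of the lazy update up to time `T`, with estimates `qhat` bounded
by `‖q‖_∞`. -/
structure BoundedRun (p : LazyParams S A) (G : EFG S A C) (T : ℕ)
    (π πbar qhat : ℕ → Profile S A) : Prop where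
  feasible_one : p.Feasible (πbar 1)
  zero_eq : π 0 = πbar 1
  step : ∀ t, 1 ≤ t → t ≤ T → ∀ s,
    p.IsLazyStep s (qhat (t - 1) s) (p.mult G (π (t - 1)) s) (πbar t s) (π t s)
  stepBar : ∀ t, 1 ≤ t → t ≤ T → ∀ s,
    p.IsLazyStep s (qhat t s) (p.mult G (π t) s) (πbar t s) (πbar (t + 1) s)
  bounded : ∀ t ≤ T, ∀ s a, |qhat t s a| ≤ p.qBound

variable [Fintype S]

/-- The error of the estimate `qh` of the feedback `q`, in the direction of the equilibrium. -/
noncomputable def noise (p : LazyParams S A) (G : EFG S A C) (πs π q qh : Profile S A) : ℝ :=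
  ∑ s, (G.seqForm πs).at (G.parentSeq s) *
    (p.mult G π s * ∑ a, (πs s a - π s a) * (q s a - qh s a))

variable {p : LazyParams S A} {G : EFG S A C} {T : ℕ} {π πbar qhat : ℕ → Profile S A}

namespace BoundedRun

omit [Fintype S] in
theorem feasible_bar (hrun : p.BoundedRun G T π πbar qhat) {t : ℕ} (ht : 1 ≤ t)
    (htT : t ≤ T + 1) : p.Feasible (πbar t) := by
  rcases ht.eq_or_lt with rfl | ht
  · exact hrun.feasible_one
  · obtain ⟨t, rfl⟩ : ∃ u, t = u + 1 := ⟨t - 1, by omega⟩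
    exact fun s => (hrun.stepBar t (by omega) (by omega) s).1

omit [Fintype S] in
theorem feasible (hrun : p.BoundedRun G T π πbar qhat) {t : ℕ} (htT : t ≤ T) :
    p.Feasible (π t) := by
  rcases Nat.eq_zero_or_pos t with rfl | ht
  · rw [hrun.zero_eq]
    exact hrun.feasible_one
  · exact fun s => (hrun.step t ht htT s).1

theorem close (hrun : p.BoundedRun G T π πbar qhat) (hp : p.Admissible G) (hQ : 0 ≤ p.qBound)
    {t : ℕ} (ht : t + 1 ≤ T) : p.Close G 3 (π t) (π (t + 1)) := by
  have h1 : ∀ t, t + 1 ≤ T → p.Close G 1 (πbar (t + 1)) (π (t + 1)) := fun t ht =>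
    close_of_isLazyStep hp (hrun.feasible_bar (by omega) (by omega))
      (fun s => hp.M₁_le_mult (hrun.feasible (by omega)) s)
      (fun s a => hrun.bounded t (by omega) s a) (fun s => hrun.step (t + 1) (by omega) ht s)
  rcases Nat.eq_zero_or_pos t with rfl | ht0
  · rw [hrun.zero_eq]
    exact (h1 0 ht).mono hp hQ (by norm_num)
  · have h2 : p.Close G 1 (πbar t) (πbar (t + 1)) :=
      close_of_isLazyStep hp (hrun.feasible_bar ht0 (by omega))
        (fun s => hp.M₁_le_mult (hrun.feasible (by omega)) s)
        (fun s a => hrun.bounded t (by omega) s a) (fun s => hrun.stepBar t ht0 (by omega) s)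
    have h3 : p.Close G 1 (πbar t) (π t) := by
      have := h1 (t - 1) (by omega)
      rwa [Nat.sub_add_cancel ht0] at this
    have := (h3.symm.trans h2).trans (h1 t ht)
    norm_num at this
    exact this

end BoundedRun

theorem qBound_le_modulus_mul_cDiff (hp : p.Admissible G) (s : S) :
    p.qBound ≤ 2 * p.reg.modulus (A s) (p.α s) * p.cDiff G s := by
  have hM := hp.M₁_pos s
  have hL := hp.log_one_div_γ_nonneg s
  have hτ := hp.τ_pos
  have hα := hp.α_pos s
  have := hp.nonempty_actions s
  have hc : (0 : ℝ) < Fintype.card (A s) := by exact_mod_cast Fintype.card_pos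
  cases hr : p.reg <;> simp only [cDiff, RegKind.modulus, hr]
  · have h : 2 * (p.α s / (2 * Fintype.card (A s))) * (Fintype.card (A s) / p.α s * p.qBound +
        √(Fintype.card (A s)) * p.τ / p.M₁ G) = p.qBound +
        2 * (p.α s / (2 * Fintype.card (A s))) * (√(Fintype.card (A s)) * p.τ / p.M₁ G) := by
      field_simp
    rw [h]
    exact le_add_of_nonneg_right (by positivity)
  · have h : 2 * (p.α s / 4) * (2 / p.α s * (p.qBound +
        p.τ * p.α s / p.M₁ G * Real.log (1 / p.γ))) =
        p.qBound + p.τ * p.α s / p.M₁ G * Real.log (1 / p.γ) := by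
      field_simp
      ring
    rw [h]
    exact le_add_of_nonneg_right (by positivity)

/-- The gain from predicting `q'` instead of `q` is compensated by the strong convexity of the
regularizer, up to a term that is linear in the learning rate. -/
theorem sum_mul_sub_bregman_le (hp : p.Admissible G) (hQ : 0 ≤ p.qBound) {s : S}
    {x y q q' : A s → ℝ} (hx : x ∈ stdSimplex ℝ (A s))
    (hy : y ∈ perturbedSimplex (p.γs s) (p.ν s)) (hq : ∀ a, |q a| ≤ p.qBound)
    (hq' : ∀ a, |q' a| ≤ p.qBound) :
    ∑ a, (x a - y a) * (q a - q' a) - 1 / p.η s * bregman (p.psi s) x y ≤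
      2 * p.cDiff G s * p.qBound * p.η s := by
  have := hp.nonempty_actions s
  set κ := p.reg.modulus (A s) (p.α s) with hκ
  set z := ∑ a, |x a - y a| with hz
  have hκ0 : 0 < κ := p.reg.modulus_pos (hp.α_pos s)
  have hη := hp.η_pos s
  have h1 : ∑ a, (x a - y a) * (q a - q' a) ≤ 2 * p.qBound * z := by
    rw [hz, Finset.mul_sum]
    refine Finset.sum_le_sum fun a _ => (le_abs_self _).trans ?_
    rw [abs_mul, mul_comm]
    refine mul_le_mul_of_nonneg_right ?_ (abs_nonneg _)
    exact (abs_sub _ _).trans (by linarith [hq a, hq' a])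
  have h2 : κ * z ^ 2 ≤ bregman (p.psi s) x y :=
    p.reg.modulus_mul_sq_le_bregman (hp.α_pos s) hx hy.1 (hp.pos_of_mem hy)
  have h3 : p.qBound ≤ 2 * κ * p.cDiff G s := qBound_le_modulus_mul_cDiff hp s
  -- Maximize the quadratic polynomial in `z`.
  have h4 : 2 * p.qBound * z - 1 / p.η s * (κ * z ^ 2) ≤ p.qBound ^ 2 * p.η s / κ := by
    have h5 : p.qBound ^ 2 * p.η s / κ - (2 * p.qBound * z - 1 / p.η s * (κ * z ^ 2)) =
        κ / p.η s * (z - p.qBound * p.η s / κ) ^ 2 := by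
      field_simp
      ring
    have : 0 ≤ κ / p.η s * (z - p.qBound * p.η s / κ) ^ 2 := by positivity
    linarith
  have h6 : p.qBound ^ 2 * p.η s / κ ≤ 2 * p.cDiff G s * p.qBound * p.η s := by
    rw [div_le_iff₀ hκ0]
    have := mul_le_mul_of_nonneg_left h3 (mul_nonneg hQ hη.le)
    nlinarith
  have h7 := mul_le_mul_of_nonneg_left h2 (one_div_pos.2 hη).le
  linarith

namespace BoundedRun

variable (hrun : p.BoundedRun G T π πbar qhat) (hp : p.Admissible G) (hη : p.LearningRates G)
  (hQ : 0 ≤ p.qBound) {πs : Profile S A} (hπs : p.Feasible πs)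

include hrun hp hη hQ hπs

/-- One step of optimistic mirror descent at one infoset: the three-point inequalities of both
updates, weighted by the current multiplier. -/
theorem regret_step_le {t : ℕ} (ht : 1 ≤ t) (htT : t ≤ T) (s : S) :
    p.mult G (π t) s * ∑ a, (πs s a - π t s a) * qhat t s a -
        p.τ * (p.psi s (πs s) - p.psi s (π t s)) ≤
      (p.mult G (π t) s / p.η s * (bregman (p.psi s) (πs s) (πbar t s) -
          bregman (p.psi s) (πs s) (πbar (t + 1) s)) -
        p.τ * bregman (p.psi s) (πs s) (πbar (t + 1) s)) +
      p.τ * (p.cDiv G s * p.ηAnc G s *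
        |p.psi s (π t s) - p.psi s (πbar (t + 1) s)|) +
      2 * p.cDiff G s * p.qBound * p.η s * p.M₂ := by
  have hb := hrun.feasible_bar ht (by omega)
  have hb' := hrun.feasible_bar (t := t + 1) (by omega) (by omega)
  have hx := hrun.feasible htT
  have hx' := hrun.feasible (t := t - 1) (by omega)
  have hA := (hrun.stepBar t ht htT s).three_point (hp.pos_of_mem (hb s)) (hp.pos_of_mem (hb' s))
    (hπs s)
  have hB := (hrun.step t ht htT s).three_point (hp.pos_of_mem (hb s)) (hp.pos_of_mem (hx s))
    (hb' s)
  have hm := p.mult_pos G (hp.pos_of_feasible hx) s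
  have hm' := p.mult_pos G (hp.pos_of_feasible hx') s
  have hmM := hp.mult_le_M₂ hx s
  have hclose := hrun.close hp hQ (t := t - 1) (by omega)
  rw [Nat.sub_add_cancel ht] at hclose
  have hstab := abs_mult_sub_le hp hη hQ hx' hx hclose s
  have hpred := sum_mul_sub_bregman_le hp hQ (hb' s).1 (hx s)
    (fun a => hrun.bounded t htT s a) (fun a => hrun.bounded (t - 1) (by omega) s a)
  have hηs := hp.η_pos s
  have hτ := hp.τ_pos
  have hD1 : 0 ≤ bregman (p.psi s) (π t s) (πbar t s) :=
    p.reg.bregman_reg_nonneg (hp.α_pos s) (hx s).1 (hb s).1 (hp.pos_of_mem (hb s))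
  have hD2 : 0 ≤ bregman (p.psi s) (πbar (t + 1) s) (π t s) :=
    p.reg.bregman_reg_nonneg (hp.α_pos s) (hb' s).1 (hx s).1 (hp.pos_of_mem (hx s))
  have hc := hp.cDiff_nonneg hQ s
  set m := p.mult G (π t) s
  set m' := p.mult G (π (t - 1)) s
  set Dsb := bregman (p.psi s) (πs s) (πbar t s)
  set Dsb' := bregman (p.psi s) (πs s) (πbar (t + 1) s)
  set Dbb := bregman (p.psi s) (πbar (t + 1) s) (πbar t s)
  set Dxb := bregman (p.psi s) (π t s) (πbar t s)
  set Dbx := bregman (p.psi s) (πbar (t + 1) s) (π t s)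
  set ψs := p.psi s (πs s)
  set ψx := p.psi s (π t s)
  set ψb := p.psi s (πbar (t + 1) s)
  have hsplit : ∑ a, (πs s a - π t s a) * qhat t s a =
      ∑ a, (πs s a - πbar (t + 1) s a) * qhat t s a +
      ∑ a, (πbar (t + 1) s a - π t s a) * qhat (t - 1) s a +
      ∑ a, (πbar (t + 1) s a - π t s a) * (qhat t s a - qhat (t - 1) s a) := by
    rw [← Finset.sum_add_distrib, ← Finset.sum_add_distrib]
    exact Finset.sum_congr rfl fun a _ => by ring
  rw [hsplit]
  set I₁ := ∑ a, (πs s a - πbar (t + 1) s a) * qhat t s a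
  set I₂ := ∑ a, (πbar (t + 1) s a - π t s a) * qhat (t - 1) s a
  set I₃ := ∑ a, (πbar (t + 1) s a - π t s a) * (qhat t s a - qhat (t - 1) s a)
  -- The update to `πbar (t + 1)`, compared with the equilibrium.
  have hA' : m * I₁ - p.τ * (ψs - ψb) ≤ m / p.η s * (Dsb - Dsb' - Dbb) - p.τ * Dsb' := by
    have := mul_le_mul_of_nonneg_left hA hm.le
    have e1 : m * (I₁ - p.τ / m * (ψs - ψb)) = m * I₁ - p.τ * (ψs - ψb) := by field_simp
    have e2 : m * (1 / p.η s * (Dsb - Dsb' - Dbb) - p.τ / m * Dsb') =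
      m / p.η s * (Dsb - Dsb' - Dbb) - p.τ * Dsb' := by field_simp
    rwa [e1, e2] at this
  -- The update to `π t`, compared with `πbar (t + 1)`; it used the previous multiplier `m'`.
  have hB' : m * I₂ - p.τ * (m / m') * (ψb - ψx) ≤ m / p.η s * (Dbb - Dbx) := by
    have := mul_le_mul_of_nonneg_left hB hm.le
    have e1 : m * (I₂ - p.τ / m' * (ψb - ψx)) = m * I₂ - p.τ * (m / m') * (ψb - ψx) := by
      field_simp
    have e2 : m * (1 / p.η s * (Dbb - Dbx - Dxb) - p.τ / m' * Dbx) =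
        m / p.η s * (Dbb - Dbx) - (m / p.η s * Dxb + m * (p.τ / m' * Dbx)) := by ring
    rw [e1, e2] at this
    have : 0 ≤ m / p.η s * Dxb + m * (p.τ / m' * Dbx) := by positivity
    linarith
  -- The error of the prediction, against the divergence left over from the second update.
  have hC' : m * I₃ - m / p.η s * Dbx ≤ 2 * p.cDiff G s * p.qBound * p.η s * p.M₂ := by
    have e1 : m * I₃ - m / p.η s * Dbx = m * (I₃ - 1 / p.η s * Dbx) := by ring
    rw [e1]
    calc _ ≤ m * (2 * p.cDiff G s * p.qBound * p.η s) := mul_le_mul_of_nonneg_left hpred hm.le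
      _ ≤ p.M₂ * (2 * p.cDiff G s * p.qBound * p.η s) := by gcongr
      _ = _ := by ring
  -- The mismatch of the two multipliers in front of the regularizer.
  have hE : (1 - m / m') * (ψx - ψb) ≤ p.cDiv G s * p.ηAnc G s * |ψx - ψb| := by
    refine (le_abs_self _).trans ?_
    rw [abs_mul]
    refine mul_le_mul_of_nonneg_right ?_ (abs_nonneg _)
    have e1 : 1 - m / m' = -(m - m') / m' := by field_simp; ring
    rw [e1, abs_div, abs_neg, abs_of_pos hm', div_le_iff₀ hm']
    exact hstab
  have hE' := mul_le_mul_of_nonneg_left hE hτ.le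
  have e3 : p.τ * (m / m') * (ψb - ψx) =
      p.τ * ((1 - m / m') * (ψx - ψb)) - p.τ * (ψx - ψb) := by ring
  have e4 : m / p.η s * (Dsb - Dsb' - Dbb) + m / p.η s * (Dbb - Dbx) =
      m / p.η s * (Dsb - Dsb') - m / p.η s * Dbx := by ring
  rw [e3] at hB'
  linarith [mul_add m (I₁ + I₂) I₃, mul_add m I₁ I₂]

/-- Telescoping with varying multipliers. Between consecutive steps the weight `m / η` of the
divergence grows by at most `τ / 2`, which is half of what the regularization takes away. -/
theorem sum_divergence_le (s : S) {n : ℕ} (hn : 1 ≤ n) (hnT : n ≤ T) :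
    ∑ t ∈ Finset.Icc 1 n,
        (p.mult G (π t) s / p.η s * (bregman (p.psi s) (πs s) (πbar t s) -
          bregman (p.psi s) (πs s) (πbar (t + 1) s)) -
        p.τ * bregman (p.psi s) (πs s) (πbar (t + 1) s)) ≤
      p.mult G (π 1) s / p.η s * bregman (p.psi s) (πs s) (πbar 1 s) -
        p.τ / 2 * ∑ t ∈ Finset.Icc 2 n, bregman (p.psi s) (πs s) (πbar t s) -
        (p.mult G (π n) s / p.η s + p.τ) *
          bregman (p.psi s) (πs s) (πbar (n + 1) s) := by
  induction n, hn using Nat.le_induction with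
  | base =>
    simp only [Finset.Icc_self, Finset.sum_singleton]
    rw [Finset.Icc_eq_empty (by norm_num), Finset.sum_empty]
    exact le_of_eq (by ring)
  | succ n hn ih =>
    have ih := ih (by omega)
    rw [← Finset.insert_Icc_right_eq_Icc_add_one (by omega), Finset.sum_insert (by simp),
      ← Finset.insert_Icc_right_eq_Icc_add_one (a := 2) (by omega), Finset.sum_insert (by simp)]
    have hb := hrun.feasible_bar (t := n + 1) (by omega) (by omega)
    have hD : 0 ≤ bregman (p.psi s) (πs s) (πbar (n + 1) s) :=
      p.reg.bregman_reg_nonneg (hp.α_pos s) (hπs s).1 (hb s).1 (hp.pos_of_mem (hb s))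
    have hstab := mult_sub_le hp hη hQ (hrun.feasible (t := n) (by omega)) (hrun.feasible hnT)
      (hrun.close hp hQ hnT) s
    have hηs := hp.η_pos s
    have h1 : p.mult G (π (n + 1)) s / p.η s - p.mult G (π n) s / p.η s ≤ p.τ / 2 := by
      rw [← sub_div, div_le_iff₀ hηs]
      linarith [hη.ratio s]
    have h2 := mul_le_mul_of_nonneg_right h1 hD
    linarith

/-- The bound of the theorem for a single trajectory, with the accumulated noise of the
feedback. -/
theorem sum_bregman_le (hNash : p.IsNash G πs) (hT : 1 ≤ T) :
    ∑ t ∈ Finset.Icc 2 T, bregman (p.jointReg G) (G.seqForm πs) (G.seqForm (πbar t)) ≤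
      2 * ∑ s, p.cDiv G s * p.ηAnc G s * (G.seqForm πs).at (G.parentSeq s) *
          ∑ t ∈ Finset.Icc 1 T, |p.psi s (π t s) - p.psi s (πbar (t + 1) s)|
      + 4 / p.τ * ∑ s, p.cDiff G s * (G.seqForm πs).at (G.parentSeq s) *
          p.qBound * p.η s * p.M₂ * T
      + 2 / p.τ * ∑ s, p.mult G (π 1) s / p.η s * (G.seqForm πs).at (G.parentSeq s) *
          bregman (p.psi s) (πs s) (πbar 1 s)
      + 2 / p.τ * ∑ t ∈ Finset.Icc 1 T,
          p.noise G πs (π t) (fun s a => p.q G (π t) s a) (qhat t) := by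
  have hτ := hp.τ_pos
  have hπs0 := hp.pos_of_feasible hπs
  set w : S → ℝ := fun s => (G.seqForm πs).at (G.parentSeq s) with hw
  have hw0 : ∀ s, 0 ≤ w s := fun s => by
    simp only [hw, G.at_parentSeq]
    exact (G.playerReach_pos hπs0 _ _).le
  set D : ℕ → S → ℝ := fun t s => bregman (p.psi s) (πs s) (πbar t s) with hDdef
  set R : ℕ → S → ℝ := fun t s => p.mult G (π t) s * ∑ a, (πs s a - π t s a) * qhat t s a -
        p.τ * (p.psi s (πs s) - p.psi s (π t s)) with hR
  set N : ℕ → ℝ := fun t => p.noise G πs (π t) (fun s a => p.q G (π t) s a) (qhat t) with hN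
  have hLHS : ∑ t ∈ Finset.Icc 2 T,
      bregman (p.jointReg G) (G.seqForm πs) (G.seqForm (πbar t)) =
      ∑ s, w s * ∑ t ∈ Finset.Icc 2 T, D t s := by
    simp only [Finset.mul_sum]
    rw [Finset.sum_comm]
    refine Finset.sum_congr rfl fun t ht => ?_
    rw [Finset.mem_Icc] at ht
    exact p.bregman_jointReg G
      (hp.pos_of_feasible (hrun.feasible_bar (by omega) (by omega))) hπs0
  have hnash : ∀ t ∈ Finset.Icc 1 T, 0 ≤ ∑ s, w s * R t s + N t := by
    intro t ht
    rw [Finset.mem_Icc] at ht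
    have hf := hrun.feasible ht.2
    refine (hNash.sum_nonneg G hπs0 hf (hp.pos_of_feasible hf)).trans (le_of_eq ?_)
    simp only [hN, noise]
    rw [← Finset.sum_add_distrib]
    refine Finset.sum_congr rfl fun s _ => ?_
    simp only [hR, hw]
    have : ∑ a, (πs s a - π t s a) * p.q G (π t) s a = ∑ a, (πs s a - π t s a) * qhat t s a +
        ∑ a, (πs s a - π t s a) * (p.q G (π t) s a - qhat t s a) := by
      rw [← Finset.sum_add_distrib]
      exact Finset.sum_congr rfl fun a _ => by ring
    rw [this]
    ring
  have hregret : ∀ s, ∑ t ∈ Finset.Icc 1 T, R t s ≤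
      p.mult G (π 1) s / p.η s * D 1 s - p.τ / 2 * ∑ t ∈ Finset.Icc 2 T, D t s +
      p.τ * (p.cDiv G s * p.ηAnc G s *
        ∑ t ∈ Finset.Icc 1 T, |p.psi s (π t s) - p.psi s (πbar (t + 1) s)|) +
      2 * p.cDiff G s * p.qBound * p.η s * p.M₂ * T := by
    intro s
    have h1 := Finset.sum_le_sum fun t (ht : t ∈ Finset.Icc 1 T) =>
      hrun.regret_step_le hp hη hQ hπs (Finset.mem_Icc.1 ht).1 (Finset.mem_Icc.1 ht).2 s
    rw [Finset.sum_add_distrib, Finset.sum_add_distrib, ← Finset.mul_sum, ← Finset.mul_sum,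
      Finset.sum_const, Nat.card_Icc, Nat.add_sub_cancel, nsmul_eq_mul] at h1
    have h2 := hrun.sum_divergence_le hp hη hQ hπs s hT le_rfl
    have hb := hrun.feasible_bar (t := T + 1) (by omega) le_rfl
    have hDT : 0 ≤ bregman (p.psi s) (πs s) (πbar (T + 1) s) :=
      p.reg.bregman_reg_nonneg (hp.α_pos s) (hπs s).1 (hb s).1 (hp.pos_of_mem (hb s))
    have hmT := p.mult_pos G (hp.pos_of_feasible (hrun.feasible (t := T) le_rfl)) s
    have hηs := hp.η_pos s
    have h3 : 0 ≤ (p.mult G (π T) s / p.η s + p.τ) *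
        bregman (p.psi s) (πs s) (πbar (T + 1) s) := by positivity
    linarith
  have htotal : 0 ≤ ∑ s, w s * (p.mult G (π 1) s / p.η s * D 1 s -
      p.τ / 2 * ∑ t ∈ Finset.Icc 2 T, D t s +
      p.τ * (p.cDiv G s * p.ηAnc G s *
        ∑ t ∈ Finset.Icc 1 T, |p.psi s (π t s) - p.psi s (πbar (t + 1) s)|) +
      2 * p.cDiff G s * p.qBound * p.η s * p.M₂ * T) + ∑ t ∈ Finset.Icc 1 T, N t := by
    have h1 := Finset.sum_nonneg hnash
    rw [Finset.sum_add_distrib, Finset.sum_comm] at h1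
    simp only [← Finset.mul_sum] at h1
    have h2 := Finset.sum_le_sum fun s (_ : s ∈ Finset.univ) =>
      mul_le_mul_of_nonneg_left (hregret s) (hw0 s)
    linarith
  have hfinal := mul_nonneg (by positivity : 0 ≤ 2 / p.τ) htotal
  rw [hLHS]
  refine le_of_sub_nonneg (hfinal.trans (le_of_eq ?_))
  rw [mul_add, sub_eq_add_neg, add_right_comm]
  congr 1
  rw [Finset.mul_sum, Finset.mul_sum, Finset.mul_sum, Finset.mul_sum, ← Finset.sum_neg_distrib,
    ← Finset.sum_add_distrib, ← Finset.sum_add_distrib, ← Finset.sum_add_distrib]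
  refine Finset.sum_congr rfl fun s _ => ?_
  field_simp
  ring

end BoundedRun

end LazyParams

/-! ### The Azuma-Hoeffding inequality -/

section Azuma

variable {Ω : Type*} {mΩ : MeasurableSpace Ω} {P : Measure Ω} [IsProbabilityMeasure P]
  {ℱ : Filtration ℕ mΩ} {T : ℕ} {Y : ℕ → Ω → ℝ} {c : ℝ}

omit [IsProbabilityMeasure P] in
theorem ae_abs_sum_le (hb : ∀ t ∈ Finset.Icc 1 T, ∀ᵐ ω ∂P, |Y t ω| ≤ c) :
    ∀ᵐ ω ∂P, |∑ t ∈ Finset.Icc 1 T, Y t ω| ≤ T * c := by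
  filter_upwards [(Finset.eventually_all _).2 hb] with ω hω
  refine (Finset.abs_sum_le_sum_abs _ _).trans ((Finset.sum_le_card_nsmul _ _ _ hω).trans ?_)
  simp

theorem integrable_exp_mul_sum (hm : ∀ t ∈ Finset.Icc 1 T, StronglyMeasurable[ℱ t] (Y t))
    (hb : ∀ t ∈ Finset.Icc 1 T, ∀ᵐ ω ∂P, |Y t ω| ≤ c) (r : ℝ) :
    StronglyMeasurable[ℱ T] (fun ω => Real.exp (r * ∑ t ∈ Finset.Icc 1 T, Y t ω)) ∧
    Integrable (fun ω => Real.exp (r * ∑ t ∈ Finset.Icc 1 T, Y t ω)) P := by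
  have h1 : StronglyMeasurable[ℱ T] (fun ω => Real.exp (r * ∑ t ∈ Finset.Icc 1 T, Y t ω)) := by
    refine Real.continuous_exp.comp_stronglyMeasurable (StronglyMeasurable.const_mul ?_ r)
    exact Finset.stronglyMeasurable_fun_sum _ fun t ht =>
      (hm t ht).mono (ℱ.mono (Finset.mem_Icc.1 ht).2)
  refine ⟨h1, Integrable.of_bound (h1.mono (ℱ.le T)).aestronglyMeasurable
    (Real.exp (|r| * (T * c))) ?_⟩
  filter_upwards [ae_abs_sum_le hb] with ω hω
  rw [Real.norm_eq_abs, Real.abs_exp]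
  refine Real.exp_le_exp.2 ((le_abs_self _).trans ?_)
  rw [abs_mul]
  exact mul_le_mul_of_nonneg_left hω (abs_nonneg r)

/-- The moment generating function of a martingale with bounded increments. On `[-c, c]` the
exponential lies below its chord, whose linear part has mean zero given the past. -/
theorem integral_exp_mul_sum_le (hc : 0 ≤ c)
    (hm : ∀ t ∈ Finset.Icc 1 T, StronglyMeasurable[ℱ t] (Y t))
    (hb : ∀ t ∈ Finset.Icc 1 T, ∀ᵐ ω ∂P, |Y t ω| ≤ c)
    (h0 : ∀ t ∈ Finset.Icc 1 T, P[Y t | ℱ (t - 1)] =ᵐ[P] 0) (r : ℝ) :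
    ∫ ω, Real.exp (r * ∑ t ∈ Finset.Icc 1 T, Y t ω) ∂P ≤
      Real.exp (T * (r * c) ^ 2 / 2) := by
  induction T with
  | zero => simp
  | succ n ih =>
    have hsub : ∀ t ∈ Finset.Icc 1 n, t ∈ Finset.Icc 1 (n + 1) := fun t ht =>
      Finset.Icc_subset_Icc_right (Nat.le_succ n) ht
    have ih := ih (fun t ht => hm t (hsub t ht)) (fun t ht => hb t (hsub t ht))
      (fun t ht => h0 t (hsub t ht))
    have hlast : n + 1 ∈ Finset.Icc 1 (n + 1) := by simp
    obtain ⟨hZm, hZi⟩ := integrable_exp_mul_sum (fun t ht => hm t (hsub t ht))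
      (fun t ht => hb t (hsub t ht)) r
    obtain ⟨_, hZi'⟩ := integrable_exp_mul_sum hm hb r
    set Z : Ω → ℝ := fun ω => Real.exp (r * ∑ t ∈ Finset.Icc 1 n, Y t ω) with hZ
    have hYb := hb _ hlast
    have hYm := ((hm _ hlast).mono (ℱ.le _)).aestronglyMeasurable (μ := P)
    have hYi : Integrable (Y (n + 1)) P := Integrable.of_bound hYm c hYb
    have hZY : Integrable (Z * Y (n + 1)) P := hZi.mul_bdd hYm hYb
    have hZY' : Integrable (fun ω => Z ω * Y (n + 1) ω) P := hZY
    have hzero : ∫ ω, Z ω * Y (n + 1) ω ∂P = 0 := by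
      have h1 : P[Z * Y (n + 1) | ℱ n] =ᵐ[P] 0 := by
        refine (condExp_mul_of_stronglyMeasurable_left hZm hZY hYi).trans ?_
        have := h0 _ hlast
        rw [Nat.add_sub_cancel] at this
        filter_upwards [this] with ω hω
        simp [hω]
      have h2 := integral_condExp (μ := P) (f := Z * Y (n + 1)) (ℱ.le n)
      rw [integral_congr_ae h1] at h2
      simpa using h2.symm
    have hpoint : ∀ᵐ ω ∂P, Real.exp (r * ∑ t ∈ Finset.Icc 1 (n + 1), Y t ω) ≤
        Real.cosh (r * c) * Z ω + Real.sinh (r * c) / c * (Z ω * Y (n + 1) ω) := by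
      filter_upwards [hYb] with ω hω
      rw [← Finset.insert_Icc_right_eq_Icc_add_one (by omega), Finset.sum_insert (by simp),
        mul_add, Real.exp_add, mul_comm]
      have ht : |Y (n + 1) ω / c| ≤ 1 := by
        rw [abs_div, abs_of_nonneg hc]
        exact div_le_one_of_le₀ hω hc
      have h1 := Real.exp_mul_le_cosh_add_mul_sinh ht (r * c)
      have h2 : Y (n + 1) ω / c * (r * c) = r * Y (n + 1) ω := by
        rcases hc.eq_or_lt with rfl | hc
        · simp [abs_nonpos_iff.1 hω]
        · field_simp
      rw [h2] at h1
      refine (mul_le_mul_of_nonneg_left h1 (Real.exp_pos _).le).trans (le_of_eq ?_)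
      simp only [hZ]
      ring
    calc _ ≤ ∫ ω, (Real.cosh (r * c) * Z ω +
          Real.sinh (r * c) / c * (Z ω * Y (n + 1) ω)) ∂P :=
          integral_mono_ae hZi' ((hZi.const_mul _).add (hZY'.const_mul _)) hpoint
      _ = Real.cosh (r * c) * ∫ ω, Z ω ∂P := by
          rw [integral_add (hZi.const_mul _) (hZY'.const_mul _), integral_const_mul,
            integral_const_mul, hzero, mul_zero, add_zero]
      _ ≤ Real.exp ((r * c) ^ 2 / 2) * Real.exp (n * (r * c) ^ 2 / 2) :=
          mul_le_mul (Real.cosh_le_exp_half_sq _) ih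
            (integral_nonneg fun ω => (Real.exp_pos _).le) (Real.exp_pos _).le
      _ = _ := by
          rw [← Real.exp_add]
          congr 1
          push_cast
          ring

/-- The **Azuma-Hoeffding inequality**, in the form of a high-probability bound. -/
theorem one_sub_le_measure_sum_le (hT : 1 ≤ T) (hc : 0 ≤ c)
    (hm : ∀ t ∈ Finset.Icc 1 T, StronglyMeasurable[ℱ t] (Y t))
    (hb : ∀ t ∈ Finset.Icc 1 T, ∀ᵐ ω ∂P, |Y t ω| ≤ c)
    (h0 : ∀ t ∈ Finset.Icc 1 T, P[Y t | ℱ (t - 1)] =ᵐ[P] 0) {δ : ℝ} (hδ0 : 0 < δ)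
    (hδ1 : δ < 1) :
    ENNReal.ofReal (1 - δ) ≤
      P {ω | ∑ t ∈ Finset.Icc 1 T, Y t ω ≤ c * √(2 * T * Real.log (1 / δ))} := by
  have hTr : (0 : ℝ) < T := by exact_mod_cast hT
  -- For `c = 0` the parameter `r` below would not make sense.
  rcases hc.eq_or_lt with rfl | hc
  · have h1 : {ω | ∑ t ∈ Finset.Icc 1 T, Y t ω ≤ 0 * √(2 * T * Real.log (1 / δ))} =ᵐ[P]
        Set.univ := by
      refine Filter.eventuallyEq_univ.2 ?_
      filter_upwards [ae_abs_sum_le hb] with ω hω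
      simpa using (le_abs_self _).trans hω
    rw [measure_congr h1, measure_univ]
    exact ENNReal.ofReal_le_one.2 (by linarith)
  set l := Real.log (1 / δ) with hl
  have hl0 : 0 < l := Real.log_pos (one_lt_one_div hδ0 hδ1)
  set ε := c * √(2 * T * l) with hε
  have hε0 : 0 < ε := mul_pos hc (Real.sqrt_pos.2 (by positivity))
  have hε2 : ε ^ 2 = c ^ 2 * (2 * T * l) := by
    rw [hε, mul_pow, Real.sq_sqrt (by positivity)]
  set X : Ω → ℝ := fun ω => ∑ t ∈ Finset.Icc 1 T, Y t ω with hX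
  have hXm : Measurable X := by
    refine (Finset.stronglyMeasurable_fun_sum _ fun t ht => ?_).measurable
    exact (hm t ht).mono (ℱ.le t)
  -- The choice of `r` minimizes the exponent of the Chernoff bound.
  set r := ε / (T * c ^ 2) with hr
  have hr0 : 0 ≤ r := by positivity
  have h1 := ProbabilityTheory.measure_ge_le_exp_mul_mgf (X := X) ε hr0
    (integrable_exp_mul_sum hm hb r).2
  have h2 : Real.exp (-r * ε) * ProbabilityTheory.mgf X P r ≤ δ := by
    refine (mul_le_mul_of_nonneg_left (integral_exp_mul_sum_le hc.le hm hb h0 r)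
      (Real.exp_pos _).le).trans (le_of_eq ?_)
    rw [← Real.exp_add]
    have : -r * ε + T * (r * c) ^ 2 / 2 = -l := by
      have e : -r * ε + T * (r * c) ^ 2 / 2 = -(ε ^ 2 / (2 * T * c ^ 2)) := by
        rw [hr]
        field_simp
        ring
      rw [e, hε2]
      field_simp
    rw [this, hl, one_div, Real.log_inv, neg_neg, Real.exp_log hδ0]
  have h3 : P {ω | ε ≤ X ω} ≤ ENNReal.ofReal δ := by
    rw [← ENNReal.ofReal_toReal (measure_ne_top P {ω | ε ≤ X ω})]
    exact ENNReal.ofReal_le_ofReal (h1.trans h2)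
  have h4 : {ω | ε ≤ X ω}ᶜ ⊆ {ω | X ω ≤ ε} := fun ω hω => by
    rw [Set.mem_compl_iff, Set.mem_ofPred_eq, not_le] at hω
    exact hω.le
  refine le_trans ?_ (measure_mono h4)
  rw [prob_compl_eq_one_sub (measurableSet_le measurable_const hXm),
    ENNReal.ofReal_sub _ hδ0.le, ENNReal.ofReal_one]
  exact tsub_le_tsub_left h3 1

end Azuma

/-! ### Measurability of the iterates -/

namespace LazyParams

variable {S : Type*} {A : S → Type*} {C : Type*} [∀ s, Fintype (A s)] [Fintype C]
  {p : LazyParams S A} {G : EFG S A C}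

/-- Up to a constant, the objective of a lazy step is a multiple of `u ↦ ⟨u, v⟩ + ψ_s(u)` with
this vector `v`. -/
noncomputable def dualPoint (p : LazyParams S A) (s : S) (qs : A s → ℝ) (m : ℝ)
    (u₀ : A s → ℝ) (a : A s) : ℝ :=
  (-qs a - 1 / p.η s * p.reg.grad (p.α s) u₀ a) / (p.τ / m + 1 / p.η s)

/-- The minimizer is a Lipschitz function of the dual point, by strong convexity. -/
theorem dist_le_of_isLazyStep (hp : p.Admissible G) {s : S} {qs qs' : A s → ℝ} {m m' : ℝ}
    (hm : 0 < m) (hm' : 0 < m') {u₀ u₀' x x' : A s → ℝ} (hu₀ : ∀ a, 0 < u₀ a)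
    (hu₀' : ∀ a, 0 < u₀' a) (h : p.IsLazyStep s qs m u₀ x)
    (h' : p.IsLazyStep s qs' m' u₀' x') :
    dist x x' ≤ 1 / (2 * p.reg.modulus (A s) (p.α s)) *
      dist (p.dualPoint s qs m u₀) (p.dualPoint s qs' m' u₀') := by
  have := hp.nonempty_actions s
  have hx := hp.pos_of_mem h.1
  have hx' := hp.pos_of_mem h'.1
  have hη := hp.η_pos s
  have hτ := hp.τ_pos
  set κ := p.reg.modulus (A s) (p.α s) with hκ
  have hκ0 : 0 < κ := p.reg.modulus_pos (hp.α_pos s)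
  have hvar : ∀ {q : A s → ℝ} {n : ℝ} {w y u : A s → ℝ}, 0 < n → (∀ a, 0 < w a) →
      p.IsLazyStep s q n w y → u ∈ perturbedSimplex (p.γs s) (p.ν s) →
      0 ≤ ∑ a, (u a - y a) * (p.dualPoint s q n w a + p.reg.grad (p.α s) y a) := by
    intro q n w y u hn hw hy hu
    have hB : 0 < p.τ / n + 1 / p.η s := by positivity
    refine le_of_mul_le_mul_left ?_ hB
    rw [mul_zero, Finset.mul_sum]
    refine (hy.variational hw (hp.pos_of_mem hy.1) hu).trans (le_of_eq ?_)
    refine Finset.sum_congr rfl fun a _ => ?_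
    rw [dualPoint]
    have e : (p.τ / n + 1 / p.η s) * ((u a - y a) *
        ((-q a - 1 / p.η s * p.reg.grad (p.α s) w a) / (p.τ / n + 1 / p.η s) +
          p.reg.grad (p.α s) y a)) = (u a - y a) *
        ((-q a - 1 / p.η s * p.reg.grad (p.α s) w a) +
          (p.τ / n + 1 / p.η s) * p.reg.grad (p.α s) y a) := by
      field_simp
    rw [e]
    ring
  set v := p.dualPoint s qs m u₀
  set v' := p.dualPoint s qs' m' u₀'
  set z := ∑ a, |x a - x' a| with hz
  have hz0 : 0 ≤ z := Finset.sum_nonneg fun a _ => abs_nonneg _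
  have h1 := hvar hm hu₀ h h'.1
  have h2 := hvar hm' hu₀' h' h.1
  have h3 : κ * z ^ 2 ≤ bregman (p.reg.reg (p.α s)) x x' :=
    p.reg.modulus_mul_sq_le_bregman (hp.α_pos s) h.1.1 h'.1.1 hx'
  have h4 : κ * z ^ 2 ≤ bregman (p.reg.reg (p.α s)) x' x := by
    have := p.reg.modulus_mul_sq_le_bregman (hp.α_pos s) h'.1.1 h.1.1 hx
    simpa only [hz, abs_sub_comm] using this
  rw [p.reg.bregman_reg _ hx'] at h3
  rw [p.reg.bregman_reg _ hx] at h4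
  have h5 : ∑ a, (x' a - x a) * (v a - v' a) ≤ z * dist v v' := by
    rw [hz, Finset.sum_mul]
    refine Finset.sum_le_sum fun a _ => (le_abs_self _).trans ?_
    rw [abs_mul, abs_sub_comm (x' a)]
    exact mul_le_mul_of_nonneg_left (dist_le_pi_dist v v' a) (abs_nonneg _)
  have h6 : ∑ a, (x' a - x a) * (v a + p.reg.grad (p.α s) x a) +
      ∑ a, (x a - x' a) * (v' a + p.reg.grad (p.α s) x' a) =
      ∑ a, (x' a - x a) * (v a - v' a) + ∑ a, p.reg.grad (p.α s) x a * (x' a - x a) +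
        ∑ a, p.reg.grad (p.α s) x' a * (x a - x' a) := by
    rw [← Finset.sum_add_distrib, ← Finset.sum_add_distrib, ← Finset.sum_add_distrib]
    exact Finset.sum_congr rfl fun a _ => by ring
  have h7 : 2 * κ * z ≤ dist v v' := by
    rcases hz0.eq_or_lt with h0 | h0
    · rw [← h0, mul_zero]
      exact dist_nonneg
    · refine le_of_mul_le_mul_left ?_ h0
      linarith
  have h8 : dist x x' ≤ z := (dist_pi_le_iff hz0).2 fun a =>
    Finset.single_le_sum (f := fun a => |x a - x' a|) (fun _ _ => abs_nonneg _)
      (Finset.mem_univ a)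
  refine h8.trans ?_
  rw [one_div_mul_eq_div, le_div_iff₀ (by positivity)]
  linarith

section Measurability

variable {Ω : Type*} {m : MeasurableSpace Ω}

/-- A function that varies at most as much as a measurable vector factors through that vector by a
Lipschitz map, which extends from the range to the whole space. -/
theorem _root_.measurable_of_dist_le_mul {ι κ : Type*} [Fintype ι] [Fintype κ] {f : Ω → ι → ℝ}
    {v : Ω → κ → ℝ} (hv : Measurable v) (K : NNReal)
    (h : ∀ ω ω', dist (f ω) (f ω') ≤ K * dist (v ω) (v ω')) : Measurable f := by
  rcases isEmpty_or_nonempty Ω with _ | _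
  · exact measurable_of_empty f
  choose! r hr using fun y (hy : y ∈ Set.range v) => hy
  have hL : LipschitzOnWith K (fun y => f (r y)) (Set.range v) :=
    LipschitzOnWith.of_dist_le_mul fun y hy y' hy' => by
      have := h (r y) (r y')
      rwa [hr y hy, hr y' hy'] at this
  obtain ⟨g, hg, hgf⟩ := hL.extend_pi
  have h1 : f = g ∘ v := by
    ext1 ω
    have h2 := hgf ⟨ω, rfl⟩
    have h3 := h ω (r (v ω))
    rw [hr (v ω) ⟨ω, rfl⟩, dist_self, mul_zero] at h3
    rw [Function.comp_apply, ← h2]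
    exact dist_le_zero.1 h3
  rw [h1]
  exact hg.continuous.measurable.comp hv

theorem measurable_of_isLazyStep (hp : p.Admissible G) {s : S} {qs : Ω → A s → ℝ} {mu : Ω → ℝ}
    {u₀ x : Ω → A s → ℝ} (hq : ∀ a, Measurable fun ω => qs ω a) (hmu : Measurable mu)
    (hu₀ : ∀ a, Measurable fun ω => u₀ ω a) (hmu0 : ∀ ω, 0 < mu ω) (hu₀p : ∀ ω a, 0 < u₀ ω a)
    (h : ∀ ω, p.IsLazyStep s (qs ω) (mu ω) (u₀ ω) (x ω)) (a : A s) :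
    Measurable fun ω => x ω a := by
  have := hp.nonempty_actions s
  have hκ0 := p.reg.modulus_pos (ι := A s) (hp.α_pos s)
  have hgrad : ∀ a, Measurable fun ω => p.reg.grad (p.α s) (u₀ ω) a := by
    intro a
    unfold RegKind.grad
    cases p.reg
    · exact (hu₀ a).const_mul _
    · exact ((hu₀ a).log.add_const 1).const_mul _
  have hv : Measurable fun ω => p.dualPoint s (qs ω) (mu ω) (u₀ ω) := by
    refine measurable_pi_lambda _ fun a => ?_
    exact ((hq a).neg.sub ((hgrad a).const_mul _)).div ((hmu.const_div _).add_const _)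
  refine (measurable_pi_apply a).comp (measurable_of_dist_le_mul hv
    (Real.toNNReal (1 / (2 * p.reg.modulus (A s) (p.α s)))) fun ω ω' => ?_)
  rw [Real.coe_toNNReal _ (by positivity)]
  exact dist_le_of_isLazyStep hp (hmu0 ω) (hmu0 ω') (hu₀p ω) (hu₀p ω') (h ω) (h ω')

omit [∀ s, Fintype (A s)] in
theorem measurable_playerReach {π : Ω → Profile S A} (hπ : ∀ s a, Measurable fun ω => π ω s a)
    (i : Fin 2) (h : List (GameStep S A C)) : Measurable fun ω => G.playerReach (π ω) i h := by
  unfold EFG.playerReach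
  induction G.playerSeq i h with
  | nil => exact measurable_const
  | cons y l ih =>
    simp only [List.map_cons, List.prod_cons]
    exact (hπ y.1 y.2).mul ih

omit [∀ s, Fintype (A s)] in
theorem measurable_mult {π : Ω → Profile S A} (hπ : ∀ s a, Measurable fun ω => π ω s a) (s : S) :
    Measurable fun ω => p.mult G (π ω) s := by
  unfold mult
  cases p.feedback
  · exact measurable_const
  · simp only [G.at_parentSeq]
    exact (measurable_playerReach hπ _ _).const_div 1
  · simp only [G.oppReach_eq]
    exact Finset.measurable_sum _ fun h _ => (measurable_playerReach hπ _ _).const_mul _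

end Measurability

namespace IsStochasticRun

variable [Fintype S] {Ω : Type*} {mΩ : MeasurableSpace Ω} {P : Measure Ω} {ℱ : Filtration ℕ mΩ} {T : ℕ}
  {π πbar qhat : ℕ → Ω → Profile S A}

theorem boundedRun (hrun : p.IsStochasticRun G P ℱ T π πbar qhat) {ω : Ω}
    (hω : ∀ t ≤ T, ∀ s a, |qhat t ω s a| ≤ p.qBound) :
    p.BoundedRun G T (fun t => π t ω) (fun t => πbar t ω) (fun t => qhat t ω) := by
  obtain ⟨π₁, hf, h1⟩ := hrun.init
  refine ⟨?_, ?_, fun t ht htT => hrun.step t ht htT ω, fun t ht htT => hrun.stepBar t ht htT ω,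
    hω⟩
  · simpa only [(h1 ω).1] using hf
  · simp only [(h1 ω).1, (h1 ω).2]

theorem feasible_bar (hrun : p.IsStochasticRun G P ℱ T π πbar qhat) (ω : Ω) {t : ℕ} (ht : 1 ≤ t)
    (htT : t ≤ T + 1) : p.Feasible (πbar t ω) := by
  rcases ht.eq_or_lt with rfl | ht
  · obtain ⟨π₁, hf, h1⟩ := hrun.init
    rw [(h1 ω).1]
    exact hf
  · obtain ⟨t, rfl⟩ : ∃ u, t = u + 1 := ⟨t - 1, by omega⟩
    exact fun s => (hrun.stepBar t (by omega) (by omega) ω s).1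

theorem feasible (hrun : p.IsStochasticRun G P ℱ T π πbar qhat) (ω : Ω) {t : ℕ}
    (htT : t ≤ T) : p.Feasible (π t ω) := by
  rcases Nat.eq_zero_or_pos t with rfl | ht
  · obtain ⟨π₁, hf, h1⟩ := hrun.init
    rw [(h1 ω).2]
    exact hf
  · exact fun s => (hrun.step t ht htT ω s).1

/-- The strategies at time `t` are determined by the estimates before time `t`. -/
theorem measurable_strategies (hrun : p.IsStochasticRun G P ℱ T π πbar qhat)
    (hp : p.Admissible G) {t : ℕ} (ht : t ≤ T) :
    (∀ s a, Measurable[ℱ (t - 1)] fun ω => π t ω s a) ∧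
      ∀ s a, Measurable[ℱ t] fun ω => πbar (t + 1) ω s a := by
  induction t with
  | zero =>
    obtain ⟨π₁, _, h1⟩ := hrun.init
    simp only [fun ω => (h1 ω).1, fun ω => (h1 ω).2, zero_add]
    exact ⟨fun _ _ => measurable_const, fun _ _ => measurable_const⟩
  | succ t ih =>
    obtain ⟨hx, hb⟩ := ih (by omega)
    have hx' : ∀ s a, Measurable[ℱ t] fun ω => π t ω s a := fun s a =>
      (hx s a).mono (ℱ.mono (Nat.sub_le t 1)) le_rfl
    have hpos : ∀ u ≤ T, ∀ s ω, 0 < p.mult G (π u ω) s := fun u hu s ω =>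
      p.mult_pos G (hp.pos_of_feasible (hrun.feasible ω hu)) s
    have hbpos : ∀ s ω a, 0 < πbar (t + 1) ω s a := fun s ω a =>
      hp.pos_of_feasible (hrun.feasible_bar ω (by omega) (by omega)) s a
    have hy : ∀ s a, Measurable[ℱ t] fun ω => π (t + 1) ω s a := fun s a =>
      measurable_of_isLazyStep (m := ℱ t) hp
        (fun a => (hrun.adapted t (by omega) s a).measurable) (measurable_mult hx' s) (hb s)
        (hpos t (by omega) s) (hbpos s) (fun ω => hrun.step (t + 1) (by omega) ht ω s) a
    have hmono : ℱ t ≤ ℱ (t + 1) := ℱ.mono (Nat.le_succ t)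
    refine ⟨hy, fun s a => ?_⟩
    exact measurable_of_isLazyStep (m := ℱ (t + 1)) hp
      (fun a => (hrun.adapted (t + 1) ht s a).measurable)
      (measurable_mult (fun s a => (hy s a).mono hmono le_rfl) s)
      (fun a => (hb s a).mono hmono le_rfl)
      (hpos (t + 1) ht s) (hbpos s) (fun ω => hrun.stepBar (t + 1) (by omega) ht ω s) a

end IsStochasticRun

end LazyParams

/-! ### The noise of the feedback -/

namespace LazyParams

variable {S : Type*} {A : S → Type*} {C : Type*} [Fintype S] [∀ s, Fintype (A s)] [Fintype C]
  {p : LazyParams S A} {G : EFG S A C}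

theorem abs_noise_le (hp : p.Admissible G) {πs π q qh : Profile S A}
    (hπs : p.Feasible πs) (hπ : p.Feasible π) (hq : ∀ s a, |q s a| ≤ p.qBound)
    (hqh : ∀ s a, |qh s a| ≤ p.qBound) :
    |p.noise G πs π q qh| ≤ 4 * p.M₂ * p.qBound * Fintype.card S := by
  unfold noise
  refine (Finset.abs_sum_le_sum_abs _ _).trans ((Finset.sum_le_card_nsmul _ _
    (4 * p.M₂ * p.qBound) fun s _ => ?_).trans ?_)
  · have hw := G.playerReach_pos (hp.pos_of_feasible hπs) (G.owner s) (G.repr s)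
    have hm := p.mult_pos G (hp.pos_of_feasible hπ) s
    have h1 : |∑ a, (πs s a - π s a) * (q s a - qh s a)| ≤ 4 * p.qBound := by
      refine (Finset.abs_sum_le_sum_abs _ _).trans ?_
      have h2 : ∀ a, |(πs s a - π s a) * (q s a - qh s a)| ≤
          (πs s a + π s a) * (2 * p.qBound) := by
        intro a
        rw [abs_mul]
        refine mul_le_mul ((abs_sub _ _).trans (le_of_eq ?_))
          ((abs_sub _ _).trans (by linarith [hq s a, hqh s a])) (abs_nonneg _) ?_
        · rw [abs_of_nonneg ((hπs s).1.1 a), abs_of_nonneg ((hπ s).1.1 a)]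
        · exact add_nonneg ((hπs s).1.1 a) ((hπ s).1.1 a)
      refine (Finset.sum_le_sum fun a _ => h2 a).trans (le_of_eq ?_)
      rw [← Finset.sum_mul, Finset.sum_add_distrib, (hπs s).1.2, (hπ s).1.2]
      ring
    rw [G.at_parentSeq, abs_mul, abs_mul, abs_of_pos hw, abs_of_pos hm]
    calc _ ≤ 1 * (p.M₂ * (4 * p.qBound)) := by
          refine mul_le_mul (hp.playerReach_le_one hπs _ _) ?_ (by positivity) zero_le_one
          exact mul_le_mul (hp.mult_le_M₂ hπ s) h1 (abs_nonneg _)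
            (hm.le.trans (hp.mult_le_M₂ hπ s))
      _ = _ := by ring
  · rw [Finset.card_univ, nsmul_eq_mul, mul_comm]

namespace IsStochasticRun

variable {Ω : Type*} {mΩ : MeasurableSpace Ω} {P : Measure Ω} [IsProbabilityMeasure P]
  {ℱ : Filtration ℕ mΩ} {T : ℕ} {π πbar qhat : ℕ → Ω → Profile S A}

omit [IsProbabilityMeasure P] in
theorem ae_bounded (hrun : p.IsStochasticRun G P ℱ T π πbar qhat) :
    ∀ᵐ ω ∂P, ∀ t ≤ T, ∀ s a, |qhat t ω s a| ≤ p.qBound := by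
  rw [ae_all_iff]
  intro t
  by_cases ht : t ≤ T
  · have : ∀ᵐ ω ∂P, ∀ s a, |qhat t ω s a| ≤ p.qBound :=
      ae_all_iff.2 fun s => ae_all_iff.2 fun a => hrun.bounded t ht s a
    filter_upwards [this] with ω hω _ using hω
  · exact Filter.Eventually.of_forall fun ω h => absurd h ht

theorem qBound_nonneg (hrun : p.IsStochasticRun G P ℱ T π πbar qhat) (hp : p.Admissible G)
    (s : S) : 0 ≤ p.qBound := by
  obtain ⟨a⟩ := hp.nonempty_actions s
  obtain ⟨ω, hω⟩ := (hrun.bounded 0 (Nat.zero_le T) s a).exists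
  exact (abs_nonneg _).trans hω

/-- The noise at time `t`, with the feedback written as a conditional expectation. -/
noncomputable def noiseAt (p : LazyParams S A) (G : EFG S A C) (P : Measure Ω)
    (ℱ : Filtration ℕ mΩ) (πs : Profile S A) (π qhat : ℕ → Ω → Profile S A) (t : ℕ) (ω : Ω) : ℝ :=
  p.noise G πs (π t ω) (fun s a => P[fun ω => qhat t ω s a | ℱ (t - 1)] ω) (qhat t ω)

theorem integrable_qhat (hrun : p.IsStochasticRun G P ℱ T π πbar qhat) {t : ℕ} (ht : t ≤ T)
    (s : S) (a : A s) : Integrable (fun ω => qhat t ω s a) P :=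
  Integrable.of_bound ((hrun.adapted t ht s a).mono (ℱ.le t)).aestronglyMeasurable p.qBound
    (hrun.bounded t ht s a)

omit [IsProbabilityMeasure P] in
theorem stronglyMeasurable_noiseAt (hrun : p.IsStochasticRun G P ℱ T π πbar qhat)
    (hp : p.Admissible G) (πs : Profile S A) {t : ℕ} (ht : t ≤ T) :
    StronglyMeasurable[ℱ t] (noiseAt p G P ℱ πs π qhat t) := by
  have hmono : ℱ (t - 1) ≤ ℱ t := ℱ.mono (Nat.sub_le t 1)
  have hx : ∀ s a, Measurable[ℱ t] fun ω => π t ω s a := fun s a =>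
    ((hrun.measurable_strategies hp ht).1 s a).mono hmono le_rfl
  unfold noiseAt noise
  refine Finset.stronglyMeasurable_fun_sum _ fun s _ => StronglyMeasurable.const_mul ?_ _
  refine StronglyMeasurable.mul (measurable_mult hx s).stronglyMeasurable ?_
  refine Finset.stronglyMeasurable_fun_sum _ fun a _ => ?_
  exact (stronglyMeasurable_const.sub (hx s a).stronglyMeasurable).mul
    ((stronglyMeasurable_condExp.mono hmono).sub (hrun.adapted t ht s a))

omit [IsProbabilityMeasure P] in
theorem ae_abs_noiseAt_le (hrun : p.IsStochasticRun G P ℱ T π πbar qhat)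
    (hp : p.Admissible G) {πs : Profile S A} (hπs : p.Feasible πs) {t : ℕ}
    (ht : t ≤ T) : ∀ᵐ ω ∂P, |noiseAt p G P ℱ πs π qhat t ω| ≤
      4 * p.M₂ * p.qBound * Fintype.card S := by
  have h1 : ∀ᵐ ω ∂P, ∀ s a, |P[fun ω => qhat t ω s a | ℱ (t - 1)] ω| ≤ p.qBound :=
    ae_all_iff.2 fun s => ae_all_iff.2 fun a =>
      ae_bdd_abs_condExp_of_ae_bdd_abs (hrun.bounded t ht s a)
  filter_upwards [hrun.ae_bounded, h1] with ω hω h1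
  exact abs_noise_le hp hπs (hrun.feasible ω ht) h1 (hω t ht)

theorem condExp_noiseAt (hrun : p.IsStochasticRun G P ℱ T π πbar qhat)
    (hp : p.Admissible G) {πs : Profile S A} (hπs : p.Feasible πs) {t : ℕ} (ht : t ≤ T) :
    P[noiseAt p G P ℱ πs π qhat t | ℱ (t - 1)] =ᵐ[P] 0 := by
  have hx := (hrun.measurable_strategies hp ht).1
  have hle := ℱ.le (t - 1)
  set e : (Σ s, A s) → Ω → ℝ := fun x ω =>
    P[fun ω => qhat t ω x.1 x.2 | ℱ (t - 1)] ω - qhat t ω x.1 x.2 with he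
  set f : (Σ s, A s) → Ω → ℝ := fun x ω => (G.seqForm πs).at (G.parentSeq x.1) *
    (p.mult G (π t ω) x.1 * (πs x.1 x.2 - π t ω x.1 x.2)) with hf
  have hsum : noiseAt p G P ℱ πs π qhat t = ∑ x, f x * e x := by
    ext ω
    simp only [noiseAt, noise, Finset.sum_apply, Fintype.sum_sigma, Pi.mul_apply, he, hf,
      Finset.mul_sum]
    refine Finset.sum_congr rfl fun s _ => Finset.sum_congr rfl fun a _ => ?_
    ring
  have hei : ∀ x, Integrable (e x) P := fun x =>
    integrable_condExp.sub (hrun.integrable_qhat ht x.1 x.2)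
  have hfm : ∀ x, StronglyMeasurable[ℱ (t - 1)] (f x) := fun x =>
    (((measurable_mult hx x.1).mul ((hx x.1 x.2).const_sub _)).const_mul _).stronglyMeasurable
  have hfb : ∀ x, ∀ᵐ ω ∂P, ‖f x ω‖ ≤ p.M₂ := by
    rintro ⟨s, a⟩
    refine Filter.Eventually.of_forall fun ω => ?_
    have hπ := hrun.feasible ω ht
    have hw := G.playerReach_pos (hp.pos_of_feasible hπs) (G.owner s) (G.repr s)
    have hm := p.mult_pos G (hp.pos_of_feasible hπ) s
    simp only [hf]
    rw [Real.norm_eq_abs, abs_mul, abs_mul, G.at_parentSeq, abs_of_pos hw, abs_of_pos hm]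
    have h1 : |πs s a - π t ω s a| ≤ 1 := by
      have h2 := (hπs s).1.1 a
      have h3 := (hπ s).1.1 a
      have h4 := apply_le_one_of_mem_stdSimplex (hπs s).1 a
      have h5 := apply_le_one_of_mem_stdSimplex (hπ s).1 a
      exact abs_le.2 ⟨by linarith, by linarith⟩
    calc _ ≤ 1 * (p.M₂ * 1) := by
          refine mul_le_mul (hp.playerReach_le_one hπs _ _) ?_ (by positivity) zero_le_one
          exact mul_le_mul (hp.mult_le_M₂ hπ s) h1 (abs_nonneg _)
            (hm.le.trans (hp.mult_le_M₂ hπ s))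
      _ = _ := by ring
  have hprod : ∀ x, Integrable (f x * e x) P := fun x =>
    (hei x).bdd_mul ((hfm x).mono hle).aestronglyMeasurable (hfb x)
  have hzero : ∀ x, P[f x * e x | ℱ (t - 1)] =ᵐ[P] 0 := by
    intro x
    refine (condExp_mul_of_stronglyMeasurable_left (hfm x) (hprod x) (hei x)).trans ?_
    have h1 : P[e x | ℱ (t - 1)] =ᵐ[P] 0 := by
      refine (condExp_sub integrable_condExp (hrun.integrable_qhat ht x.1 x.2) _).trans ?_
      rw [condExp_of_stronglyMeasurable hle stronglyMeasurable_condExp integrable_condExp,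
        sub_self]
    filter_upwards [h1] with ω hω
    simp [hω]
  rw [hsum]
  refine (condExp_finsetSum (fun x _ => hprod x) _).trans ?_
  have := ae_all_iff.2 hzero
  filter_upwards [this] with ω hω
  simp [hω]

end IsStochasticRun

end LazyParams

/-! ### The high-probability bound -/

theorem mainTheorem4 {S : Type*} {A : S → Type*} {C : Type*}
    [Fintype S] [∀ s, Fintype (A s)] [Fintype C]
    (G : EFG S A C) (p : LazyParams S A)
    (hp : p.Admissible G) (hη : p.LearningRates G)
    (πs : Profile S A) (hNash : p.IsNash G πs)
    {Ω : Type*} {mΩ : MeasurableSpace Ω} (P : Measure Ω) [IsProbabilityMeasure P]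
    (ℱ : Filtration ℕ mΩ) (T : ℕ) (hT : 1 ≤ T) (π πbar qhat : ℕ → Ω → Profile S A)
    (hrun : p.IsStochasticRun G P ℱ T π πbar qhat)
    (δ : ℝ) (hδ0 : 0 < δ) (hδ1 : δ < 1) :
    ENNReal.ofReal (1 - δ) ≤ P {ω |
      ∑ t ∈ Finset.Icc 2 T,
          bregman (p.jointReg G) (G.seqForm πs) (G.seqForm (πbar t ω)) ≤
        2 * ∑ s, p.cDiv G s * p.ηAnc G s * (G.seqForm πs).at (G.parentSeq s) *
            ∑ t ∈ Finset.Icc 1 T, |p.psi s (π t ω s) - p.psi s (πbar (t + 1) ω s)|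
        + 4 / p.τ * ∑ s, p.cDiff G s * (G.seqForm πs).at (G.parentSeq s) *
            p.qBound * p.η s * p.M₂ * T
        + 2 / p.τ * ∑ s, p.mult G (π 1 ω) s / p.η s * (G.seqForm πs).at (G.parentSeq s) *
            bregman (p.psi s) (πs s) (πbar 1 ω s)
        + 8 / p.τ * p.M₂ * p.qBound * Fintype.card S *
            Real.sqrt (2 * T * Real.log (1 / δ))} := by

  have hπs := hNash.1
  have hT' : ∀ t ∈ Finset.Icc 1 T, t ≤ T := fun t ht => (Finset.mem_Icc.1 ht).2
  rcases isEmpty_or_nonempty S with hS | ⟨⟨s₀⟩⟩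
  · -- Without infosets both sides vanish.
    have h1 : ∀ ω, bregman (p.jointReg G) (G.seqForm πs) (G.seqForm (πbar 0 ω)) = 0 := fun ω => by
      rw [p.bregman_jointReg G (fun s => hS.elim s) (fun s => hS.elim s)]
      simp
    have h2 : ∀ (t : ℕ) ω, πbar t ω = πbar 0 ω := fun t ω => funext fun s => hS.elim s
    simp only [h2, h1]
    simp [ENNReal.ofReal_le_one, hδ0.le]
  have hQ := hrun.qBound_nonneg hp s₀
  have hM₂ : 0 ≤ p.M₂ := (p.mult_pos G (hp.pos_of_feasible hπs) s₀).le.trans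
    (hp.mult_le_M₂ hπs s₀)
  have hτ := hp.τ_pos
  refine (one_sub_le_measure_sum_le hT
    (by positivity : 0 ≤ 4 * p.M₂ * p.qBound * (Fintype.card S : ℝ))
    (fun t ht => hrun.stronglyMeasurable_noiseAt hp πs (hT' t ht))
    (fun t ht => hrun.ae_abs_noiseAt_le hp hπs (hT' t ht))
    (fun t ht => hrun.condExp_noiseAt hp hπs (hT' t ht)) hδ0 hδ1).trans ?_
  refine measure_mono_ae ?_
  have hunb : ∀ᵐ ω ∂P, ∀ t ∈ Finset.Icc 1 T, ∀ s a,
      P[fun ω => qhat t ω s a | ℱ (t - 1)] ω = p.q G (π t ω) s a := by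
    refine (Finset.eventually_all _).2 fun t ht => ?_
    exact ae_all_iff.2 fun s => ae_all_iff.2 fun a =>
      hrun.unbiased t (Finset.mem_Icc.1 ht).1 (hT' t ht) s a
  filter_upwards [hrun.ae_bounded, hunb] with ω hω hu hN
  have hnoise : ∑ t ∈ Finset.Icc 1 T,
      p.noise G πs (π t ω) (fun s a => p.q G (π t ω) s a) (qhat t ω) ≤
      4 * p.M₂ * p.qBound * (Fintype.card S : ℝ) * √(2 * T * Real.log (1 / δ)) := by
    refine le_trans (le_of_eq (Finset.sum_congr rfl fun t ht => ?_)) hN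
    simp only [LazyParams.IsStochasticRun.noiseAt, hu t ht]
  have h1 := (hrun.boundedRun hω).sum_bregman_le hp hη hQ hπs hNash hT
  have h2 := mul_le_mul_of_nonneg_left hnoise (by positivity : 0 ≤ 2 / p.τ)
  refine h1.trans (add_le_add_right (h2.trans (le_of_eq ?_)) _)
  ring
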